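/- Let $r,s\ge 0$ be integers. **Bead diagrams.** An $(r,s)$-bead diagram is a graph with a top and a bottom row of $r+s$ vertices, labelled $1,\dots,r+s$ from left to right in each row, with a vertical wall between the first $r$ and the last $s$ vertices of each row. Every vertex is joined by a strand to exactly one other vertex. A vertical strand (joining a top vertex to a bottom vertex) does not cross the wall, a horizontal strand (joining two vertices of the same row) does, and there are no loops. Each strand carries finitely many (possibly no) beads; the beads of the diagram are numbered $1,\dots,n$, each number being used once. Beads may slide along their strand, but neither leave it nor change their order on it; diagrams that differ by sliding are identified. Let $\widetilde{BD}_{r,s}$ be the complex vector space with basis the $(r,s)$-bead diagrams, with the following bilinear product: for diagrams $d_1,d_2$, place $d_1$ under $d_2$, identify the top vertices of $d_1$ with the bottom vertices of $d_2$, add the number of beads of $d_1$ to every bead number of $d_2$, and concatenate; $d_1d_2=0$ if a loop occurs in the middle row. This is an associative algebra with unit. **The algebra $BD'_{r,s}$ and the ideal $L$.** $BD'_{r,s}$ is the unital subalgebra of $\widetilde{BD}_{r,s}$ generated by: the beadless diagrams $\mathbf s_i$ of the transpositions $(i,i+1)$ with $1\le i\le r-1$ or $r+1\le i\le r+s-1$;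 if $r,s\ge1$, the beadless diagram $\mathbf e_{r,r+1}$ in which the vertices $r$ and $r+1$ are joined in each row and every other top vertex is joined to the bottom vertex with the same label; and the diagrams $\mathbf c_i$ ($1\le i\le r+s$), the identity diagram with one bead, on its $i$-th strand. $L$ is the two-sided ideal of $BD'_{r,s}$ generated by the elements $\mathbf c_k^2+1$ ($1\le k\le r$), $\mathbf c_l^2-1$ ($r+1\le l\le r+s$) and $\mathbf c_i\mathbf c_j+\mathbf c_j\mathbf c_i$ ($1\le i\ne j\le r+s$). **The diagram $\widetilde d$.** The good vertex of a strand is its top vertex if the strand is vertical and its left vertex if it is horizontal. A bead on a horizontal strand of the bottom row has type I, every other bead has type II. For a bead diagram $d$, let $\widetilde d$ be the diagram with the same strands, with one bead on each strand that carries an odd number of beads in $d$ and no bead on the others; the beads of $\widetilde d$ are numbered $1,2,\dots$, first those of type I and then those of type II, and within each type from left to right by the labels of the good vertices of their strands. **The numbers $\beta(d)$ and $\gamma(d)$.** Let $\eta_1<\dots<\eta_p$ be the numbers of the beads of type I of $d$, and $a_j$ the label of the good vertex of the strand carrying the bead $\eta_j$; let $\vartheta_1<\dots<\vartheta_q$ and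 $b_1,\dots,b_q$ be the analogous data for type II. Put * $\ell_1=|\{(j,k): j<k,\ a_j>a_k\}|$ and $\ell_2=|\{(j,k): j<k,\ b_j>b_k\}|$; * $\rho_1=\sum_{i=1}^{r}\lfloor |\{j: a_j=i\}|/2\rfloor$, $\rho_2=\sum_{i=1}^{r}\lfloor |\{j: b_j=i\}|/2\rfloor$ and $\alpha=\sum_{i=r+1}^{r+s}\lfloor |\{j: b_j=i\}|/2\rfloor$; * $p_1=\sum_j |\{k:\eta_k>\eta_j$, and the bead $\eta_k$ lies on the same strand as $\eta_j$, between $\eta_j$ and the good vertex of that strand$\}|$; * $p_2=\sum_j |\{k:\vartheta_k<\vartheta_j$, and the bead $\vartheta_k$ lies on the same strand as $\vartheta_j$, between $\vartheta_j$ and the good vertex of that strand$\}|$; * $c=|\{(j,k): \eta_k>\vartheta_j\}|$; * $\beta(d)=\ell_1+\ell_2+\rho_1+\rho_2+p_1+p_2+c$ and $\gamma(d)=\beta(d)+\alpha$. **Statement.** Let $M$ be the linear span of the elements $d-(-1)^{\beta(d)}\widetilde d$, where $d$ runs over the bead diagrams in $BD'_{r,s}$. Then $L=M$. Moreover, the elements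 $d-(-1)^{\beta(d)}\widetilde d$, where $d$ runs over the bead diagrams in $BD'_{r,s}$ with $\gamma(d)\ge1$, form a basis of the complex vector space $L$ (and are pairwise distinct for distinct $d$). -/

import Mathlib

/-! ### Walks that leave a set -/

/-- `Exits f lab A x y l`: the walk `x, f x, f (f x), …` meets the set `A` (after at least one step)
for the first time at `y`, and `l` is the concatenation of the words `lab z` over the points `z`
visited strictly before `y` (the starting point included). -/
inductive Exits {X : Type} (f : X → X) (lab : X → List ℕ) (A : Set X) : X → X → List ℕ → Prop
  | leave {x : X} : f x ∈ A → Exits f lab A x (f x) (lab x)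
  | step {x y : X} {l : List ℕ} : f x ∉ A → Exits f lab A (f x) y l →
      Exits f lab A x y (lab x ++ l)

namespace Exits

variable {X Y : Type} {f : X → X} {lab : X → List ℕ} {A B : Set X}
  {g : Y → Y} {lab' : Y → List ℕ} {A' : Set Y}

theorem mem {x y : X} {l : List ℕ} (h : Exits f lab A x y l) : y ∈ A := by
  induction h with
  | leave h => exact h
  | step _ _ ih => exact ih

theorem unique {x y y' : X} {l l' : List ℕ} (h : Exits f lab A x y l)
    (h' : Exits f lab A x y' l') : y = y' ∧ l = l' := by
  induction h generalizing y' l' with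
  | leave h =>
    cases h' with
    | leave _ => exact ⟨rfl, rfl⟩
    | step h2 _ => exact absurd h h2
  | step h1 _ ih =>
    cases h' with
    | leave h2 => exact absurd h2 h1
    | step _ h3 =>
      obtain ⟨rfl, rfl⟩ := ih h3
      exact ⟨rfl, rfl⟩

theorem tail {x y : X} {l : List ℕ} (h : Exits f lab A x y l) (hx : f x ∉ A) :
    ∃ l', Exits f lab A (f x) y l' := by
  cases h with
  | leave h => exact absurd h hx
  | step _ h => exact ⟨_, h⟩

theorem of_mem (hAB : A ⊆ B) {x y : X} {l : List ℕ} (h : Exits f lab B x y l) (hy : y ∈ A) :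
    Exits f lab A x y l := by
  induction h with
  | leave _ => exact .leave hy
  | step h1 _ ih => exact .step (fun h => h1 (hAB h)) (ih hy)

theorem append (hAB : A ⊆ B) {x y z : X} {l l' : List ℕ} (h : Exits f lab B x y l) (hy : y ∉ A)
    (h' : Exits f lab A y z l') : Exits f lab A x z (l ++ l') := by
  induction h with
  | leave _ => exact .step hy h'
  | step h1 _ ih =>
    rw [List.append_assoc]
    exact .step (fun h => h1 (hAB h)) (ih hy h')

theorem coarsen (hAB : A ⊆ B) (ι : Y → X) (hA : ∀ y, ι y ∈ A ↔ y ∈ A')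
    (H : ∀ y, Exits f lab B (ι y) (ι (g y)) (lab' y)) {y z : Y} {l : List ℕ}
    (h : Exits g lab' A' y z l) : Exits f lab A (ι y) (ι z) l := by
  induction h with
  | @leave x h => exact (H x).of_mem hAB ((hA _).2 h)
  | @step x y l h1 _ ih => exact (H x).append hAB (fun h => h1 ((hA _).1 h)) ih

/-- A walk that leaves through `A` splits at any earlier visit of `B`. -/
theorem cut (hAB : A ⊆ B) {x q b : X} {l l1 : List ℕ} (h : Exits f lab A x q l)
    (h' : Exits f lab B x b l1) (hb : b ∉ A) :
    ∃ l2, Exits f lab A b q l2 ∧ l = l1 ++ l2 := by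
  induction h generalizing l1 with
  | leave h =>
    cases h' with
    | leave _ => exact absurd h hb
    | step h2 _ => exact absurd (hAB h) h2
  | step h1 h3 ih =>
    cases h' with
    | leave _ => exact ⟨_, h3, rfl⟩
    | step h2 h4 =>
      obtain ⟨l2, h5, rfl⟩ := ih h4
      exact ⟨l2, h5, by simp⟩

/-- A walk that leaves through `A` gives a walk of the coarser system that leaves. -/
theorem refineAux (hAB : A ⊆ B) (ι : Y → X) (hA : ∀ y, ι y ∈ A ↔ y ∈ A')
    (H : ∀ y, ∃ l, Exits f lab B (ι y) (ι (g y)) l) {x q : X} {l : List ℕ}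
    (h : Exits f lab A x q l) :
    (∀ y, x = ι y → ∃ z m, Exits g lab' A' y z m) ∧
      (∀ y m, Exits f lab B x (ι y) m → y ∈ A' ∨ ∃ z m, Exits g lab' A' y z m) := by
  induction h with
  | @leave x h =>
    constructor
    · rintro y rfl
      obtain ⟨l, hl⟩ := H y
      have := hl.unique (.leave (hAB h))
      exact ⟨_, _, .leave ((hA _).1 (this.1 ▸ h))⟩
    · intro y m hm
      have := hm.unique (.leave (hAB h))
      exact .inl ((hA _).1 (this.1 ▸ h))
  | @step x q l h1 h2 ih =>
    have key : ∀ y m, Exits f lab B x (ι y) m → y ∈ A' ∨ ∃ z m, Exits g lab' A' y z m := by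
      intro y m hm
      by_cases hB : f x ∈ B
      · have := hm.unique (.leave hB)
        exact .inr (ih.1 y this.1.symm)
      · obtain ⟨_, h3⟩ := hm.tail hB
        exact ih.2 _ _ h3
    refine ⟨?_, key⟩
    rintro y rfl
    obtain ⟨l, hl⟩ := H y
    by_cases hy : g y ∈ A'
    · exact ⟨_, _, .leave hy⟩
    · obtain h | ⟨z, m, h⟩ := key _ _ hl
      · exact absurd h hy
      · exact ⟨_, _, .step hy h⟩

/-- Every walk leaves through `A` iff every walk reaches `B` and every walk of the coarser
system leaves. -/
theorem total_iff (hAB : A ⊆ B) (ι : Y → X) (hA : ∀ y, ι y ∈ A ↔ y ∈ A')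
    (hB : ∀ x ∈ B, ∃ y, ι y = x)
    (H : ∀ y, Exits f lab B (ι y) (ι (g y)) (lab' y)) :
    (∀ x, ∃ q l, Exits f lab A x q l) ↔
      (∀ x, ∃ q l, Exits f lab B x q l) ∧ ∀ y, ∃ q l, Exits g lab' A' y q l := by
  constructor
  · intro h
    refine ⟨fun x => ?_, fun y => ?_⟩
    · obtain ⟨q, l, hx⟩ := h x
      induction hx with
      | leave h => exact ⟨_, _, .leave (hAB h)⟩
      | @step x q l h1 h2 ih =>
        by_cases hxB : f x ∈ B
        · exact ⟨_, _, .leave hxB⟩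
        · obtain ⟨q, l, h⟩ := ih
          exact ⟨_, _, .step hxB h⟩
    · obtain ⟨q, l, hx⟩ := h (ι y)
      exact (refineAux hAB ι hA (fun y => ⟨_, H y⟩) hx).1 y rfl
  · rintro ⟨h1, h2⟩ x
    obtain ⟨q, l, hx⟩ := h1 x
    by_cases hq : q ∈ A
    · exact ⟨_, _, hx.of_mem hAB hq⟩
    · obtain ⟨y, rfl⟩ := hB q hx.mem
      obtain ⟨z, m, h⟩ := h2 y
      exact ⟨_, _, hx.append hAB hq (h.coarsen hAB ι hA H)⟩

theorem embed (κ κ' : Y → X) (φ : ℕ → ℕ) (hl : ∀ z, lab (κ z) = (lab' z).map φ)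
    (h0 : ∀ z, g z ∈ A' → f (κ z) ∈ B ∧ f (κ z) = κ' (g z))
    (h1 : ∀ z, g z ∉ A' → f (κ z) ∉ B ∧ f (κ z) = κ (g z)) {y z : Y} {l : List ℕ}
    (h : Exits g lab' A' y z l) : Exits f lab B (κ y) (κ' z) (l.map φ) := by
  induction h with
  | @leave x h =>
    rw [← hl, ← (h0 _ h).2]
    exact .leave (h0 _ h).1
  | @step x y l h2 _ ih =>
    rw [List.map_append, ← hl]
    refine .step (h1 _ h2).1 ?_
    rwa [(h1 _ h2).2]

theorem unembed (κ : Y → X)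
    (h1 : ∀ z, g z ∉ A' → f (κ z) ∉ B ∧ f (κ z) = κ (g z)) {x q : X} {l : List ℕ}
    (h : Exits f lab B x q l) : ∀ y, x = κ y → ∃ z m, Exits g lab' A' y z m := by
  induction h with
  | @leave x h =>
    rintro y rfl
    by_cases hy : g y ∈ A'
    · exact ⟨_, _, .leave hy⟩
    · exact absurd h (h1 _ hy).1
  | @step x y l h2 _ ih =>
    rintro y rfl
    by_cases hy : g y ∈ A'
    · exact ⟨_, _, .leave hy⟩
    · obtain ⟨z, m, h⟩ := ih _ (h1 _ hy).2
      exact ⟨_, _, .step hy h⟩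

theorem map_lab (φ : ℕ → ℕ) {x y : X} {l : List ℕ} (h : Exits f lab A x y l) :
    Exits f (fun x => (lab x).map φ) A x y (l.map φ) := by
  induction h with
  | leave h => exact .leave h
  | step h1 _ ih =>
    rw [List.map_append]
    exact .step h1 ih

/-- Walks run backwards. -/
theorem reverse (δ τ : X → X) (hδ : ∀ x, δ (δ x) = x) (hτ : ∀ x, τ (τ x) = x)
    (hA : ∀ x ∈ A, τ x = x) (hf : ∀ x, f x = τ (δ x))
    (hl : ∀ x, lab (δ x) = (lab x).reverse) {x y : X} {l : List ℕ}
    (h : Exits f lab A x y l) (hx : x ∈ A) : Exits f lab A y x l.reverse := by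
  have key : ∀ p m, (τ x ∈ A ∧ p = τ x ∧ m = [] ∨ τ x ∉ A ∧ Exits f lab A (τ x) p m) →
      Exits f lab A y p (l.reverse ++ m) := by
    clear hx
    induction h with
    | @leave x h =>
      intro p m hp
      have e1 : f x = δ x := by rw [← hA _ h, hf, hτ]
      have e2 : f (f x) = τ x := by rw [hf (f x), e1, hδ]
      have e3 : (lab x).reverse = lab (f x) := by rw [e1, hl]
      rw [e3]
      obtain ⟨h1, rfl, rfl⟩ | ⟨h1, h2⟩ := hp
      · rw [List.append_nil, ← e2]
        exact .leave (by rwa [e2])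
      · exact .step (by rwa [e2]) (by rwa [e2])
    | @step x y l h1 _ ih =>
      intro p m hp
      have e1 : τ (f x) = δ x := by rw [hf, hτ]
      have e2 : f (δ x) = τ x := by rw [hf, hδ]
      rw [List.reverse_append, List.append_assoc]
      refine ih _ _ (.inr ⟨fun h => h1 ?_, ?_⟩)
      · have := hA _ h
        rw [hτ] at this
        rwa [this]
      · rw [e1, ← hl]
        obtain ⟨h1, rfl, rfl⟩ | ⟨h1, h2⟩ := hp
        · rw [List.append_nil, ← e2]
          exact .leave (by rwa [e2])
        · exact .step (by rwa [e2]) (by rwa [e2])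
  have := key x [] (.inl ⟨by rwa [hA _ hx], (hA _ hx).symm, rfl⟩)
  rwa [List.append_nil] at this

/-- If all walks leave, then the walks starting in `A` together visit every point once. -/
theorem sum_eq [Fintype X] (hf : Function.Bijective f) (T : X → List ℕ) (Q : X → X)
    (hT : ∀ x, Exits f lab A x (Q x) (T x)) [DecidablePred (· ∈ A)] :
    ∑ x with x ∈ A, (T x : Multiset ℕ) = ∑ x, (lab x : Multiset ℕ) := by
  have h1 : ∀ x, (T x : Multiset ℕ) = lab x + if f x ∈ A then 0 else (T (f x) : Multiset ℕ) := by
    intro x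
    split_ifs with h
    · rw [((hT x).unique (.leave h)).2, add_zero]
    · rw [((hT x).unique (.step h (hT _))).2]
      rfl
  have h2 : ∑ x, (T x : Multiset ℕ) =
      ∑ x, (lab x : Multiset ℕ) + ∑ x with x ∉ A, (T x : Multiset ℕ) := by
    rw [Finset.sum_congr rfl fun x _ => h1 x, Finset.sum_add_distrib]
    congr 1
    rw [hf.sum_comp (fun x => if x ∈ A then 0 else (T x : Multiset ℕ)), Finset.sum_filter]
    exact Finset.sum_congr rfl fun x _ => by by_cases h : x ∈ A <;> simp only [h, if_true, if_false, not_true, not_false_eq_true]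
  rw [← Finset.sum_filter_add_sum_filter_not _ (· ∈ A)] at h2
  exact add_right_cancel h2

end Exits

/-! ### Bead diagrams -/

/-- The vertices of an `(r, s)`-bead diagram: `(false, i)` is the vertex number `i` of the bottom
row, `(true, i)` the vertex number `i` of the top row. Vertices are numbered from `0`; those with
number `< r` lie to the left of the wall. -/
abbrev BeadVertex (r s : ℕ) : Type := Bool × Fin (r + s)

/-- An `(r, s)`-bead diagram (up to sliding beads along strands). A strand joins `v` and
`partner v`. A strand joins two vertices of the same row iff it crosses the wall (in particular
`partner v ≠ v`). `beads v` is the list of the numbers of the beads met when running through the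
strand of `v` from `v` to `partner v`. -/
@[ext]
structure BeadDiagram (r s : ℕ) where
  partner : BeadVertex r s → BeadVertex r s
  partner_partner : ∀ v, partner (partner v) = v
  wall : ∀ v, (partner v).1 = v.1 ↔ ¬ ((partner v).2.val < r ↔ v.2.val < r)
  /-- the number of beads -/
  numBeads : ℕ
  beads : BeadVertex r s → List ℕ
  beads_partner : ∀ v, beads (partner v) = (beads v).reverse
  /-- Each of the numbers `1, …, numBeads` is carried by exactly one bead, and no other number is
  used. (Every bead is counted twice, once from each end of its strand.) -/
  beads_number : ∑ v, (beads v : Multiset ℕ) = 2 • (Multiset.range numBeads).map (· + 1)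

namespace BeadDiagram

variable {r s : ℕ}

theorem ext' {d d' : BeadDiagram r s} (h1 : ∀ v, d.partner v = d'.partner v)
    (h2 : ∀ v, d.beads v = d'.beads v) : d = d' := by
  have h3 : d.numBeads = d'.numBeads := by
    have e := congrArg Multiset.card d.beads_number
    have e' := congrArg Multiset.card d'.beads_number
    rw [funext h2] at e
    rw [e] at e'
    simpa using e'
  exact BeadDiagram.ext (funext h1) h3 (funext h2)

/-- The parity of (row) + (side of the wall). -/
def orient (v : BeadVertex r s) : Bool := xor v.1 (decide (v.2.val < r))

theorem wall_iff (v w : BeadVertex r s) :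
    (w.1 = v.1 ↔ ¬ (w.2.val < r ↔ v.2.val < r)) ↔ orient w = !orient v := by
  obtain ⟨a, i⟩ := v
  obtain ⟨b, j⟩ := w
  unfold orient
  by_cases h1 : i.val < r <;> by_cases h2 : j.val < r <;> cases a <;> cases b <;> simp [h1, h2]

/-! #### Multiplication -/

/-- The vertices of two stacked diagrams: `(false, v)` is the vertex `v` of the lower diagram,
`(true, v)` the vertex `v` of the upper one. -/
abbrev Stack (r s : ℕ) : Type := Bool × BeadVertex r s

/-- Pass from a vertex in the middle of the stack to the vertex it is identified with: the top
vertex `i` of the lower diagram and the bottom vertex `i` of the upper one are interchanged. The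
other vertices are fixed. -/
def glue : Stack r s → Stack r s
  | (false, (true, i)) => (true, (false, i))
  | (true, (false, i)) => (false, (true, i))
  | (false, (false, i)) => (false, (false, i))
  | (true, (true, i)) => (true, (true, i))

/-- The bottom vertices of the lower diagram and the top vertices of the upper one. -/
def outer : Set (Stack r s) := {p | p.1 = p.2.1}

/-- A vertex of the product diagram as a vertex of the stack. -/
def toStack (v : BeadVertex r s) : Stack r s := (v.1, v)

/-- Run through the strand of `p` in its diagram, and enter the other diagram if the end of that
strand lies in the middle of the stack. -/
def move (d₁ d₂ : BeadDiagram r s) (p : Stack r s) : Stack r s :=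
  glue (p.1, if p.1 then d₂.partner p.2 else d₁.partner p.2)

/-- The bead numbers met on the way; those of the upper diagram are shifted. -/
def stackBeads (d₁ d₂ : BeadDiagram r s) (p : Stack r s) : List ℕ :=
  if p.1 then (d₂.beads p.2).map (· + d₁.numBeads) else d₁.beads p.2

/-- There is no loop in the middle row: from every vertex of the stack one gets out. -/
def NoLoop (d₁ d₂ : BeadDiagram r s) : Prop :=
  ∀ p, ∃ q l, Exits (move d₁ d₂) (stackBeads d₁ d₂) outer p q l

theorem glue_glue (p : Stack r s) : glue (glue p) = p := by
  rcases p with ⟨_ | _, _ | _, i⟩ <;> rfl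

theorem glue_outer (p : Stack r s) (hp : p ∈ outer) : glue p = p := by
  rcases p with ⟨_ | _, _ | _, i⟩ <;> first | rfl | (simp [outer] at hp)

/-- The other end of the strand of `p` in its diagram. -/
def stackPartner (d₁ d₂ : BeadDiagram r s) (p : Stack r s) : Stack r s :=
  (p.1, if p.1 then d₂.partner p.2 else d₁.partner p.2)

theorem stackPartner_stackPartner (d₁ d₂ : BeadDiagram r s) (p : Stack r s) :
    stackPartner d₁ d₂ (stackPartner d₁ d₂ p) = p := by
  rcases p with ⟨_ | _, v⟩ <;> simp [stackPartner, partner_partner]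

theorem stackBeads_stackPartner (d₁ d₂ : BeadDiagram r s) (p : Stack r s) :
    stackBeads d₁ d₂ (stackPartner d₁ d₂ p) = (stackBeads d₁ d₂ p).reverse := by
  rcases p with ⟨_ | _, v⟩ <;> simp [stackPartner, stackBeads, beads_partner]

theorem move_bijective (d₁ d₂ : BeadDiagram r s) : Function.Bijective (move d₁ d₂) :=
  (Function.Involutive.bijective glue_glue).comp
    (Function.Involutive.bijective (stackPartner_stackPartner d₁ d₂))

theorem toStack_mem (v : BeadVertex r s) : toStack v ∈ outer := rfl

theorem toStack_of_mem {p : Stack r s} (hp : p ∈ outer) : toStack p.2 = p :=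
  Prod.ext hp.symm rfl

theorem exits_reverse {d₁ d₂ : BeadDiagram r s} {p q : Stack r s} {l : List ℕ}
    (h : Exits (move d₁ d₂) (stackBeads d₁ d₂) outer p q l) (hp : p ∈ outer) :
    Exits (move d₁ d₂) (stackBeads d₁ d₂) outer q p l.reverse :=
  h.reverse (stackPartner d₁ d₂) glue (stackPartner_stackPartner d₁ d₂) glue_glue glue_outer
    (fun _ => rfl) (stackBeads_stackPartner d₁ d₂) hp

theorem orient_partner (d : BeadDiagram r s) (v : BeadVertex r s) :
    orient (d.partner v) = !orient v := (wall_iff _ _).1 (d.wall v)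

theorem exits_orient {d₁ d₂ : BeadDiagram r s} {p q : Stack r s} {l : List ℕ}
    (h : Exits (move d₁ d₂) (stackBeads d₁ d₂) outer p q l) : orient q.2 = !orient p.2 := by
  have key : ∀ p : Stack r s, orient (stackPartner d₁ d₂ p).2 = !orient p.2 := by
    rintro ⟨_ | _, v⟩ <;> simp [stackPartner, orient_partner]
  induction h with
  | @leave p h =>
    rw [← key]
    have : move d₁ d₂ p = stackPartner d₁ d₂ p := by
      rw [← glue_outer _ h]
      exact glue_glue _
    rw [this]
  | @step p q l h _ ih =>
    rw [ih]
    have : ∀ p : Stack r s, glue p ∉ outer → orient (glue p).2 = !orient p.2 := by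
      rintro ⟨_ | _, _ | _, i⟩ h <;> by_cases hi : i.val < r <;>
        simp [glue, outer, orient, hi] at h ⊢
    have h2 := this (stackPartner d₁ d₂ p) h
    rw [key] at h2
    exact congrArg _ (h2.trans (Bool.not_not _))

instance : DecidablePred (· ∈ (outer : Set (Stack r s))) := fun p =>
  inferInstanceAs (Decidable (p.1 = p.2.1))

/-- The concatenated diagram, in the absence of loops. -/
noncomputable def concat (d₁ d₂ : BeadDiagram r s) (h : NoLoop d₁ d₂) : BeadDiagram r s where
  partner v := (h (toStack v)).choose.2
  beads v := (h (toStack v)).choose_spec.choose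
  numBeads := d₁.numBeads + d₂.numBeads
  partner_partner v := by
    have h1 := (h (toStack v)).choose_spec.choose_spec
    have h2 := exits_reverse h1 (toStack_mem v)
    have h3 := (h (toStack (h (toStack v)).choose.2)).choose_spec.choose_spec
    have h4 := toStack_of_mem h1.mem
    generalize toStack (h (toStack v)).choose.2 = x at h3 h4 ⊢
    subst h4
    exact congrArg Prod.snd (h3.unique h2).1
  wall v := (wall_iff _ _).2 (exits_orient (h (toStack v)).choose_spec.choose_spec)
  beads_partner v := by
    have h1 := (h (toStack v)).choose_spec.choose_spec
    have h2 := exits_reverse h1 (toStack_mem v)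
    have h3 := (h (toStack (h (toStack v)).choose.2)).choose_spec.choose_spec
    have h4 := toStack_of_mem h1.mem
    generalize toStack (h (toStack v)).choose.2 = x at h3 h4 ⊢
    subst h4
    exact (h3.unique h2).2
  beads_number := by
    have h1 := Exits.sum_eq (move_bijective d₁ d₂) _ _
      (fun x => (h x).choose_spec.choose_spec)
    have h2 : ∑ v : BeadVertex r s, ((h (toStack v)).choose_spec.choose : Multiset ℕ) =
        ∑ x with x ∈ outer, ((h x).choose_spec.choose : Multiset ℕ) := by
      refine Finset.sum_nbij' toStack Prod.snd (fun v _ => ?_) (fun _ _ => Finset.mem_univ _)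
        (fun _ _ => rfl) (fun x hx => toStack_of_mem ?_) (fun _ _ => rfl)
      · exact Finset.mem_filter.2 ⟨Finset.mem_univ _, toStack_mem v⟩
      · exact (Finset.mem_filter.1 hx).2
    rw [h2, h1, Fintype.sum_prod_type, Fintype.sum_bool]
    have h3 : ∑ v, (stackBeads d₁ d₂ (true, v) : Multiset ℕ) =
        2 • ((Multiset.range d₂.numBeads).map (· + 1)).map (· + d₁.numBeads) := by
      have := congrArg (Multiset.mapAddMonoidHom (· + d₁.numBeads)) d₂.beads_number
      rw [map_sum, map_nsmul] at this
      exact this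
    have h4 : ∑ v, (stackBeads d₁ d₂ (false, v) : Multiset ℕ) =
        2 • (Multiset.range d₁.numBeads).map (· + 1) := d₁.beads_number
    rw [h3, h4, ← nsmul_add, Multiset.range_add, Multiset.map_add, add_comm, Multiset.map_map,
      Multiset.map_map]
    congr 3
    funext x
    simp only [Function.comp]
    omega

theorem exits_concat {d₁ d₂ : BeadDiagram r s} (h : NoLoop d₁ d₂) (v : BeadVertex r s) :
    Exits (move d₁ d₂) (stackBeads d₁ d₂) outer (toStack v)
      (toStack ((concat d₁ d₂ h).partner v)) ((concat d₁ d₂ h).beads v) := by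
  have h1 := (h (toStack v)).choose_spec.choose_spec
  have h2 : toStack ((concat d₁ d₂ h).partner v) = (h (toStack v)).choose :=
    toStack_of_mem h1.mem
  rw [h2]
  exact h1

theorem concat_eq {d₁ d₂ : BeadDiagram r s} (h : NoLoop d₁ d₂) {d : BeadDiagram r s}
    (hd : ∀ v, Exits (move d₁ d₂) (stackBeads d₁ d₂) outer (toStack v)
      (toStack (d.partner v)) (d.beads v)) : concat d₁ d₂ h = d :=
  ext' (fun v => congrArg Prod.snd ((exits_concat h v).unique (hd v)).1)
    (fun v => ((exits_concat h v).unique (hd v)).2)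

open scoped Classical in
/-- The product of two bead diagrams (`d₁` is put under `d₂`); `none` stands for zero. -/
noncomputable def mul (d₁ d₂ : BeadDiagram r s) : Option (BeadDiagram r s) :=
  if h : NoLoop d₁ d₂ then some (concat d₁ d₂ h) else none

/-- The diagram with strands given by a permutation that preserves the two sides of the wall
and no beads. -/
def ofPerm (σ : Equiv.Perm (Fin (r + s))) (hσ : ∀ i, (σ i).val < r ↔ i.val < r) :
    BeadDiagram r s where
  partner v := if v.1 then (false, σ.symm v.2) else (true, σ v.2)
  partner_partner v := by rcases v with ⟨_ | _, i⟩ <;> simp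
  wall v := by
    rcases v with ⟨_ | _, i⟩
    · simp [hσ]
    · have := hσ (σ.symm i)
      rw [Equiv.apply_symm_apply] at this
      simp [this]
  numBeads := 0
  beads _ := []
  beads_partner _ := rfl
  beads_number := by simp

/-- The identity diagram. -/
instance : One (BeadDiagram r s) := ⟨ofPerm (Equiv.refl _) fun _ => Iff.rfl⟩

/-! #### Associativity -/

/-- The vertices of three stacked diagrams. -/
abbrev Stack₃ (r s : ℕ) : Type := Fin 3 × BeadVertex r s

def glue₃ : Stack₃ r s → Stack₃ r s
  | (0, (true, i)) => (1, (false, i))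
  | (1, (false, i)) => (0, (true, i))
  | (1, (true, i)) => (2, (false, i))
  | (2, (false, i)) => (1, (true, i))
  | (0, (false, i)) => (0, (false, i))
  | (2, (true, i)) => (2, (true, i))

def move₃ (a b c : BeadDiagram r s) : Stack₃ r s → Stack₃ r s
  | (0, v) => glue₃ (0, a.partner v)
  | (1, v) => glue₃ (1, b.partner v)
  | (2, v) => glue₃ (2, c.partner v)

def stackBeads₃ (a b c : BeadDiagram r s) : Stack₃ r s → List ℕ
  | (0, v) => a.beads v
  | (1, v) => (b.beads v).map (· + a.numBeads)
  | (2, v) => (c.beads v).map (· + (a.numBeads + b.numBeads))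

def outer₃ : Set (Stack₃ r s) := {p | p.1 = 0 ∧ p.2.1 = false ∨ p.1 = 2 ∧ p.2.1 = true}

def outerL : Set (Stack₃ r s) :=
  {p | p.1 = 0 ∧ p.2.1 = false ∨ p.1 = 1 ∧ p.2.1 = true ∨ p.1 = 2}

def outerR : Set (Stack₃ r s) :=
  {p | p.1 = 2 ∧ p.2.1 = true ∨ p.1 = 1 ∧ p.2.1 = false ∨ p.1 = 0}

def inL : Stack r s → Stack₃ r s
  | (false, v) => (0, v)
  | (true, v) => (1, v)

def inR : Stack r s → Stack₃ r s
  | (false, v) => (1, v)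
  | (true, v) => (2, v)

def atL : Stack r s → Stack₃ r s
  | (false, (false, i)) => (0, (false, i))
  | (false, (true, i)) => (1, (true, i))
  | (true, v) => (2, v)

def atR : Stack r s → Stack₃ r s
  | (false, v) => (0, v)
  | (true, (false, i)) => (1, (false, i))
  | (true, (true, i)) => (2, (true, i))

theorem fin3 (k : Fin 3) : k = 0 ∨ k = 1 ∨ k = 2 := by omega

theorem embedL_out (a b c : BeadDiagram r s) (z : Stack r s) (hz : move a b z ∈ outer) :
    move₃ a b c (inL z) ∈ outerL ∧ move₃ a b c (inL z) = glue₃ (inL (move a b z)) := by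
  rcases z with ⟨_ | _, v⟩
  · rcases h : a.partner v with ⟨t, i⟩
    cases t <;> simp_all [move, move₃, inL, glue, glue₃, outer, outerL]
  · rcases h : b.partner v with ⟨t, i⟩
    cases t <;> simp_all [move, move₃, inL, glue, glue₃, outer, outerL]

theorem embedL_in (a b c : BeadDiagram r s) (z : Stack r s) (hz : move a b z ∉ outer) :
    move₃ a b c (inL z) ∉ outerL ∧ move₃ a b c (inL z) = inL (move a b z) := by
  rcases z with ⟨_ | _, v⟩
  · rcases h : a.partner v with ⟨t, i⟩
    cases t <;> simp_all [move, move₃, inL, glue, glue₃, outer, outerL]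
  · rcases h : b.partner v with ⟨t, i⟩
    cases t <;> simp_all [move, move₃, inL, glue, glue₃, outer, outerL]

theorem embedR_out (a b c : BeadDiagram r s) (z : Stack r s) (hz : move b c z ∈ outer) :
    move₃ a b c (inR z) ∈ outerR ∧ move₃ a b c (inR z) = glue₃ (inR (move b c z)) := by
  rcases z with ⟨_ | _, v⟩
  · rcases h : b.partner v with ⟨t, i⟩
    cases t <;> simp_all [move, move₃, inR, glue, glue₃, outer, outerR]
  · rcases h : c.partner v with ⟨t, i⟩
    cases t <;> simp_all [move, move₃, inR, glue, glue₃, outer, outerR]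

theorem embedR_in (a b c : BeadDiagram r s) (z : Stack r s) (hz : move b c z ∉ outer) :
    move₃ a b c (inR z) ∉ outerR ∧ move₃ a b c (inR z) = inR (move b c z) := by
  rcases z with ⟨_ | _, v⟩
  · rcases h : b.partner v with ⟨t, i⟩
    cases t <;> simp_all [move, move₃, inR, glue, glue₃, outer, outerR]
  · rcases h : c.partner v with ⟨t, i⟩
    cases t <;> simp_all [move, move₃, inR, glue, glue₃, outer, outerR]

theorem beadsL (a b c : BeadDiagram r s) (z : Stack r s) :
    stackBeads₃ a b c (inL z) = (stackBeads a b z).map id := by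
  rcases z with ⟨_ | _, v⟩ <;> simp [stackBeads, stackBeads₃, inL]

theorem beadsR (a b c : BeadDiagram r s) (z : Stack r s) :
    stackBeads₃ a b c (inR z) = (stackBeads b c z).map (· + a.numBeads) := by
  rcases z with ⟨_ | _, v⟩ <;> simp [stackBeads, stackBeads₃, inR]
  intros
  omega

def NoLoop₃ (a b c : BeadDiagram r s) : Prop :=
  ∀ p, ∃ q l, Exits (move₃ a b c) (stackBeads₃ a b c) outer₃ p q l

theorem outer_subL : (outer₃ : Set (Stack₃ r s)) ⊆ outerL := by
  rintro ⟨k, t, i⟩ h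
  simp only [outer₃, outerL, Set.mem_ofPred_eq] at h ⊢
  tauto

theorem outer_subR : (outer₃ : Set (Stack₃ r s)) ⊆ outerR := by
  rintro ⟨k, t, i⟩ h
  simp only [outer₃, outerR, Set.mem_ofPred_eq] at h ⊢
  tauto

theorem atL_mem (y : Stack r s) : atL y ∈ outer₃ ↔ y ∈ outer := by
  rcases y with ⟨_ | _, _ | _, i⟩ <;> simp [atL, outer₃, outer]

theorem atR_mem (y : Stack r s) : atR y ∈ outer₃ ↔ y ∈ outer := by
  rcases y with ⟨_ | _, _ | _, i⟩ <;> simp [atR, outer₃, outer]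

theorem atL_surj (x : Stack₃ r s) (hx : x ∈ outerL) : ∃ y, atL y = x := by
  rcases x with ⟨k, t, i⟩
  obtain rfl | rfl | rfl := fin3 k <;> cases t <;> simp [outerL] at hx
  · exact ⟨(false, (false, i)), rfl⟩
  · exact ⟨(false, (true, i)), rfl⟩
  · exact ⟨(true, (false, i)), rfl⟩
  · exact ⟨(true, (true, i)), rfl⟩

theorem atR_surj (x : Stack₃ r s) (hx : x ∈ outerR) : ∃ y, atR y = x := by
  rcases x with ⟨k, t, i⟩
  obtain rfl | rfl | rfl := fin3 k <;> cases t <;> simp [outerR] at hx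
  · exact ⟨(false, (false, i)), rfl⟩
  · exact ⟨(false, (true, i)), rfl⟩
  · exact ⟨(true, (false, i)), rfl⟩
  · exact ⟨(true, (true, i)), rfl⟩

theorem stepL {a b : BeadDiagram r s} (c : BeadDiagram r s) (h : NoLoop a b) (y : Stack r s) :
    Exits (move₃ a b c) (stackBeads₃ a b c) outerL (atL y) (atL (move (concat a b h) c y))
      (stackBeads (concat a b h) c y) := by
  rcases y with ⟨_ | _, v⟩
  · have h1 := (exits_concat h v).embed inL (glue₃ ∘ inL) id (beadsL a b c)
      (embedL_out a b c) (embedL_in a b c)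
    have e1 : inL (toStack v) = atL (false, v) := by
      rcases v with ⟨_ | _, i⟩ <;> rfl
    have e2 : (glue₃ ∘ inL) (toStack ((concat a b h).partner v)) =
        atL (move (concat a b h) c (false, v)) := by
      show _ = atL (glue (false, (concat a b h).partner v))
      rcases (concat a b h).partner v with ⟨_ | _, i⟩ <;> rfl
    rw [e1, e2, List.map_id] at h1
    exact h1
  · have e1 : atL (move (concat a b h) c (true, v)) = move₃ a b c (atL (true, v)) := by
      show atL (glue (true, c.partner v)) = glue₃ (2, c.partner v)
      rcases c.partner v with ⟨_ | _, i⟩ <;> rfl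
    rw [e1]
    refine .leave ?_
    show glue₃ (2, c.partner v) ∈ outerL
    rcases c.partner v with ⟨_ | _, i⟩ <;> simp [glue₃, outerL]

theorem stepR (a : BeadDiagram r s) {b c : BeadDiagram r s} (h : NoLoop b c) (y : Stack r s) :
    Exits (move₃ a b c) (stackBeads₃ a b c) outerR (atR y) (atR (move a (concat b c h) y))
      (stackBeads a (concat b c h) y) := by
  rcases y with ⟨_ | _, v⟩
  · have e1 : atR (move a (concat b c h) (false, v)) = move₃ a b c (atR (false, v)) := by
      show atR (glue (false, a.partner v)) = glue₃ (0, a.partner v)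
      rcases a.partner v with ⟨_ | _, i⟩ <;> rfl
    rw [e1]
    refine .leave ?_
    show glue₃ (0, a.partner v) ∈ outerR
    rcases a.partner v with ⟨_ | _, i⟩ <;> simp [glue₃, outerR]
  · have h1 := (exits_concat h v).embed inR (glue₃ ∘ inR) (· + a.numBeads) (beadsR a b c)
      (embedR_out a b c) (embedR_in a b c)
    have e1 : inR (toStack v) = atR (true, v) := by
      rcases v with ⟨_ | _, i⟩ <;> rfl
    have e2 : (glue₃ ∘ inR) (toStack ((concat b c h).partner v)) =
        atR (move a (concat b c h) (true, v)) := by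
      show _ = atR (glue (true, (concat b c h).partner v))
      rcases (concat b c h).partner v with ⟨_ | _, i⟩ <;> rfl
    rw [e1, e2] at h1
    exact h1

theorem noLoopL {a b : BeadDiagram r s} (c : BeadDiagram r s) (h : NoLoop a b) :
    NoLoop (concat a b h) c ↔ NoLoop₃ a b c := by
  unfold NoLoop₃
  rw [Exits.total_iff outer_subL atL atL_mem atL_surj (stepL c h)]
  refine ⟨fun h1 => ⟨?_, h1⟩, And.right⟩
  rintro ⟨k, v⟩
  obtain rfl | rfl | rfl := fin3 k
  · obtain ⟨q, l, h2⟩ := h (false, v)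
    exact ⟨_, _, h2.embed inL (glue₃ ∘ inL) id (beadsL a b c) (embedL_out a b c) (embedL_in a b c)⟩
  · obtain ⟨q, l, h2⟩ := h (true, v)
    exact ⟨_, _, h2.embed inL (glue₃ ∘ inL) id (beadsL a b c) (embedL_out a b c) (embedL_in a b c)⟩
  · exact ⟨_, _, stepL c h (true, v)⟩

theorem noLoopR (a : BeadDiagram r s) {b c : BeadDiagram r s} (h : NoLoop b c) :
    NoLoop a (concat b c h) ↔ NoLoop₃ a b c := by
  unfold NoLoop₃
  rw [Exits.total_iff outer_subR atR atR_mem atR_surj (stepR a h)]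
  refine ⟨fun h1 => ⟨?_, h1⟩, And.right⟩
  rintro ⟨k, v⟩
  obtain rfl | rfl | rfl := fin3 k
  · exact ⟨_, _, stepR a h (false, v)⟩
  · obtain ⟨q, l, h2⟩ := h (false, v)
    exact ⟨_, _, h2.embed inR (glue₃ ∘ inR) (· + a.numBeads) (beadsR a b c) (embedR_out a b c)
      (embedR_in a b c)⟩
  · obtain ⟨q, l, h2⟩ := h (true, v)
    exact ⟨_, _, h2.embed inR (glue₃ ∘ inR) (· + a.numBeads) (beadsR a b c) (embedR_out a b c)
      (embedR_in a b c)⟩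

theorem exits_sub {X : Type} {f : X → X} {lab : X → List ℕ} {A B : Set X} (hAB : A ⊆ B)
    {x y : X} {l : List ℕ} (h : Exits f lab A x y l) : ∃ q l, Exits f lab B x q l := by
  induction h with
  | leave h => exact ⟨_, _, .leave (hAB h)⟩
  | @step x q l h1 h2 ih =>
    by_cases hxB : f x ∈ B
    · exact ⟨_, _, .leave hxB⟩
    · obtain ⟨q, l, h⟩ := ih
      exact ⟨_, _, .step hxB h⟩

theorem noLoop_left {a b c : BeadDiagram r s} (h : NoLoop₃ a b c) : NoLoop a b := by
  intro y
  obtain ⟨q, l, h1⟩ := h (inL y)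
  obtain ⟨q, l, h1⟩ := exits_sub outer_subL h1
  exact h1.unembed inL (embedL_in a b c) y rfl

theorem noLoop_right {a b c : BeadDiagram r s} (h : NoLoop₃ a b c) : NoLoop b c := by
  intro y
  obtain ⟨q, l, h1⟩ := h (inR y)
  obtain ⟨q, l, h1⟩ := exits_sub outer_subR h1
  exact h1.unembed inR (embedR_in a b c) y rfl

theorem toStack_LR (v : BeadVertex r s) : atL (toStack v) = atR (toStack v) := by
  rcases v with ⟨_ | _, i⟩ <;> rfl

theorem atR_injective : Function.Injective (atR : Stack r s → Stack₃ r s) := by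
  rintro ⟨_ | _, _ | _, i⟩ ⟨_ | _, _ | _, j⟩ h <;> simp [atR] at h ⊢ <;> exact h

theorem concat_assoc {a b c : BeadDiagram r s} (h₁ : NoLoop a b) (h₂ : NoLoop (concat a b h₁) c)
    (h₃ : NoLoop b c) (h₄ : NoLoop a (concat b c h₃)) :
    concat (concat a b h₁) c h₂ = concat a (concat b c h₃) h₄ := by
  have key : ∀ v, toStack ((concat (concat a b h₁) c h₂).partner v) =
        toStack ((concat a (concat b c h₃) h₄).partner v) ∧
      (concat (concat a b h₁) c h₂).beads v = (concat a (concat b c h₃) h₄).beads v := by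
    intro v
    have e1 := (exits_concat h₂ v).coarsen outer_subL atL atL_mem (stepL c h₁)
    have e2 := (exits_concat h₄ v).coarsen outer_subR atR atR_mem (stepR a h₃)
    rw [toStack_LR, toStack_LR] at e1
    have := e1.unique e2
    exact ⟨atR_injective this.1, this.2⟩
  refine ext' (fun v => ?_) fun v => (key v).2
  have := congrArg Prod.snd (key v).1
  exact this

open scoped Classical in
theorem mul_assoc' (a b c : BeadDiagram r s) :
    (mul a b).bind (fun d => mul d c) = (mul b c).bind (fun d => mul a d) := by
  unfold mul
  by_cases h : NoLoop₃ a b c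
  · have h₁ := noLoop_left h
    have h₃ := noLoop_right h
    have h₂ := (noLoopL c h₁).2 h
    have h₄ := (noLoopR a h₃).2 h
    simp only [h₁, h₃, h₂, h₄, dite_true, Option.bind_some, concat_assoc h₁ h₂ h₃ h₄]
  · have e1 : ((if h : NoLoop a b then some (concat a b h) else none).bind fun d =>
        if h : NoLoop d c then some (concat d c h) else none) = none := by
      by_cases h₁ : NoLoop a b
      · have h₂ : ¬ NoLoop (concat a b h₁) c := fun h' => h ((noLoopL c h₁).1 h')
        simp only [h₁, h₂, dite_true, dite_false, Option.bind_some]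
      · simp only [h₁, dite_false, Option.bind_none]
    have e2 : ((if h : NoLoop b c then some (concat b c h) else none).bind fun d =>
        if h : NoLoop a d then some (concat a d h) else none) = none := by
      by_cases h₁ : NoLoop b c
      · have h₂ : ¬ NoLoop a (concat b c h₁) := fun h' => h ((noLoopR a h₁).1 h')
        simp only [h₁, h₂, dite_true, dite_false, Option.bind_some]
      · simp only [h₁, dite_false, Option.bind_none]
    rw [e1, e2]

theorem one_exits (d : BeadDiagram r s) (v : BeadVertex r s) :
    Exits (move 1 d) (stackBeads 1 d) outer (true, v) (toStack (d.partner v)) (d.beads v) := by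
  have hl : stackBeads 1 d (true, v) = d.beads v :=
    (List.map_congr_left fun x _ => Nat.add_zero x).trans (List.map_id _)
  rcases h : d.partner v with ⟨t, i⟩
  cases t
  · have h1 : move 1 d (true, v) = (false, (true, i)) := by simp [move, h, glue]
    have h2 : move 1 d (false, (true, i)) = toStack (false, i) := rfl
    have h3 := Exits.leave (lab := stackBeads 1 d) (h2 ▸ toStack_mem (false, i))
    have h4 := Exits.step (h1 ▸ by simp [outer]) (h1 ▸ h3)
    rw [hl, h1, h2, show stackBeads 1 d (false, (true, i)) = [] from rfl, List.append_nil] at h4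
    exact h4
  · have h1 : move 1 d (true, v) = toStack (true, i) := by simp [move, h, glue, toStack]
    rw [← h1, ← hl]
    exact .leave (h1 ▸ toStack_mem _)

theorem one_exits_bot (d : BeadDiagram r s) (i : Fin (r + s)) :
    Exits (move 1 d) (stackBeads 1 d) outer (false, (false, i)) (toStack (d.partner (false, i)))
      (d.beads (false, i)) := by
  have h1 : move 1 d (false, (false, i)) = (true, (false, i)) := rfl
  exact Exits.step (lab := stackBeads 1 d) (h1 ▸ by simp [outer])
    (h1 ▸ one_exits d (false, i))

theorem one_noLoop (d : BeadDiagram r s) : NoLoop 1 d := by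
  rintro ⟨_ | _, v⟩
  · rcases v with ⟨_ | _, i⟩
    · exact ⟨_, _, one_exits_bot d i⟩
    · have h2 : move 1 d (false, (true, i)) = toStack (false, i) := rfl
      exact ⟨_, _, .leave (h2 ▸ toStack_mem (false, i))⟩
  · exact ⟨_, _, one_exits d v⟩

theorem one_mul' (d : BeadDiagram r s) : mul 1 d = some d := by
  unfold mul
  rw [dif_pos (one_noLoop d)]
  refine congrArg _ (concat_eq _ ?_)
  rintro ⟨_ | _, i⟩
  · exact one_exits_bot d i
  · exact one_exits d _

theorem exits_one (d : BeadDiagram r s) (v : BeadVertex r s) :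
    Exits (move d 1) (stackBeads d 1) outer (false, v) (toStack (d.partner v)) (d.beads v) := by
  have hl : stackBeads d 1 (false, v) = d.beads v := rfl
  rcases h : d.partner v with ⟨t, i⟩
  cases t
  · have h1 : move d 1 (false, v) = toStack (false, i) := by simp [move, h, glue, toStack]
    rw [← h1, ← hl]
    exact .leave (h1 ▸ toStack_mem _)
  · have h1 : move d 1 (false, v) = (true, (false, i)) := by simp [move, h, glue]
    have h2 : move d 1 (true, (false, i)) = toStack (true, i) := rfl
    have h3 := Exits.leave (lab := stackBeads d 1) (h2 ▸ toStack_mem (true, i))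
    have h4 := Exits.step (h1 ▸ by simp [outer]) (h1 ▸ h3)
    rw [hl, h1, h2, show stackBeads d 1 (true, (false, i)) = [] from rfl, List.append_nil] at h4
    exact h4

theorem exits_one_top (d : BeadDiagram r s) (i : Fin (r + s)) :
    Exits (move d 1) (stackBeads d 1) outer (true, (true, i)) (toStack (d.partner (true, i)))
      (d.beads (true, i)) := by
  have h1 : move d 1 (true, (true, i)) = (false, (true, i)) := rfl
  exact Exits.step (lab := stackBeads d 1) (h1 ▸ by simp [outer])
    (h1 ▸ exits_one d (true, i))

theorem noLoop_one (d : BeadDiagram r s) : NoLoop d 1 := by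
  rintro ⟨_ | _, v⟩
  · exact ⟨_, _, exits_one d v⟩
  · rcases v with ⟨_ | _, i⟩
    · have h2 : move d 1 (true, (false, i)) = toStack (true, i) := rfl
      exact ⟨_, _, .leave (h2 ▸ toStack_mem (true, i))⟩
    · exact ⟨_, _, exits_one_top d i⟩

theorem mul_one' (d : BeadDiagram r s) : mul d 1 = some d := by
  unfold mul
  rw [dif_pos (noLoop_one d)]
  refine congrArg _ (concat_eq _ ?_)
  rintro ⟨_ | _, i⟩
  · exact exits_one d _
  · exact exits_one_top d i

end BeadDiagram

/-! ### The algebra of bead diagrams -/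

/-- The complex vector space with basis the `(r, s)`-bead diagrams. -/
def BeadAlgebra (r s : ℕ) : Type := BeadDiagram r s →₀ ℂ

namespace BeadAlgebra

variable {r s : ℕ}

noncomputable instance : AddCommGroup (BeadAlgebra r s) :=
  inferInstanceAs (AddCommGroup (BeadDiagram r s →₀ ℂ))

noncomputable instance : Module ℂ (BeadAlgebra r s) :=
  inferInstanceAs (Module ℂ (BeadDiagram r s →₀ ℂ))

/-- A bead diagram as a basis vector. -/
noncomputable def of (d : BeadDiagram r s) : BeadAlgebra r s := Finsupp.single d (1 : ℂ)

noncomputable def ofOption : Option (BeadDiagram r s) → BeadAlgebra r s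
  | none => 0
  | some d => of d

/-- The bilinear extension of the product of diagrams. -/
noncomputable def mulHom : BeadAlgebra r s →ₗ[ℂ] BeadAlgebra r s →ₗ[ℂ] BeadAlgebra r s :=
  Finsupp.linearCombination ℂ fun d₁ =>
    (Finsupp.linearCombination ℂ fun d₂ => ofOption (d₁.mul d₂) :
      (BeadDiagram r s →₀ ℂ) →ₗ[ℂ] BeadAlgebra r s)

noncomputable instance : Mul (BeadAlgebra r s) := ⟨fun x y => mulHom x y⟩

noncomputable instance : One (BeadAlgebra r s) := ⟨of 1⟩

theorem mul_def (x y : BeadAlgebra r s) : x * y = mulHom x y := rfl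

theorem of_mul_of (d₁ d₂ : BeadDiagram r s) : of d₁ * of d₂ = ofOption (d₁.mul d₂) := by
  rw [mul_def]
  unfold mulHom of
  erw [Finsupp.linearCombination_single, one_smul, Finsupp.linearCombination_single, one_smul]

theorem induction_on {P : BeadAlgebra r s → Prop} (x : BeadAlgebra r s) (h0 : P 0)
    (hof : ∀ d, P (of d)) (hadd : ∀ x y, P x → P y → P (x + y))
    (hsmul : ∀ (c : ℂ) x, P x → P (c • x)) : P x := by
  refine Finsupp.induction_linear (motive := P) x h0 hadd fun d c => ?_
  have : (Finsupp.single d c : BeadDiagram r s →₀ ℂ) = c • Finsupp.single d (1 : ℂ) := by simp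
  rw [this]
  exact hsmul c _ (hof d)

theorem add_mul' (x y z : BeadAlgebra r s) : (x + y) * z = x * z + y * z := by
  simp [mul_def]

theorem mul_add' (x y z : BeadAlgebra r s) : x * (y + z) = x * y + x * z := by
  simp [mul_def]

theorem smul_mul' (c : ℂ) (x y : BeadAlgebra r s) : (c • x) * y = c • (x * y) := by
  simp [mul_def]

theorem mul_smul' (c : ℂ) (x y : BeadAlgebra r s) : x * (c • y) = c • (x * y) := by
  simp [mul_def]

theorem zero_mul' (x : BeadAlgebra r s) : 0 * x = 0 := by simp [mul_def]

theorem mul_zero' (x : BeadAlgebra r s) : x * 0 = 0 := by simp [mul_def]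

theorem mul_assoc' (x y z : BeadAlgebra r s) : x * y * z = x * (y * z) := by
  refine induction_on (P := fun x => x * y * z = x * (y * z)) x (by simp [zero_mul'])
    (fun a => ?_) (fun x x' h h' => ?_) (fun c x h => ?_)
  · refine induction_on (P := fun y => of a * y * z = of a * (y * z)) y
      (by simp [zero_mul', mul_zero']) (fun b => ?_) (fun y y' h h' => ?_)
      (fun c y h => ?_)
    · refine induction_on (P := fun z => of a * of b * z = of a * (of b * z)) z
        (by simp [mul_zero']) (fun c => ?_) (fun z z' h h' => ?_)
        (fun c z h => ?_)
      · have h := congrArg ofOption (BeadDiagram.mul_assoc' a b c)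
        have h1 : ofOption ((a.mul b).bind fun d => d.mul c) = of a * of b * of c := by
          rw [of_mul_of]
          cases a.mul b with
          | none => exact (zero_mul' _).symm
          | some d => exact (of_mul_of _ _).symm
        have h2 : ofOption ((b.mul c).bind fun d => a.mul d) = of a * (of b * of c) := by
          rw [of_mul_of b c]
          cases b.mul c with
          | none => exact (mul_zero' _).symm
          | some d => exact (of_mul_of _ _).symm
        rw [← h1, ← h2, h]
      · simp only [mul_add', h, h']
      · simp only [mul_smul', h]
    · simp only [mul_add', add_mul', h, h']
    · simp only [mul_smul', smul_mul', h]
  · simp only [add_mul', h, h']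
  · simp only [smul_mul', h]

theorem one_mul' (x : BeadAlgebra r s) : 1 * x = x := by
  refine induction_on (P := fun x => 1 * x = x) x (mul_zero' 1) (fun d => ?_) (fun x y h h' => ?_) (fun c x h => ?_)
  · exact (of_mul_of _ _).trans (congrArg ofOption (BeadDiagram.one_mul' d))
  · rw [mul_add', h, h']
  · rw [mul_smul', h]

theorem mul_one' (x : BeadAlgebra r s) : x * 1 = x := by
  refine induction_on (P := fun x => x * 1 = x) x (zero_mul' 1) (fun d => ?_) (fun x y h h' => ?_) (fun c x h => ?_)
  · exact (of_mul_of _ _).trans (congrArg ofOption (BeadDiagram.mul_one' d))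
  · rw [add_mul', h, h']
  · rw [smul_mul', h]

noncomputable instance : Ring (BeadAlgebra r s) :=
  { (inferInstance : AddCommGroup (BeadAlgebra r s)),
    (inferInstance : Mul (BeadAlgebra r s)),
    (inferInstance : One (BeadAlgebra r s)) with
    left_distrib := mul_add'
    right_distrib := add_mul'
    zero_mul := zero_mul'
    mul_zero := mul_zero'
    mul_assoc := mul_assoc'
    one_mul := one_mul'
    mul_one := mul_one' }

noncomputable instance : Algebra ℂ (BeadAlgebra r s) :=
  Algebra.ofModule smul_mul' mul_smul'

end BeadAlgebra

namespace BeadDiagram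

variable {r s : ℕ}

/-! ### Generators -/

/-- The diagram of the transposition `(i, i + 1)` of two neighbours on the same side of the wall
(numbered from `0`, so that `i + 1 = r` is excluded). -/
def transposition (i : ℕ) (h : i + 1 < r + s) (h' : i + 1 ≠ r) : BeadDiagram r s :=
  ofPerm (Equiv.swap ⟨i, by omega⟩ ⟨i + 1, h⟩) fun k => by
    rw [Equiv.swap_apply_def]
    split_ifs with h1 h2
    · subst h1
      simp only
      omega
    · subst h2
      simp only
      omega
    · rfl

/-- The diagram without beads in which the two neighbours of the wall are joined in each row and
all other strands are the identity. -/
def cupCap (hr : 0 < r) (hs : 0 < s) : BeadDiagram r s where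
  partner v :=
    if v.2.val = r - 1 then (v.1, ⟨r, by omega⟩)
    else if v.2.val = r then (v.1, ⟨r - 1, by omega⟩)
    else (!v.1, v.2)
  partner_partner v := by
    obtain ⟨b, i, hi⟩ := v
    by_cases h1 : i = r - 1
    · subst h1
      have : ¬ r = r - 1 := by omega
      simp [this]
    · by_cases h2 : i = r
      · subst h2
        simp [h1]
      · simp [h1, h2]
  wall v := by
    obtain ⟨b, i, hi⟩ := v
    by_cases h1 : i = r - 1
    · subst h1
      simp
      omega
    · by_cases h2 : i = r
      · subst h2
        simp [h1]
        omega
      · simp [h1, h2]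
  numBeads := 0
  beads _ := []
  beads_partner _ := rfl
  beads_number := by simp

/-- The identity diagram with one bead on the strand number `i`. -/
def bead (i : Fin (r + s)) : BeadDiagram r s where
  partner v := (!v.1, v.2)
  partner_partner v := by simp
  wall v := by simp
  numBeads := 1
  beads v := if v.2 = i then [1] else []
  beads_partner v := by
    show (if v.2 = i then [1] else []) = _
    split_ifs <;> rfl
  beads_number := by
    have h : ∀ j : Fin (r + s), ((if j = i then [1] else [] : List ℕ) : Multiset ℕ) =
        if j = i then {1} else 0 := fun j => by split_ifs <;> rfl
    rw [Fintype.sum_prod_type, Fintype.sum_bool, ← two_nsmul]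
    simp only [h, Finset.sum_ite_eq', Finset.mem_univ, if_true]
    rfl

/-! ### The statistics of a bead diagram -/

/-- The good vertex of a strand: its top vertex if the strand is vertical, its left vertex if it is
horizontal. A strand is a horizontal strand of the bottom row iff its good vertex lies in the
bottom row; so beads of type I (resp. II) are the beads on strands whose good vertex is in
the bottom (resp. top) row. -/
def IsGood (d : BeadDiagram r s) (v : BeadVertex r s) : Prop :=
  ((d.partner v).1 ≠ v.1 ∧ v.1 = true) ∨ ((d.partner v).1 = v.1 ∧ v.2 < (d.partner v).2)

instance (d : BeadDiagram r s) : DecidablePred d.IsGood := fun v => by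
  unfold IsGood
  infer_instance

/-- The beads of type I (`row = false`) or of type II (`row = true`), each given as a pair: its
number and the label of the good vertex of its strand. -/
def typedBeads (d : BeadDiagram r s) (row : Bool) : Finset (ℕ × Fin (r + s)) :=
  {x ∈ Finset.Icc 1 d.numBeads ×ˢ Finset.univ | d.IsGood (row, x.2) ∧ x.1 ∈ d.beads (row, x.2)}

/-- `ℓ₁` (`row = false`) and `ℓ₂` (`row = true`): the inversions of the sequence of labels of good
vertices, read in the order of the bead numbers. -/
def inversions (d : BeadDiagram r s) (row : Bool) : ℕ :=
  Finset.card {x ∈ d.typedBeads row ×ˢ d.typedBeads row | x.1.1 < x.2.1 ∧ x.2.2 < x.1.2}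

/-- Half the number (rounded down) of beads of the given type on the strand with good vertex
number `i`. -/
def halfCount (d : BeadDiagram r s) (row : Bool) (i : Fin (r + s)) : ℕ :=
  Finset.card {x ∈ d.typedBeads row | x.2 = i} / 2

/-- `ρ₁` (`row = false`) and `ρ₂` (`row = true`). -/
def rho (d : BeadDiagram r s) (row : Bool) : ℕ :=
  ∑ i : Fin (r + s) with i.val < r, d.halfCount row i

/-- `p₁`: the sum over the beads of type I of the number of beads with a larger number that are
passed on the way to the good vertex of the strand. -/
def passing₁ (d : BeadDiagram r s) : ℕ :=
  ∑ i : Fin (r + s) with d.IsGood (false, i),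
    ∑ j : Fin (d.beads (false, i)).length,
      Finset.card {k : Fin (d.beads (false, i)).length |
        k < j ∧ (d.beads (false, i)).get j < (d.beads (false, i)).get k}

/-- `p₂`: the sum over the beads of type II of the number of beads with a smaller number that are
passed on the way to the good vertex of the strand. -/
def passing₂ (d : BeadDiagram r s) : ℕ :=
  ∑ i : Fin (r + s) with d.IsGood (true, i),
    ∑ j : Fin (d.beads (true, i)).length,
      Finset.card {k : Fin (d.beads (true, i)).length |
        k < j ∧ (d.beads (true, i)).get k < (d.beads (true, i)).get j}

/-- The number of pairs of a bead of type II and a bead of type I with a larger number. -/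
def mixed (d : BeadDiagram r s) : ℕ :=
  Finset.card {x ∈ d.typedBeads true ×ˢ d.typedBeads false | x.1.1 < x.2.1}

def alpha (d : BeadDiagram r s) : ℕ :=
  ∑ i : Fin (r + s) with r ≤ i.val, d.halfCount true i

def beta (d : BeadDiagram r s) : ℕ :=
  d.inversions false + d.inversions true + d.rho false + d.rho true + d.passing₁ + d.passing₂ +
    d.mixed

def gamma (d : BeadDiagram r s) : ℕ := d.beta + d.alpha

/-! ### The reduced diagram -/

/-- The good vertices of the strands with an odd number of beads. -/
def oddGood (d : BeadDiagram r s) : Finset (BeadVertex r s) :=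
  {v | d.IsGood v ∧ Odd (d.beads v).length}

/-- The good vertex of the strand of `v`. -/
def goodEnd (d : BeadDiagram r s) (v : BeadVertex r s) : BeadVertex r s :=
  if d.IsGood v then v else d.partner v

/-- The number of the bead left over on the strand with good vertex `v`: first the beads of type I
from left to right, then the beads of type II from left to right. -/
def newNumber (d : BeadDiagram r s) (v : BeadVertex r s) : ℕ :=
  Finset.card {w ∈ d.oddGood | w.1 < v.1 ∨ w.1 = v.1 ∧ w.2 ≤ v.2}

theorem isGood_partner (d : BeadDiagram r s) (v : BeadVertex r s) :
    d.IsGood (d.partner v) ↔ ¬ d.IsGood v := by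
  have h := d.wall v
  unfold IsGood
  rw [d.partner_partner]
  generalize d.partner v = w at h
  obtain ⟨a, i⟩ := v
  obtain ⟨b, j⟩ := w
  have h' : i = j → b ≠ a := by
    rintro rfl
    simpa using h
  have h2 := lt_trichotomy i j
  cases a <;> cases b <;> simp at h' ⊢ <;>
    exact ⟨fun h => h.le, fun h => lt_of_le_of_ne h fun e => h' e.symm⟩

theorem goodEnd_partner (d : BeadDiagram r s) (v : BeadVertex r s) :
    d.goodEnd (d.partner v) = d.goodEnd v := by
  unfold goodEnd
  have h := d.isGood_partner v
  by_cases h1 : d.IsGood v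
  · rw [if_pos h1, if_neg (fun h2 => h.1 h2 h1), partner_partner]
  · rw [if_neg h1, if_pos (h.2 h1)]

theorem map_rank {α : Type} [LinearOrder α] (S : Finset α) :
    S.val.map (fun v => Finset.card {w ∈ S | w ≤ v}) = (Multiset.range S.card).map (· + 1) := by
  have hmono : ∀ v ∈ S, ∀ w ∈ S, v < w →
      Finset.card {x ∈ S | x ≤ v} < Finset.card {x ∈ S | x ≤ w} := by
    intro v hv w hw h
    refine Finset.card_lt_card ⟨fun x hx => ?_, fun hs => ?_⟩
    · rw [Finset.mem_filter] at hx ⊢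
      exact ⟨hx.1, hx.2.trans h.le⟩
    · have := hs (Finset.mem_filter.2 ⟨hw, le_rfl⟩)
      exact absurd h (not_lt.2 (Finset.mem_filter.1 this).2)
  have hinj : Set.InjOn (fun v => Finset.card {w ∈ S | w ≤ v}) S := by
    intro v hv w hw h
    rcases lt_trichotomy v w with h1 | h1 | h1
    · exact absurd h (hmono v hv w hw h1).ne
    · exact h1
    · exact absurd h (hmono w hw v hv h1).ne'
  have h1 : S.image (fun v => Finset.card {w ∈ S | w ≤ v}) =
      (Finset.range S.card).image (· + 1) := by
    refine Finset.eq_of_subset_of_card_le (fun n hn => ?_) ?_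
    · obtain ⟨v, hv, rfl⟩ := Finset.mem_image.1 hn
      have h1 : 0 < Finset.card {w ∈ S | w ≤ v} :=
        Finset.card_pos.2 ⟨v, Finset.mem_filter.2 ⟨hv, le_rfl⟩⟩
      have h2 : Finset.card {w ∈ S | w ≤ v} ≤ S.card := Finset.card_filter_le _ _
      refine Finset.mem_image.2 ⟨Finset.card {w ∈ S | w ≤ v} - 1, Finset.mem_range.2 ?_, ?_⟩ <;>
        omega
    · rw [Finset.card_image_of_injOn hinj]
      exact Finset.card_image_le.trans_eq (Finset.card_range _)
  have h2 := congrArg Finset.val h1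
  rw [Finset.image_val_of_injOn hinj,
    Finset.image_val_of_injOn (fun a _ b _ h => Nat.succ_injective h)] at h2
  exact h2

theorem map_newNumber (d : BeadDiagram r s) :
    d.oddGood.val.map d.newNumber = (Multiset.range d.oddGood.card).map (· + 1) := by
  have h := map_rank (d.oddGood.map (toLex (α := BeadVertex r s)).toEmbedding)
  rw [Finset.card_map, Finset.map_val, Multiset.map_map] at h
  rw [← h]
  refine Multiset.map_congr rfl fun v _ => ?_
  simp only [Function.comp, Finset.filter_map, Finset.card_map]
  unfold newNumber
  congr 1
  refine Finset.filter_congr fun w _ => ?_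
  exact (Prod.Lex.le_iff (x := toLex w) (y := toLex v)).symm

/-- The diagram `d̃`: same strands; one bead is left on each strand with an odd number of beads,
none on the others; renumbered. -/
def reduce (d : BeadDiagram r s) : BeadDiagram r s where
  partner := d.partner
  partner_partner := d.partner_partner
  wall := d.wall
  numBeads := d.oddGood.card
  beads v := if Odd (d.beads v).length then [d.newNumber (d.goodEnd v)] else []
  beads_partner v := by
    rw [d.beads_partner, d.goodEnd_partner, List.length_reverse]
    split_ifs <;> rfl
  beads_number := by
    set F : BeadVertex r s → Multiset ℕ := fun v =>
      ((if Odd (d.beads v).length then [d.newNumber (d.goodEnd v)] else [] : List ℕ) :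
        Multiset ℕ) with hF
    have hp : ∀ v, F (d.partner v) = F v := fun v => by
      simp only [hF]
      rw [d.beads_partner, d.goodEnd_partner, List.length_reverse]
    have h1 : ∑ v with ¬ d.IsGood v, F v = ∑ v with d.IsGood v, F v := by
      refine Finset.sum_nbij' d.partner d.partner ?_ ?_ (fun v _ => d.partner_partner v)
        (fun v _ => d.partner_partner v) (fun v _ => (hp v).symm)
      · intro v hv
        rw [Finset.mem_filter] at hv ⊢
        exact ⟨Finset.mem_univ _, (d.isGood_partner v).2 hv.2⟩
      · intro v hv
        rw [Finset.mem_filter] at hv ⊢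
        exact ⟨Finset.mem_univ _, fun h => (d.isGood_partner v).1 h hv.2⟩
    have h2 : ∑ v with d.IsGood v, F v = ∑ v ∈ d.oddGood, {d.newNumber v} := by
      unfold oddGood
      rw [← Finset.filter_filter, Finset.sum_filter (fun v => Odd (d.beads v).length)]
      refine Finset.sum_congr rfl fun v hv => ?_
      have hg : d.goodEnd v = v := if_pos (Finset.mem_filter.1 hv).2
      simp only [hF, hg]
      split_ifs <;> rfl
    rw [← Finset.sum_filter_add_sum_filter_not Finset.univ d.IsGood, h1, ← two_nsmul, h2, ← map_newNumber]
    congr 1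
    refine Eq.trans ?_ (Multiset.sum_map_singleton _)
    rw [Multiset.map_map]
    rfl

end BeadDiagram

/-! ### The algebra `BD'`, the ideal `L` and the space `M` -/

namespace BeadAlgebra

open BeadDiagram

/-- The subalgebra `BD'` generated by the transpositions on either side of the wall, the diagram
`cupCap` (if both sides are non-empty) and the one-bead diagrams. -/
noncomputable def BD' (r s : ℕ) : Subalgebra ℂ (BeadAlgebra r s) :=
  Algebra.adjoin ℂ ({x | ∃ i h h', x = of (transposition i h h')} ∪
    {x | ∃ hr hs, x = of (cupCap hr hs)} ∪ {x | ∃ i, x = of (bead i)})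

/-- The two-sided ideal `L` of `BD'` generated by the Clifford relations. -/
noncomputable def cliffordIdeal (r s : ℕ) : TwoSidedIdeal (BD' r s) :=
  TwoSidedIdeal.span
    ({x | ∃ k : Fin (r + s), k.val < r ∧ (x : BeadAlgebra r s) = of (bead k) ^ 2 + 1} ∪
      {x | ∃ l : Fin (r + s), r ≤ l.val ∧ (x : BeadAlgebra r s) = of (bead l) ^ 2 - 1} ∪
      {x | ∃ i j : Fin (r + s), i ≠ j ∧
        (x : BeadAlgebra r s) = of (bead i) * of (bead j) + of (bead j) * of (bead i)})

/-- `L` as a subspace of the space of all diagrams. -/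
noncomputable def cliffordSubmodule (r s : ℕ) : Submodule ℂ (BeadAlgebra r s) where
  carrier := {x | ∃ y ∈ cliffordIdeal r s, (y : BeadAlgebra r s) = x}
  zero_mem' := ⟨0, (cliffordIdeal r s).zero_mem, rfl⟩
  add_mem' := by
    rintro _ _ ⟨x, hx, rfl⟩ ⟨y, hy, rfl⟩
    exact ⟨x + y, (cliffordIdeal r s).add_mem hx hy, rfl⟩
  smul_mem' := by
    rintro c _ ⟨x, hx, rfl⟩
    refine ⟨c • x, ?_, rfl⟩
    rw [Algebra.smul_def]
    exact (cliffordIdeal r s).mul_mem_left _ _ hx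

/-- The element `d - (-1)^β(d) d̃`. -/
noncomputable def reduction {r s : ℕ} (d : BeadDiagram r s) : BeadAlgebra r s :=
  of d - (-1 : ℂ) ^ d.beta • of d.reduce

/-- The space `M` spanned by the elements `d - (-1)^β(d) d̃`, for the bead diagrams `d` in `BD'`. -/
noncomputable def reductionSpan (r s : ℕ) : Submodule ℂ (BeadAlgebra r s) :=
  Submodule.span ℂ {x | ∃ d : BeadDiagram r s, of d ∈ BD' r s ∧ x = reduction d}

end BeadAlgebra

/-! Let `Φ` be the linear map `d ↦ (-1)^β(d) d̃` (`reduceHom`). The theorem rests on two facts: `Φ`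
vanishes on `L`, and `BD' = W + L`, where `W` is spanned by the diagrams of `BD'` with `γ = 0`,
which `Φ` fixes (`reduceHom_of_gamma`). Indeed, if `x = w + l`, then `x - Φ(x) = l` lies in `L`; and
`x - Φ(x) = x` for `x` in `L`. So `L` is the image of `BD'` under `1 - Φ`. Every product of
generators is a diagram or zero, so `BD'` is spanned by its diagrams and this image is `M`. A
diagram with `γ = 0` contributes zero, and `d̃` always has `γ = 0`; hence modulo the diagrams with
`γ = 0` the remaining elements `d ∓ d̃` become distinct basis vectors `d`, which gives independence.

Why `Φ` vanishes on `L`: write the bead numbers strand by strand, in the order of the good vertices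
(bottom row first, each row from left to right), reading away from the good vertex in the bottom row
and towards it in the top row. Then `β` is the number of inversions of this word plus the number of
pairs that can be cancelled on strands whose good vertex is left of the wall (`beta_eq`).
Interchanging two consecutive bead numbers changes the parity of the inversions; this is the
relation `c_i c_j + c_j c_i` (`reduce_beta_swap`). Inserting two adjacent beads with consecutive
numbers adds, modulo 2, one or no inversion according to the reading direction, and one cancelled
pair if the good vertex is left of the wall. The parity `orient` of row plus side flips between the
ends of every strand, also of a concatenated one, and therefore the two contributions add up to a
parity that depends only on the side where the pair was inserted (`reduce_beta_insert`): odd on the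
left, even on the right. These are the signs of `c_k^2 = -1` and `c_l^2 = 1`.

Why `BD' = W + L`: modulo `L` the one-bead diagrams anticommute and have squares `±1`. By sliding
beads along strands, every product of generators becomes a multiple of a beadless diagram with beads
only below and above it (`isSplit_of_mem_closure`). These beads are moved to good vertices, sorted
and cancelled, which leaves a diagram with `γ = 0` (`IsSplit.exists_reduced`). The scalars need not
be followed here, because `Φ` determines them afterwards. -/

/-! ### Inversions of lists -/

/-- The number of entries of `l` that are smaller than `x`. -/
def smallerCount (x : ℕ) (l : List ℕ) : ℕ := (l.map fun y => if y < x then 1 else 0).sum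

/-- The number of pairs consisting of an entry of `a` and a smaller entry of `b`. -/
def crossCount (a b : List ℕ) : ℕ := (a.map fun x => smallerCount x b).sum

/-- The number of inversions of a list. -/
def inversionCount : List ℕ → ℕ
  | [] => 0
  | x :: l => smallerCount x l + inversionCount l

theorem smallerCount_append (x : ℕ) (a b : List ℕ) :
    smallerCount x (a ++ b) = smallerCount x a + smallerCount x b := by
  simp [smallerCount]

theorem crossCount_cons_left (x : ℕ) (a b : List ℕ) :
    crossCount (x :: a) b = smallerCount x b + crossCount a b := by
  simp [crossCount]

theorem crossCount_append_right (a b c : List ℕ) :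
    crossCount a (b ++ c) = crossCount a b + crossCount a c := by
  simp [crossCount, smallerCount_append, List.sum_map_add]

theorem inversionCount_append (a b : List ℕ) :
    inversionCount (a ++ b) = inversionCount a + inversionCount b + crossCount a b := by
  induction a with
  | nil => simp [inversionCount, crossCount]
  | cons x a ih =>
    simp only [List.cons_append, inversionCount, ih, smallerCount_append, crossCount_cons_left]
    omega

theorem sum_map_flatMap {α : Type} (l : List α) (f : α → List ℕ) (g : ℕ → ℕ) :
    ((l.flatMap f).map g).sum = (l.map fun a => ((f a).map g).sum).sum := by
  induction l with
  | nil => rfl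
  | cons a l ih => simp [ih]

/-- Inversions lie inside one block or between two blocks. The order of the blocks enters as the
indicator of `j < i`, so that for blocks indexed by vertex labels the second term matches the
definition of `inversions`. -/
theorem inversionCount_flatMap {α : Type} [LinearOrder α] (ls : List α) (h : ls.Pairwise (· < ·))
    (F : α → List ℕ) :
    inversionCount (ls.flatMap F) = (ls.map fun i => inversionCount (F i)).sum +
      (ls.map fun j => ((F j).map fun u =>
        (ls.map fun i => if j < i then smallerCount u (F i) else 0).sum).sum).sum := by
  induction ls with
  | nil => rfl
  | cons a l ih =>
    rw [List.pairwise_cons] at h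
    have e1 : crossCount (F a) (l.flatMap F) = ((F a).map fun u =>
        ((a :: l).map fun i => if a < i then smallerCount u (F i) else 0).sum).sum := by
      unfold crossCount
      congr 1
      refine List.map_congr_left fun u _ => ?_
      rw [List.map_cons, List.sum_cons, if_neg (lt_irrefl a), zero_add]
      unfold smallerCount
      rw [sum_map_flatMap]
      congr 1
      exact List.map_congr_left fun i hi => (if_pos (h.1 i hi)).symm
    have e2 : (l.map fun j => ((F j).map fun u =>
        ((a :: l).map fun i => if j < i then smallerCount u (F i) else 0).sum).sum) =
        l.map fun j => ((F j).map fun u =>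
        (l.map fun i => if j < i then smallerCount u (F i) else 0).sum).sum := by
      refine List.map_congr_left fun j hj => ?_
      congr 1
      refine List.map_congr_left fun u _ => ?_
      rw [List.map_cons, List.sum_cons, if_neg (not_lt.2 (h.1 j hj).le), zero_add]
    rw [List.flatMap_cons, inversionCount_append, ih h.2, e1, List.map_cons, List.sum_cons,
      List.map_cons (l := l), List.sum_cons, e2]
    omega

/-- The pairs whose earlier member is the head are split off. The relation is a parameter because
`passing₁` and `passing₂` compare bead numbers in opposite directions. -/
theorem sum_card_pairs (R : ℕ → ℕ → Prop) [DecidableRel R] (x : ℕ) (l : List ℕ) :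
    ∑ j : Fin (x :: l).length, Finset.card {k : Fin (x :: l).length |
        k < j ∧ R ((x :: l).get k) ((x :: l).get j)} =
      (l.map fun y => if R x y then 1 else 0).sum +
      ∑ j : Fin l.length, Finset.card {k : Fin l.length | k < j ∧ R (l.get k) (l.get j)} := by
  have e : (l.map fun y => if R x y then 1 else 0).sum =
      ∑ j : Fin l.length, if R x (l.get j) then 1 else 0 := by
    conv_lhs => rw [← List.ofFn_get l, List.map_ofFn, List.sum_ofFn]
    rfl
  simp only [Finset.card_filter]
  rw [e, ← Finset.sum_add_distrib]
  erw [Fin.sum_univ_succ]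
  have h0 : ∀ i : Fin (x :: l).length, ¬ i < (0 : Fin (l.length + 1)) :=
    fun i => by exact Fin.not_lt_zero i
  rw [Finset.sum_eq_zero (fun i _ => if_neg fun h => h0 i h.1), zero_add]
  refine Finset.sum_congr rfl fun j _ => ?_
  erw [Fin.sum_univ_succ]
  congr 1
  · have : (0 : Fin (l.length + 1)) < j.succ := Fin.succ_pos j
    by_cases hR : R x (l.get j)
    · rw [if_pos hR]
      exact if_pos ⟨this, hR⟩
    · rw [if_neg hR]
      exact if_neg fun h => hR h.2
  · refine Finset.sum_congr rfl fun k _ => ?_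
    have : (k.succ < j.succ) ↔ k < j := Fin.succ_lt_succ_iff
    by_cases hR : k < j ∧ R (l.get k) (l.get j)
    · rw [if_pos hR]
      exact if_pos ⟨this.2 hR.1, hR.2⟩
    · rw [if_neg hR]
      exact if_neg fun h => hR ⟨this.1 h.1, h.2⟩

theorem inversionCount_eq_sum (l : List ℕ) :
    ∑ j : Fin l.length, Finset.card {k : Fin l.length | k < j ∧ l.get j < l.get k} =
      inversionCount l := by
  induction l with
  | nil => rfl
  | cons x l ih =>
    have := sum_card_pairs (fun a b => b < a) x l
    rw [this, ih]
    rfl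

theorem inversionCount_reverse_eq_sum (l : List ℕ) :
    ∑ j : Fin l.length, Finset.card {k : Fin l.length | k < j ∧ l.get k < l.get j} =
      inversionCount l.reverse := by
  induction l with
  | nil => rfl
  | cons x l ih =>
    have := sum_card_pairs (fun a b => a < b) x l
    rw [this, ih, List.reverse_cons, inversionCount_append]
    have e : crossCount l.reverse [x] = (l.map fun y => if x < y then 1 else 0).sum := by
      unfold crossCount
      rw [List.map_reverse, List.sum_reverse]
      simp [smallerCount]
    rw [e]
    simp [inversionCount, smallerCount]
    omega

namespace BeadDiagram

variable {r s : ℕ}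

/-! ### The word of a bead diagram -/

/-- The vertices, from left to right, first in the bottom row, then in the top row. -/
def vertices (r s : ℕ) : List (BeadVertex r s) :=
  (List.finRange (r + s)).map (fun i => (false, i)) ++
    (List.finRange (r + s)).map (fun i => (true, i))

/-- The bead numbers on the strand with good vertex `v`, read away from `v` for beads of type I and
towards `v` for beads of type II. -/
def segment (d : BeadDiagram r s) (v : BeadVertex r s) : List ℕ :=
  if d.IsGood v then if v.1 then (d.beads v).reverse else d.beads v else []

/-- All bead numbers, strand by strand. -/
def word (d : BeadDiagram r s) : List ℕ := (vertices r s).flatMap d.segment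

theorem sum_vertices {M : Type} [AddCommMonoid M] (f : BeadVertex r s → M) :
    ((vertices r s).map f).sum = ∑ v, f v := by
  rw [Fintype.sum_prod_type, Fintype.sum_bool, Fin.sum_univ_def, Fin.sum_univ_def, add_comm]
  simp only [vertices, List.map_append, List.sum_append, List.map_map]
  rfl

theorem mem_vertices (v : BeadVertex r s) : v ∈ vertices r s := by
  obtain ⟨_ | _, i⟩ := v <;> simp [vertices]

theorem coe_flatMap {α : Type} (l : List α) (f : α → List ℕ) :
    ((l.flatMap f : List ℕ) : Multiset ℕ) = (l.map fun a => (f a : Multiset ℕ)).sum := by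
  induction l with
  | nil => rfl
  | cons a l ih =>
    rw [List.flatMap_cons, ← Multiset.coe_add, ih]
    rfl

theorem coe_segment (d : BeadDiagram r s) (v : BeadVertex r s) :
    (d.segment v : Multiset ℕ) = if d.IsGood v then (d.beads v : Multiset ℕ) else 0 := by
  unfold segment
  split_ifs
  · exact Multiset.coe_reverse _
  · rfl
  · rfl

/-- Exactly one end of each strand is good, so the sum over good vertices is half of the sum in
`beads_number`; the factor 2 is cancelled in multiplicities. -/
theorem coe_word (d : BeadDiagram r s) :
    (d.word : Multiset ℕ) = (Multiset.range d.numBeads).map (· + 1) := by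
  have h1 : ∑ v with ¬ d.IsGood v, (d.beads v : Multiset ℕ) =
      ∑ v with d.IsGood v, (d.beads v : Multiset ℕ) := by
    refine Finset.sum_nbij' d.partner d.partner ?_ ?_ (fun v _ => d.partner_partner v)
      (fun v _ => d.partner_partner v) (fun v _ => ?_)
    · intro v hv
      rw [Finset.mem_filter] at hv ⊢
      exact ⟨Finset.mem_univ _, (d.isGood_partner v).2 hv.2⟩
    · intro v hv
      rw [Finset.mem_filter] at hv ⊢
      exact ⟨Finset.mem_univ _, fun h => (d.isGood_partner v).1 h hv.2⟩
    · rw [d.beads_partner, Multiset.coe_reverse]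
  have h2 : (d.word : Multiset ℕ) = ∑ v with d.IsGood v, (d.beads v : Multiset ℕ) := by
    unfold word
    rw [coe_flatMap, sum_vertices, Finset.sum_filter]
    exact Finset.sum_congr rfl fun v _ => d.coe_segment v
  have h3 := d.beads_number
  rw [← Finset.sum_filter_add_sum_filter_not Finset.univ d.IsGood, h1, ← two_nsmul, ← h2] at h3
  ext t
  have h4 := congrArg (Multiset.count t) h3
  rw [Multiset.count_nsmul, Multiset.count_nsmul] at h4
  omega

theorem nodup_word (d : BeadDiagram r s) : d.word.Nodup := by
  rw [← Multiset.coe_nodup, coe_word]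
  exact (Multiset.nodup_range _).map (add_left_injective 1)

theorem mem_word {d : BeadDiagram r s} {t : ℕ} : t ∈ d.word ↔ 1 ≤ t ∧ t ≤ d.numBeads := by
  rw [← Multiset.mem_coe, coe_word, Multiset.mem_map]
  simp only [Multiset.mem_range]
  constructor
  · rintro ⟨a, h, rfl⟩
    omega
  · exact fun h => ⟨t - 1, by omega, by omega⟩

theorem length_word (d : BeadDiagram r s) : d.word.length = d.numBeads := by
  rw [← Multiset.coe_card, coe_word, Multiset.card_map, Multiset.card_range]

theorem mem_segment {d : BeadDiagram r s} {v : BeadVertex r s} {t : ℕ} :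
    t ∈ d.segment v ↔ d.IsGood v ∧ t ∈ d.beads v := by
  rw [← Multiset.mem_coe, coe_segment]
  split_ifs with h <;> simp [h]

theorem mem_word_of_mem_segment {d : BeadDiagram r s} {v : BeadVertex r s} {t : ℕ}
    (h : t ∈ d.segment v) : t ∈ d.word :=
  List.mem_flatMap.2 ⟨v, mem_vertices v, h⟩

theorem mem_beads_bound {d : BeadDiagram r s} {v : BeadVertex r s} {t : ℕ} (h : t ∈ d.beads v) :
    1 ≤ t ∧ t ≤ d.numBeads := by
  by_cases hv : d.IsGood v
  · exact mem_word.1 (mem_word_of_mem_segment (mem_segment.2 ⟨hv, h⟩))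
  · refine mem_word.1 (mem_word_of_mem_segment (v := d.partner v)
      (mem_segment.2 ⟨(d.isGood_partner v).2 hv, ?_⟩))
    rwa [d.beads_partner, List.mem_reverse]

theorem nodup_segment (d : BeadDiagram r s) (v : BeadVertex r s) : (d.segment v).Nodup :=
  (List.nodup_flatMap.1 d.nodup_word).1 v (mem_vertices v)

theorem mem_typedBeads {d : BeadDiagram r s} {row : Bool} {x : ℕ × Fin (r + s)} :
    x ∈ d.typedBeads row ↔ x.1 ∈ d.segment (row, x.2) := by
  unfold typedBeads
  rw [mem_segment, Finset.mem_filter, Finset.mem_product, Finset.mem_Icc]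
  exact ⟨fun h => h.2, fun h => ⟨⟨mem_beads_bound h.2, Finset.mem_univ _⟩, h⟩⟩

theorem filter_typedBeads (d : BeadDiagram r s) (row : Bool) (i : Fin (r + s)) :
    {x ∈ d.typedBeads row | x.2 = i} = (d.segment (row, i)).toFinset.map
      ⟨fun t => (t, i), fun _ _ h => congrArg Prod.fst h⟩ := by
  ext ⟨t, j⟩
  simp only [Finset.mem_filter, mem_typedBeads, Finset.mem_map, List.mem_toFinset]
  constructor
  · rintro ⟨h, rfl⟩
    exact ⟨t, h, rfl⟩
  · rintro ⟨_, h, h'⟩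
    cases h'
    exact ⟨h, rfl⟩

theorem sum_typedBeads (d : BeadDiagram r s) (row : Bool) (f : ℕ × Fin (r + s) → ℕ) :
    ∑ x ∈ d.typedBeads row, f x = ∑ i, ((d.segment (row, i)).map fun t => f (t, i)).sum := by
  rw [← Finset.sum_fiberwise (d.typedBeads row) Prod.snd]
  refine Finset.sum_congr rfl fun i _ => ?_
  rw [filter_typedBeads, Finset.sum_map, List.sum_toFinset _ (d.nodup_segment _)]
  rfl

theorem halfCount_eq (d : BeadDiagram r s) (row : Bool) (i : Fin (r + s)) :
    d.halfCount row i = (d.segment (row, i)).length / 2 := by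
  unfold halfCount
  rw [filter_typedBeads, Finset.card_map, List.toFinset_card_of_nodup (d.nodup_segment _)]

/-- The part of the word that belongs to one row. -/
def rowWord (d : BeadDiagram r s) (row : Bool) : List ℕ :=
  (List.finRange (r + s)).flatMap fun i => d.segment (row, i)

theorem word_eq (d : BeadDiagram r s) : d.word = d.rowWord false ++ d.rowWord true := by
  simp only [word, rowWord, vertices, List.flatMap_append, List.flatMap_map]

theorem mixed_eq (d : BeadDiagram r s) :
    d.mixed = crossCount (d.rowWord false) (d.rowWord true) := by
  unfold mixed crossCount smallerCount
  rw [Finset.card_filter, Finset.sum_product_right, sum_typedBeads, Fin.sum_univ_def]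
  unfold rowWord
  rw [sum_map_flatMap]
  congr 1
  refine List.map_congr_left fun j _ => ?_
  congr 1
  refine List.map_congr_left fun u _ => ?_
  rw [sum_typedBeads, sum_map_flatMap, Fin.sum_univ_def]

theorem pairwise_finRange (n : ℕ) : (List.finRange n).Pairwise (· < ·) := by
  exact List.pairwise_lt_finRange n

/-- Inversions between different strands form `ℓ₁` or `ℓ₂`; those within a strand form `p₁` or `p₂`,
by the choice of reading direction in `segment`. -/
theorem inversionCount_rowWord (d : BeadDiagram r s) (row : Bool) :
    inversionCount (d.rowWord row) =
      d.inversions row + ∑ i, inversionCount (d.segment (row, i)) := by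
  unfold rowWord
  rw [inversionCount_flatMap _ (pairwise_finRange _), ← Fin.sum_univ_def, ← Fin.sum_univ_def,
    add_comm]
  congr 1
  unfold inversions
  rw [Finset.card_filter, Finset.sum_product_right, sum_typedBeads]
  refine Finset.sum_congr rfl fun j _ => ?_
  congr 1
  refine List.map_congr_left fun u _ => ?_
  rw [sum_typedBeads, Fin.sum_univ_def]
  congr 1
  refine List.map_congr_left fun i _ => ?_
  unfold smallerCount
  by_cases h : j < i <;> simp [h]

theorem passing₁_eq (d : BeadDiagram r s) :
    d.passing₁ = ∑ i, inversionCount (d.segment (false, i)) := by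
  unfold passing₁
  rw [Finset.sum_filter]
  refine Finset.sum_congr rfl fun i _ => ?_
  unfold segment
  by_cases h : d.IsGood (false, i)
  · rw [if_pos h, if_pos h]
    exact inversionCount_eq_sum _
  · rw [if_neg h, if_neg h]
    rfl

theorem passing₂_eq (d : BeadDiagram r s) :
    d.passing₂ = ∑ i, inversionCount (d.segment (true, i)) := by
  unfold passing₂
  rw [Finset.sum_filter]
  refine Finset.sum_congr rfl fun i _ => ?_
  unfold segment
  by_cases h : d.IsGood (true, i)
  · rw [if_pos h, if_pos h]
    exact inversionCount_reverse_eq_sum _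
  · rw [if_neg h, if_neg h]
    rfl

/-- `β` in terms of the word. -/
theorem beta_eq (d : BeadDiagram r s) :
    d.beta = inversionCount d.word +
      ∑ v : BeadVertex r s, if v.2.val < r then (d.segment v).length / 2 else 0 := by
  unfold beta rho
  rw [word_eq, inversionCount_append, inversionCount_rowWord, inversionCount_rowWord, passing₁_eq,
    passing₂_eq, mixed_eq, Fintype.sum_prod_type, Fintype.sum_bool, Finset.sum_filter,
    Finset.sum_filter]
  simp only [halfCount_eq]
  omega

/-- A bottom good vertex lies to the left of the wall. -/
theorem lt_of_isGood_bottom {d : BeadDiagram r s} {i : Fin (r + s)} (h : d.IsGood (false, i)) :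
    i.val < r := by
  obtain ⟨_, h⟩ | ⟨h1, h2⟩ := h
  · simp at h
  · have := (d.wall (false, i)).1 h1
    have h2 : i.val < (d.partner (false, i)).2.val := h2
    simp only at this
    by_contra h3
    exact this (by constructor <;> intro <;> omega)

/-- Adding `α` removes the condition on the side of the wall: a strand with good vertex to the right
of the wall can only carry beads of type II. -/
theorem gamma_eq (d : BeadDiagram r s) :
    d.gamma = inversionCount d.word + ∑ v : BeadVertex r s, (d.segment v).length / 2 := by
  unfold gamma alpha
  rw [beta_eq, add_assoc, Fintype.sum_prod_type, Fintype.sum_bool, Fintype.sum_prod_type,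
    Fintype.sum_bool, Finset.sum_filter]
  have h1 : ∀ i : Fin (r + s), (if i.val < r then (d.segment (false, i)).length / 2 else 0) =
      (d.segment (false, i)).length / 2 := by
    intro i
    split_ifs with h
    · rfl
    · have : ¬ d.IsGood (false, i) := fun h' => h (lt_of_isGood_bottom h')
      simp [segment, this]
  have h2 : ∑ i : Fin (r + s), (d.segment (true, i)).length / 2 =
      (∑ i : Fin (r + s), if i.val < r then (d.segment (true, i)).length / 2 else 0) +
      ∑ i : Fin (r + s), if r ≤ i.val then (d.segment (true, i)).length / 2 else 0 := by
    rw [← Finset.sum_add_distrib]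
    refine Finset.sum_congr rfl fun i _ => ?_
    by_cases h : i.val < r
    · simp [h]
    · simp [h, not_lt.1 h]
  simp only [halfCount_eq, h1, h2]
  omega

end BeadDiagram

/-! ### Diagrams with `γ = 0` are exactly the fixed points of `d ↦ d̃` -/

theorem inversionCount_eq_zero_iff (l : List ℕ) :
    inversionCount l = 0 ↔ l.Pairwise (· ≤ ·) := by
  induction l with
  | nil => simp [inversionCount]
  | cons x l ih =>
    rw [inversionCount, Nat.add_eq_zero_iff, ih, List.pairwise_cons]
    refine and_congr ?_ Iff.rfl
    unfold smallerCount
    rw [List.sum_eq_zero_iff]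
    simp only [List.mem_map, forall_exists_index, and_imp, forall_apply_eq_imp_iff₂]
    refine forall₂_congr fun y _ => ?_
    split_ifs with h
    · simp [h]
    · simpa using h

theorem flatMap_injOn_of_length {α : Type} (l : List α) (f g : α → List ℕ)
    (hl : ∀ a ∈ l, (f a).length = (g a).length) (h : l.flatMap f = l.flatMap g) :
    ∀ a ∈ l, f a = g a := by
  induction l with
  | nil => simp
  | cons a l ih =>
    rw [List.flatMap_cons, List.flatMap_cons] at h
    have h1 := List.append_inj h (hl a (by simp))
    rintro b (_ | ⟨_, hb⟩)
    · exact h1.1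
    · exact ih (fun a ha => hl a (by simp [ha])) h1.2 b hb

namespace BeadDiagram

variable {r s : ℕ}

theorem isGood_congr {d d' : BeadDiagram r s} (hp : d.partner = d'.partner)
    (v : BeadVertex r s) : d.IsGood v ↔ d'.IsGood v := by
  unfold IsGood
  rw [hp]

/-- The bead list at a vertex that is not good is the reverse of the list at the good end of its
strand, so the segments lose no information. -/
theorem ext_segment {d d' : BeadDiagram r s} (hp : d.partner = d'.partner)
    (hs : ∀ v, d.segment v = d'.segment v) : d = d' := by
  have key : ∀ v, d.IsGood v → d.beads v = d'.beads v := by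
    intro v hv
    have h := hs v
    unfold segment at h
    rw [if_pos hv, if_pos ((isGood_congr hp v).1 hv)] at h
    split_ifs at h
    · exact List.reverse_injective h
    · exact h
  refine ext' (fun v => congrFun hp v) fun v => ?_
  by_cases hv : d.IsGood v
  · exact key v hv
  · have h := key _ ((d.isGood_partner v).2 hv)
    rw [d.beads_partner, hp, d'.beads_partner] at h
    exact List.reverse_injective h

theorem reduce_congr {d d' : BeadDiagram r s} (hp : d.partner = d'.partner)
    (hl : ∀ v, Odd (d.beads v).length ↔ Odd (d'.beads v).length) : d.reduce = d'.reduce := by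
  have h1 : d.oddGood = d'.oddGood := by
    ext v
    simp only [oddGood, Finset.mem_filter, isGood_congr hp, hl]
  have h2 : d.goodEnd = d'.goodEnd := by
    funext v
    simp only [goodEnd, isGood_congr hp, hp]
  refine ext' (fun v => congrFun hp v) fun v => ?_
  simp only [reduce, hl, newNumber, h1, h2]

theorem segment_reduce (d : BeadDiagram r s) (v : BeadVertex r s) :
    d.reduce.segment v = if v ∈ d.oddGood then [d.newNumber v] else [] := by
  have h1 : d.reduce.IsGood v ↔ d.IsGood v := Iff.rfl
  have h2 : d.reduce.beads v = if Odd (d.beads v).length then [d.newNumber (d.goodEnd v)] else [] :=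
    rfl
  unfold segment
  simp only [h1, h2, oddGood, Finset.mem_filter, Finset.mem_univ, true_and]
  by_cases hg : d.IsGood v
  · have h3 : d.goodEnd v = v := if_pos hg
    rw [h3]
    by_cases ho : Odd (d.beads v).length <;> simp [hg, ho]
  · simp [hg]

theorem length_segment (d : BeadDiagram r s) (v : BeadVertex r s) (hv : d.IsGood v) :
    (d.segment v).length = (d.beads v).length := by
  unfold segment
  rw [if_pos hv]
  split_ifs <;> simp

theorem length_segment_reduce (d : BeadDiagram r s) (v : BeadVertex r s) :
    (d.reduce.segment v).length = (d.segment v).length % 2 := by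
  rw [segment_reduce]
  unfold oddGood
  simp only [Finset.mem_filter, Finset.mem_univ, true_and]
  by_cases hv : d.IsGood v
  · rw [d.length_segment v hv]
    by_cases h : Odd (d.beads v).length
    · simp [hv, h, Nat.odd_iff.1 h]
    · rw [if_neg fun h' => h h'.2, Nat.even_iff.1 (Nat.not_odd_iff_even.1 h)]
      rfl
  · simp [hv, segment]

theorem gamma_eq_zero_iff (d : BeadDiagram r s) :
    d.gamma = 0 ↔ d.word.Pairwise (· ≤ ·) ∧ ∀ v, (d.segment v).length ≤ 1 := by
  rw [gamma_eq, Nat.add_eq_zero_iff, inversionCount_eq_zero_iff, Finset.sum_eq_zero_iff]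
  refine and_congr Iff.rfl ?_
  simp only [Finset.mem_univ, true_imp_iff]
  exact forall_congr' fun v => by omega

theorem pairwise_vertices :
    (vertices r s).Pairwise fun v w => v.1 < w.1 ∨ v.1 = w.1 ∧ v.2 < w.2 := by
  unfold vertices
  rw [List.pairwise_append, List.pairwise_map, List.pairwise_map]
  refine ⟨(pairwise_finRange _).imp fun h => .inr ⟨rfl, h⟩,
    (pairwise_finRange _).imp fun h => .inr ⟨rfl, h⟩, ?_⟩
  intro v hv w hw
  simp only [List.mem_map] at hv hw
  obtain ⟨i, _, rfl⟩ := hv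
  obtain ⟨j, _, rfl⟩ := hw
  exact .inl Bool.false_lt_true

/-- The remaining beads are numbered by the rank of their good vertices in the order in which the
word is read, so the word is sorted; and no strand keeps two beads. -/
theorem gamma_reduce (d : BeadDiagram r s) : d.reduce.gamma = 0 := by
  rw [gamma_eq_zero_iff]
  constructor
  · unfold word
    rw [List.pairwise_flatMap]
    constructor
    · intro v _
      rw [segment_reduce]
      split_ifs <;> simp
    · refine pairwise_vertices.imp fun {v w} h x hx y hy => ?_
      rw [segment_reduce] at hx hy
      split_ifs at hx with h1
      · split_ifs at hy with h2
        · rw [List.mem_singleton] at hx hy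
          rw [hx, hy]
          refine Finset.card_le_card fun u hu => ?_
          rw [Finset.mem_filter] at hu ⊢
          refine ⟨hu.1, ?_⟩
          rcases hu.2 with hu | ⟨hu, hu'⟩ <;> rcases h with h | ⟨h, h'⟩
          · exact .inl (hu.trans h)
          · exact .inl (h ▸ hu)
          · exact .inl (hu ▸ h)
          · exact .inr ⟨hu.trans h, hu'.trans h'.le⟩
        · simp at hy
      · simp at hx
  · intro v
    rw [length_segment_reduce]
    omega

theorem length_word_eq_sum (d : BeadDiagram r s) :
    d.word.length = ((vertices r s).map fun v => (d.segment v).length).sum := by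
  unfold word
  rw [List.length_flatMap]

theorem reduce_eq_self {d : BeadDiagram r s} (h : d.gamma = 0) : d.reduce = d := by
  have h1 := (gamma_eq_zero_iff d).1 h
  have h2 := (gamma_eq_zero_iff _).1 d.gamma_reduce
  have hl : ∀ v, (d.reduce.segment v).length = (d.segment v).length := by
    intro v
    have := h1.2 v
    rw [length_segment_reduce]
    omega
  have hn : d.reduce.numBeads = d.numBeads := by
    rw [← length_word, ← length_word, length_word_eq_sum, length_word_eq_sum]
    simp only [hl]
  have hw : d.reduce.word = d.word := by
    have hp : d.reduce.word.Perm d.word := by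
      rw [← Multiset.coe_eq_coe, coe_word, coe_word, hn]
    -- Both words are sorted arrangements of `1, …, numBeads`. As their blocks have equal lengths,
    -- equality of the words gives equality of all segments.
    exact hp.eq_of_pairwise (fun a b _ _ => le_antisymm) h2.1 h1.1
  exact ext_segment rfl fun v =>
    flatMap_injOn_of_length _ _ _ (fun v _ => hl v) hw v (mem_vertices v)

theorem beta_eq_zero {d : BeadDiagram r s} (h : d.gamma = 0) : d.beta = 0 := by
  unfold gamma at h
  omega

end BeadDiagram

theorem pairwise_of_length_le_one : ∀ l : List ℕ, l.length ≤ 1 → l.Pairwise (· ≤ ·)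
  | [], _ => .nil
  | [a], _ => List.pairwise_singleton _ a
  | _ :: _ :: _, h => by simp at h

namespace BeadDiagram

variable {r s : ℕ}

/-! ### Multiplication by one bead -/

/-- A walk from the lower diagram that ends in its top row at `i` continues along the `i`-th
identity strand, and meets the new bead iff `i = j`. -/
theorem exits_bead_right (d : BeadDiagram r s) (j : Fin (r + s)) (v : BeadVertex r s) :
    Exits (move d (bead j)) (stackBeads d (bead j)) outer (false, v) (toStack (d.partner v))
      (d.beads v ++ if d.partner v = (true, j) then [d.numBeads + 1] else []) := by
  have hl : stackBeads d (bead j) (false, v) = d.beads v := rfl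
  rcases h : d.partner v with ⟨t, i⟩
  cases t
  · have h1 : move d (bead j) (false, v) = toStack (false, i) := by
      simp [move, h, glue, toStack]
    rw [if_neg (by simp), List.append_nil, ← h1, ← hl]
    exact .leave (h1 ▸ toStack_mem _)
  · have h1 : move d (bead j) (false, v) = (true, (false, i)) := by simp [move, h, glue]
    have h2 : move d (bead j) (true, (false, i)) = toStack (true, i) := rfl
    have h3 := Exits.leave (lab := stackBeads d (bead j)) (h2 ▸ toStack_mem (true, i))
    have h4 := Exits.step (h1 ▸ by simp [outer]) (h1 ▸ h3)
    rw [hl, h1, h2] at h4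
    convert h4 using 2
    by_cases hij : i = j <;> simp [stackBeads, bead, hij, add_comm]

theorem exits_bead_right_top (d : BeadDiagram r s) (j i : Fin (r + s)) :
    Exits (move d (bead j)) (stackBeads d (bead j)) outer (true, (true, i))
      (toStack (d.partner (true, i)))
      ((if i = j then [d.numBeads + 1] else []) ++
        (d.beads (true, i) ++ if d.partner (true, i) = (true, j) then [d.numBeads + 1] else [])) := by
  have h1 : move d (bead j) (true, (true, i)) = (false, (true, i)) := rfl
  have h2 := Exits.step (lab := stackBeads d (bead j)) (h1 ▸ by simp [outer])
    (h1 ▸ exits_bead_right d j (true, i))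
  convert h2 using 2
  by_cases hij : i = j <;> simp [stackBeads, bead, hij, add_comm]

theorem noLoop_bead_right (d : BeadDiagram r s) (j : Fin (r + s)) : NoLoop d (bead j) := by
  rintro ⟨_ | _, v⟩
  · exact ⟨_, _, exits_bead_right d j v⟩
  · rcases v with ⟨_ | _, i⟩
    · have h2 : move d (bead j) (true, (false, i)) = toStack (true, i) := rfl
      exact ⟨_, _, .leave (h2 ▸ toStack_mem (true, i))⟩
    · exact ⟨_, _, exits_bead_right_top d j i⟩

theorem exits_bead_left (d : BeadDiagram r s) (j : Fin (r + s)) (v : BeadVertex r s) :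
    Exits (move (bead j) d) (stackBeads (bead j) d) outer (true, v) (toStack (d.partner v))
      ((d.beads v).map (· + 1) ++ if d.partner v = (false, j) then [1] else []) := by
  have hl : stackBeads (bead j) d (true, v) = (d.beads v).map (· + 1) := rfl
  rcases h : d.partner v with ⟨t, i⟩
  cases t
  · have h1 : move (bead j) d (true, v) = (false, (true, i)) := by simp [move, h, glue]
    have h2 : move (bead j) d (false, (true, i)) = toStack (false, i) := rfl
    have h3 := Exits.leave (lab := stackBeads (bead j) d) (h2 ▸ toStack_mem (false, i))
    have h4 := Exits.step (h1 ▸ by simp [outer]) (h1 ▸ h3)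
    rw [hl, h1, h2] at h4
    convert h4 using 2
    by_cases hij : i = j <;> simp [stackBeads, bead, hij]
  · have h1 : move (bead j) d (true, v) = toStack (true, i) := by
      simp [move, h, glue, toStack]
    rw [if_neg (by simp), List.append_nil, ← h1, ← hl]
    exact .leave (h1 ▸ toStack_mem _)

theorem exits_bead_left_bottom (d : BeadDiagram r s) (j i : Fin (r + s)) :
    Exits (move (bead j) d) (stackBeads (bead j) d) outer (false, (false, i))
      (toStack (d.partner (false, i)))
      ((if i = j then [1] else []) ++
        ((d.beads (false, i)).map (· + 1) ++
          if d.partner (false, i) = (false, j) then [1] else [])) := by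
  have h1 : move (bead j) d (false, (false, i)) = (true, (false, i)) := rfl
  have h2 := Exits.step (lab := stackBeads (bead j) d) (h1 ▸ by simp [outer])
    (h1 ▸ exits_bead_left d j (false, i))
  convert h2 using 2
  by_cases hij : i = j <;> simp [stackBeads, bead, hij]

theorem noLoop_bead_left (d : BeadDiagram r s) (j : Fin (r + s)) : NoLoop (bead j) d := by
  rintro ⟨_ | _, v⟩
  · rcases v with ⟨_ | _, i⟩
    · exact ⟨_, _, exits_bead_left_bottom d j i⟩
    · have h2 : move (bead j) d (false, (true, i)) = toStack (false, i) := rfl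
      exact ⟨_, _, .leave (h2 ▸ toStack_mem (false, i))⟩
  · exact ⟨_, _, exits_bead_left d j v⟩

/-- Add a last bead at the top vertex `j`. -/
noncomputable def addTop (d : BeadDiagram r s) (j : Fin (r + s)) : BeadDiagram r s :=
  concat d (bead j) (noLoop_bead_right d j)

/-- Add a first bead at the bottom vertex `j`. -/
noncomputable def addBottom (d : BeadDiagram r s) (j : Fin (r + s)) : BeadDiagram r s :=
  concat (bead j) d (noLoop_bead_left d j)

theorem numBeads_addTop (d : BeadDiagram r s) (j : Fin (r + s)) :
    (d.addTop j).numBeads = d.numBeads + 1 := rfl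

theorem exits_addTop (d : BeadDiagram r s) (j : Fin (r + s)) (v : BeadVertex r s) :
    Exits (move d (bead j)) (stackBeads d (bead j)) outer (toStack v) (toStack (d.partner v))
      ((if v = (true, j) then [d.numBeads + 1] else []) ++ (d.beads v ++
        if d.partner v = (true, j) then [d.numBeads + 1] else [])) := by
  rcases v with ⟨_ | _, i⟩
  · rw [if_neg (by simp), List.nil_append]
    exact exits_bead_right d j (false, i)
  · have h := exits_bead_right_top d j i
    by_cases hij : i = j
    · rw [if_pos hij] at h
      rw [if_pos (by rw [hij])]
      exact h
    · rw [if_neg hij] at h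
      rw [if_neg (by simpa using hij)]
      exact h

theorem partner_addTop (d : BeadDiagram r s) (j : Fin (r + s)) :
    (d.addTop j).partner = d.partner :=
  funext fun v =>
    congrArg Prod.snd ((exits_concat (noLoop_bead_right d j) v).unique (exits_addTop d j v)).1

theorem beads_addTop (d : BeadDiagram r s) (j : Fin (r + s)) (v : BeadVertex r s) :
    (d.addTop j).beads v = (if v = (true, j) then [d.numBeads + 1] else []) ++ (d.beads v ++
      if d.partner v = (true, j) then [d.numBeads + 1] else []) :=
  ((exits_concat (noLoop_bead_right d j) v).unique (exits_addTop d j v)).2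

theorem exits_addBottom (d : BeadDiagram r s) (j : Fin (r + s)) (v : BeadVertex r s) :
    Exits (move (bead j) d) (stackBeads (bead j) d) outer (toStack v) (toStack (d.partner v))
      ((if v = (false, j) then [1] else []) ++ ((d.beads v).map (· + 1) ++
        if d.partner v = (false, j) then [1] else [])) := by
  rcases v with ⟨_ | _, i⟩
  · have h := exits_bead_left_bottom d j i
    by_cases hij : i = j
    · rw [if_pos hij] at h
      rw [if_pos (by rw [hij])]
      exact h
    · rw [if_neg hij] at h
      rw [if_neg (by simpa using hij)]
      exact h
  · rw [if_neg (by simp), List.nil_append]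
    exact exits_bead_left d j (true, i)

theorem partner_addBottom (d : BeadDiagram r s) (j : Fin (r + s)) :
    (d.addBottom j).partner = d.partner :=
  funext fun v =>
    congrArg Prod.snd ((exits_concat (noLoop_bead_left d j) v).unique (exits_addBottom d j v)).1

theorem beads_addBottom (d : BeadDiagram r s) (j : Fin (r + s)) (v : BeadVertex r s) :
    (d.addBottom j).beads v = (if v = (false, j) then [1] else []) ++ ((d.beads v).map (· + 1) ++
      if d.partner v = (false, j) then [1] else []) :=
  ((exits_concat (noLoop_bead_left d j) v).unique (exits_addBottom d j v)).2

theorem partner_eq_iff (d : BeadDiagram r s) (v w : BeadVertex r s) :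
    d.partner v = w ↔ v = d.partner w :=
  ⟨fun h => by rw [← h, d.partner_partner], fun h => by rw [h, d.partner_partner]⟩

theorem partner_ne (d : BeadDiagram r s) (v : BeadVertex r s) : d.partner v ≠ v := by
  intro h
  have := d.orient_partner v
  rw [h] at this
  cases h' : orient v <;> simp [h'] at this

theorem beads_eq_nil {d : BeadDiagram r s} (h : d.numBeads = 0) (v : BeadVertex r s) :
    d.beads v = [] := by
  refine List.eq_nil_iff_forall_not_mem.2 fun t ht => ?_
  have := mem_beads_bound ht
  omega

/-- A single bead reads `[1]` from either end of its strand. The formula is symmetric in the two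
ends, which is what allows beads to slide through beadless diagrams. -/
theorem beads_addTop_of_beadless {u : BeadDiagram r s} (h : u.numBeads = 0) (j : Fin (r + s))
    (v : BeadVertex r s) :
    (u.addTop j).beads v = if v = (true, j) ∨ v = u.partner (true, j) then [1] else [] := by
  have := u.partner_ne (true, j)
  rw [beads_addTop, beads_eq_nil h, h, List.nil_append]
  simp only [u.partner_eq_iff]
  by_cases h1 : v = (true, j)
  · subst h1
    simp [this.symm]
  · rw [if_neg h1]
    simp [h1]

theorem beads_addBottom_of_beadless {u : BeadDiagram r s} (h : u.numBeads = 0) (j : Fin (r + s))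
    (v : BeadVertex r s) :
    (u.addBottom j).beads v = if v = (false, j) ∨ v = u.partner (false, j) then [1] else [] := by
  have := u.partner_ne (false, j)
  rw [beads_addBottom, beads_eq_nil h, List.map_nil, List.nil_append]
  simp only [u.partner_eq_iff]
  by_cases h1 : v = (false, j)
  · subst h1
    simp [this.symm]
  · rw [if_neg h1]
    simp [h1]

/-- A bead slides along a vertical strand. -/
theorem addBottom_eq_addTop {u : BeadDiagram r s} (h : u.numBeads = 0) {i j : Fin (r + s)}
    (hij : u.partner (false, i) = (true, j)) : u.addBottom i = u.addTop j := by
  refine ext' (fun v => by rw [partner_addBottom, partner_addTop]) fun v => ?_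
  rw [beads_addBottom_of_beadless h, beads_addTop_of_beadless h, hij,
    ((u.partner_eq_iff _ _).1 hij).symm]
  simp only [or_comm]

/-- A bead slides along a horizontal strand of the bottom row. -/
theorem addBottom_eq_addBottom {u : BeadDiagram r s} (h : u.numBeads = 0) {i j : Fin (r + s)}
    (hij : u.partner (false, i) = (false, j)) : u.addBottom i = u.addBottom j := by
  refine ext' (fun v => by rw [partner_addBottom, partner_addBottom]) fun v => ?_
  rw [beads_addBottom_of_beadless h, beads_addBottom_of_beadless h, hij,
    ((u.partner_eq_iff _ _).1 hij).symm]
  simp only [or_comm]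

/-- A bead slides along a horizontal strand of the top row. -/
theorem addTop_eq_addTop {u : BeadDiagram r s} (h : u.numBeads = 0) {i j : Fin (r + s)}
    (hij : u.partner (true, i) = (true, j)) : u.addTop i = u.addTop j := by
  refine ext' (fun v => by rw [partner_addTop, partner_addTop]) fun v => ?_
  rw [beads_addTop_of_beadless h, beads_addTop_of_beadless h, hij,
    ((u.partner_eq_iff _ _).1 hij).symm]
  simp only [or_comm]

/-- Segments of the top row are read towards the good vertex, so a bead added there comes last, and
it has the largest number. -/
theorem segment_addTop {d : BeadDiagram r s} {j : Fin (r + s)} (hj : d.IsGood (true, j))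
    (v : BeadVertex r s) : (d.addTop j).segment v =
      d.segment v ++ if v = (true, j) then [d.numBeads + 1] else [] := by
  unfold segment
  simp only [isGood_congr (partner_addTop d j), beads_addTop, d.partner_eq_iff]
  by_cases hv : d.IsGood v
  · have h1 : v ≠ d.partner (true, j) := by
      rintro rfl
      exact (d.isGood_partner _).1 hv hj
    rw [if_pos hv, if_pos hv, if_neg h1]
    by_cases h2 : v = (true, j)
    · subst h2
      simp
    · simp [h2]
  · have h2 : v ≠ (true, j) := fun h => hv (h ▸ hj)
    simp [hv, h2]

/-- Segments of the bottom row are read away from the good vertex, so a bead added there comes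
first, and it has number 1. -/
theorem segment_addBottom {d : BeadDiagram r s} {j : Fin (r + s)} (hj : d.IsGood (false, j))
    (v : BeadVertex r s) : (d.addBottom j).segment v =
      (if v = (false, j) then [1] else []) ++ (d.segment v).map (· + 1) := by
  unfold segment
  simp only [isGood_congr (partner_addBottom d j), beads_addBottom, d.partner_eq_iff]
  by_cases hv : d.IsGood v
  · have h1 : v ≠ d.partner (false, j) := by
      rintro rfl
      exact (d.isGood_partner _).1 hv hj
    rw [if_pos hv, if_pos hv, if_neg h1]
    by_cases h2 : v = (false, j)
    · subst h2
      simp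
    · split_ifs <;> simp
  · have h2 : v ≠ (false, j) := fun h => hv (h ▸ hj)
    simp [hv, h2]

/-- Since no bead sits at a good top vertex from `j` onwards, the new largest number is appended at
the very end of the word and is alone on its strand. -/
theorem gamma_addTop {d : BeadDiagram r s} {j : Fin (r + s)} (hd : d.gamma = 0)
    (hj : d.IsGood (true, j)) (h : ∀ i, j ≤ i → d.segment (true, i) = []) :
    (d.addTop j).gamma = 0 := by
  rw [gamma_eq_zero_iff] at hd ⊢
  have hl : ∀ v, ((d.addTop j).segment v).length ≤ 1 := by
    intro v
    rw [segment_addTop hj]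
    by_cases hv : v = (true, j)
    · subst hv
      rw [h j le_rfl]
      simp
    · rw [if_neg hv]
      simpa only [List.append_nil, List.nil_append, List.length_map] using hd.2 v
  refine ⟨?_, hl⟩
  unfold word
  rw [List.pairwise_flatMap]
  constructor
  · exact fun v _ => pairwise_of_length_le_one _ (hl v)
  · refine (pairwise_vertices.and (List.pairwise_flatMap.1 hd.1).2).imp fun {v w} hvw x hx y hy => ?_
    have hx' : x ≤ d.numBeads + 1 :=
      (mem_word.1 (mem_word_of_mem_segment hx)).2
    rw [segment_addTop hj] at hx hy
    rw [List.mem_append] at hx hy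
    rcases hy with hy | hy
    · rcases hx with hx | hx
      · exact hvw.2 x hx y hy
      · split_ifs at hx with h1
        · subst h1
          obtain ⟨_ | _, i⟩ := w
          · rcases hvw.1 with h' | ⟨h', _⟩
            · exact absurd (show true < false from h') (by decide)
            · exact absurd (show true = false from h') (by decide)
          · rcases hvw.1 with h' | ⟨_, h'⟩
            · exact absurd (show true < true from h') (by decide)
            · rw [h i (le_of_lt h')] at hy
              simp at hy
        · simp at hx
    · split_ifs at hy
      · rw [List.mem_singleton] at hy
        omega
      · simp at hy

/-- Mirror image of `gamma_addTop`: the number 1 is put in front of a sorted word whose entries are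
shifted up. -/
theorem gamma_addBottom {d : BeadDiagram r s} {j : Fin (r + s)} (hd : d.gamma = 0)
    (hj : d.IsGood (false, j)) (h : ∀ i, i ≤ j → d.segment (false, i) = []) :
    (d.addBottom j).gamma = 0 := by
  rw [gamma_eq_zero_iff] at hd ⊢
  have hl : ∀ v, ((d.addBottom j).segment v).length ≤ 1 := by
    intro v
    rw [segment_addBottom hj]
    by_cases hv : v = (false, j)
    · subst hv
      rw [h j le_rfl]
      simp
    · rw [if_neg hv]
      simpa only [List.append_nil, List.nil_append, List.length_map] using hd.2 v
  refine ⟨?_, hl⟩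
  unfold word
  rw [List.pairwise_flatMap]
  constructor
  · exact fun v _ => pairwise_of_length_le_one _ (hl v)
  · refine (pairwise_vertices.and (List.pairwise_flatMap.1 hd.1).2).imp fun {v w} hvw x hx y hy => ?_
    have hy' : 1 ≤ y := (mem_word.1 (mem_word_of_mem_segment hy)).1
    rw [segment_addBottom hj] at hx hy
    rw [List.mem_append] at hx hy
    rcases hx with hx | hx
    · split_ifs at hx
      · rw [List.mem_singleton] at hx
        omega
      · simp at hx
    · rcases hy with hy | hy
      · split_ifs at hy with h1
        · subst h1
          obtain ⟨_ | _, i⟩ := v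
          · rcases hvw.1 with h' | ⟨_, h'⟩
            · exact absurd (show false < false from h') (by decide)
            · rw [h i (le_of_lt h')] at hx
              simp at hx
          · rcases hvw.1 with h' | ⟨h', _⟩
            · exact absurd (show true < false from h') (by decide)
            · exact absurd (show true = false from h') (by decide)
        · simp at hy
      · obtain ⟨x, hx', rfl⟩ := List.mem_map.1 hx
        obtain ⟨y, hyw, rfl⟩ := List.mem_map.1 hy
        exact Nat.succ_le_succ (hvw.2 x hx' y hyw)

end BeadDiagram

namespace BeadAlgebra

open BeadDiagram

variable {r s : ℕ}

theorem of_mul_of_eq {d₁ d₂ : BeadDiagram r s} (h : NoLoop d₁ d₂) :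
    of d₁ * of d₂ = of (concat d₁ d₂ h) := by
  rw [of_mul_of, mul, dif_pos h]
  rfl

theorem of_mul_of_eq_zero {d₁ d₂ : BeadDiagram r s} (h : ¬ NoLoop d₁ d₂) :
    of d₁ * of d₂ = 0 := by
  rw [of_mul_of, mul, dif_neg h]
  rfl

theorem of_mul_bead (d : BeadDiagram r s) (j : Fin (r + s)) :
    of d * of (bead j) = of (d.addTop j) := of_mul_of_eq _

theorem bead_mul_of (d : BeadDiagram r s) (j : Fin (r + s)) :
    of (bead j) * of d = of (d.addBottom j) := of_mul_of_eq _

end BeadAlgebra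

/-! ### Signs -/

theorem sum_map_eq_count (a : ℕ) (l : List ℕ) :
    (l.map fun y => if y = a then 1 else 0).sum = l.count a := by
  induction l with
  | nil => rfl
  | cons x l ih =>
    rw [List.map_cons, List.sum_cons, ih, List.count_cons, add_comm]
    simp

/-- The interchange of two neighbours respects every comparison except the one between these two,
which the hypotheses exclude. -/
theorem swap_lt_swap_iff {p x y : ℕ} (h1 : x = p → y ≠ p + 1) (h2 : x = p + 1 → y ≠ p) :
    Equiv.swap p (p + 1) y < Equiv.swap p (p + 1) x ↔ y < x := by
  simp only [Equiv.swap_apply_def]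
  split_ifs <;> omega

theorem smallerCount_map_swap {p x : ℕ} {l : List ℕ} (h1 : x = p → p + 1 ∉ l)
    (h2 : x = p + 1 → p ∉ l) :
    smallerCount (Equiv.swap p (p + 1) x) (l.map (Equiv.swap p (p + 1))) = smallerCount x l := by
  unfold smallerCount
  rw [List.map_map]
  congr 1
  refine List.map_congr_left fun y hy => ?_
  simp only [Function.comp,
    swap_lt_swap_iff (fun h h' => h1 h (h' ▸ hy)) (fun h h' => h2 h (h' ▸ hy))]

theorem inversionCount_map_swap_of_not_mem {p : ℕ} {l : List ℕ} (h : p ∉ l ∨ p + 1 ∉ l) :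
    inversionCount (l.map (Equiv.swap p (p + 1))) = inversionCount l := by
  induction l with
  | nil => rfl
  | cons x l ih =>
    simp only [List.mem_cons, not_or] at h
    rw [List.map_cons, inversionCount, inversionCount, ih (h.imp And.right And.right),
      smallerCount_map_swap]
    · rintro rfl
      exact (h.resolve_left fun h => h.1 rfl).2
    · rintro rfl
      exact (h.resolve_right fun h => h.1 rfl).2

/-- Interchanging two neighbouring entries changes the parity of the number of inversions. -/
theorem odd_inversionCount_map_swap {p : ℕ} {l : List ℕ} (hl : l.Nodup) (h1 : p ∈ l)
    (h2 : p + 1 ∈ l) :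
    Odd (inversionCount (l.map (Equiv.swap p (p + 1))) + inversionCount l) := by
  induction l with
  | nil => simp at h1
  | cons x l ih =>
    rw [List.nodup_cons] at hl
    rw [List.map_cons, inversionCount, inversionCount]
    by_cases hx : x = p
    · subst hx
      have h2 : x + 1 ∈ l := by simpa using h2
      rw [inversionCount_map_swap_of_not_mem (.inl hl.1), Equiv.swap_apply_left]
      have e : smallerCount (x + 1) (l.map (Equiv.swap x (x + 1))) = smallerCount x l + l.count (x + 1) := by
        rw [← sum_map_eq_count]
        unfold smallerCount
        rw [List.map_map, ← List.sum_map_add]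
        congr 1
        refine List.map_congr_left fun y hy => ?_
        have : y ≠ x := fun h => hl.1 (h ▸ hy)
        simp only [Function.comp, Equiv.swap_apply_def]
        split_ifs <;> omega
      rw [e, List.count_eq_one_of_mem hl.2 h2]
      exact ⟨smallerCount x l + inversionCount l, by omega⟩
    · by_cases hx' : x = p + 1
      · subst hx'
        have h1 : p ∈ l := by simpa using h1
        rw [inversionCount_map_swap_of_not_mem (.inr hl.1), Equiv.swap_apply_right]
        have e : smallerCount (p + 1) l =
            smallerCount p (l.map (Equiv.swap p (p + 1))) + l.count p := by
          rw [← sum_map_eq_count]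
          unfold smallerCount
          rw [List.map_map, ← List.sum_map_add]
          congr 1
          refine List.map_congr_left fun y hy => ?_
          have : y ≠ p + 1 := fun h => hl.1 (h ▸ hy)
          simp only [Function.comp, Equiv.swap_apply_def]
          split_ifs <;> omega
        rw [e, List.count_eq_one_of_mem hl.2 h1]
        exact ⟨smallerCount p (l.map (Equiv.swap p (p + 1))) + inversionCount l, by omega⟩
      · rw [smallerCount_map_swap (fun h => absurd h hx) (fun h => absurd h hx')]
        obtain ⟨k, hk⟩ := ih hl.2 ((List.mem_cons.1 h1).resolve_left (Ne.symm hx))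
          ((List.mem_cons.1 h2).resolve_left (Ne.symm hx'))
        exact ⟨smallerCount x l + k, by omega⟩

theorem inversionCount_map {f : ℕ → ℕ} (hf : StrictMono f) (l : List ℕ) :
    inversionCount (l.map f) = inversionCount l := by
  induction l with
  | nil => rfl
  | cons x l ih =>
    rw [List.map_cons, inversionCount, inversionCount, ih]
    simp [smallerCount, Function.comp_def, hf.lt_iff_lt]

/-- A number different from `p` and `p + 1` is larger than both of them or smaller than both. -/
theorem even_crossCount_pair {p : ℕ} {a w : List ℕ} (hw : w = [p, p + 1] ∨ w = [p + 1, p])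
    (h1 : p ∉ a) (h2 : p + 1 ∉ a) : Even (crossCount a w) := by
  induction a with
  | nil => exact ⟨0, rfl⟩
  | cons x a ih =>
    simp only [List.mem_cons, not_or] at h1 h2
    rw [crossCount_cons_left]
    refine Even.add ?_ (ih h1.2 h2.2)
    have : smallerCount x w = if p < x then 2 else 0 := by
      obtain rfl | rfl := hw <;> simp [smallerCount] <;> split_ifs <;> omega
    rw [this]
    split_ifs <;> decide

theorem even_pair_crossCount {p : ℕ} {a w : List ℕ} (hw : w = [p, p + 1] ∨ w = [p + 1, p])
    (h1 : p ∉ a) : Even (crossCount w a) := by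
  have : smallerCount (p + 1) a = smallerCount p a := by
    unfold smallerCount
    congr 1
    refine List.map_congr_left fun y hy => ?_
    have : y ≠ p := fun h => h1 (h ▸ hy)
    split_ifs <;> omega
  refine ⟨smallerCount p a, ?_⟩
  obtain rfl | rfl := hw <;> simp [crossCount, this]

/-- Inserting an adjacent pair of neighbours. -/
theorem inversionCount_insert_pair {p : ℕ} {a b w : List ℕ}
    (hw : w = [p, p + 1] ∨ w = [p + 1, p]) (h1 : p ∉ a) (h2 : p + 1 ∉ a) (h3 : p ∉ b) :
    inversionCount (a ++ (w ++ b)) % 2 = (inversionCount (a ++ b) + inversionCount w) % 2 := by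
  obtain ⟨m, hm⟩ := even_crossCount_pair hw h1 h2
  obtain ⟨n, hn⟩ := even_pair_crossCount hw h3
  simp only [inversionCount_append, crossCount_append_right, hm, hn]
  omega

/-! ### Lists with inserted pairs -/

/-- `PairInsert w f l' l`: the list `l` is obtained from `l'` by applying `f` to all entries and
inserting copies of `w`. -/
inductive PairInsert (w : List ℕ) (f : ℕ → ℕ) : List ℕ → List ℕ → Prop
  | nil : PairInsert w f [] []
  | cons (t : ℕ) {l' l : List ℕ} : PairInsert w f l' l → PairInsert w f (t :: l') (f t :: l)
  | pair {l' l : List ℕ} : PairInsert w f l' l → PairInsert w f l' (w ++ l)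

namespace PairInsert

variable {w : List ℕ} {f : ℕ → ℕ}

theorem append {a a' b b' : List ℕ} (h : PairInsert w f a a') (h' : PairInsert w f b b') :
    PairInsert w f (a ++ b) (a' ++ b') := by
  induction h with
  | nil => exact h'
  | cons t _ ih => exact .cons t ih
  | pair _ ih =>
    rw [List.append_assoc]
    exact .pair ih

theorem map (l : List ℕ) : PairInsert w f l (l.map f) := by
  induction l with
  | nil => exact .nil
  | cons t l ih => exact .cons t ih

theorem self : PairInsert w f [] w := by
  have := PairInsert.pair (w := w) (f := f) .nil
  rwa [List.append_nil] at this

theorem length_mod_two (hw : w.length = 2) {l' l : List ℕ} (h : PairInsert w f l' l) :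
    l.length % 2 = l'.length % 2 := by
  induction h with
  | nil => rfl
  | cons t _ ih =>
    simp only [List.length_cons]
    omega
  | pair _ ih =>
    rw [List.length_append, hw]
    omega

/-- `PairInsert` allows any number of copies, which makes it compatible with concatenation; a list
without repetitions can contain at most one. -/
theorem split {l' l : List ℕ} (h : PairInsert w f l' l) (hl : l.Nodup) (hw : w ≠ []) :
    l = l'.map f ∨ ∃ a b, l' = a ++ b ∧ l = a.map f ++ (w ++ b.map f) := by
  induction h with
  | nil => exact .inl rfl
  | cons t _ ih =>
    obtain rfl | ⟨a, b, rfl, rfl⟩ := ih hl.of_cons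
    · exact .inl rfl
    · exact .inr ⟨t :: a, b, rfl, rfl⟩
  | @pair l' l _ ih =>
    obtain rfl | ⟨a, b, rfl, rfl⟩ := ih (List.nodup_append.1 hl).2.1
    · exact .inr ⟨[], l', rfl, rfl⟩
    · obtain ⟨t, ht⟩ := List.exists_mem_of_ne_nil w hw
      exact absurd rfl ((List.nodup_append.1 hl).2.2 t ht t (by simp [ht]))

end PairInsert

namespace BeadDiagram

variable {r s : ℕ}

/-! ### Changing the beads of a factor without changing its strands -/

/-- Running through a strand flips `orient`, and changing diagrams in the middle row flips it back.
So all pieces of a concatenated strand are entered with the same orientation. -/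
theorem orient_move {d₁ d₂ : BeadDiagram r s} {p : Stack r s} (h : move d₁ d₂ p ∉ outer) :
    orient (move d₁ d₂ p).2 = orient p.2 := by
  have key : orient (stackPartner d₁ d₂ p).2 = !orient p.2 := by
    rcases p with ⟨_ | _, v⟩ <;> simp [stackPartner, orient_partner]
  have : ∀ p : Stack r s, glue p ∉ outer → orient (glue p).2 = !orient p.2 := by
    rintro ⟨_ | _, _ | _, i⟩ h <;> by_cases hi : i.val < r <;>
      simp [glue, outer, orient, hi] at h ⊢
  have h2 := this (stackPartner d₁ d₂ p) h
  rw [key, Bool.not_not] at h2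
  exact h2

theorem move_congr {x x' : BeadDiagram r s} (hp : x'.partner = x.partner) (y : BeadDiagram r s) :
    move x' y = move x y := by
  funext p
  unfold move
  rw [hp]

/-- Transfers a comparison of bead lists, strand piece by strand piece, to whole walks. `R` may
depend on the orientation because that is constant along a walk. -/
theorem exits_rel (R : Bool → List ℕ → List ℕ → Prop)
    (happ : ∀ o a a' b b', R o a a' → R o b b' → R o (a ++ b) (a' ++ b'))
    {x x' y : BeadDiagram r s} (hp : x'.partner = x.partner)
    (hR : ∀ p : Stack r s, R (orient p.2) (stackBeads x y p) (stackBeads x' y p))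
    {p q : Stack r s} {l : List ℕ} (h : Exits (move x y) (stackBeads x y) outer p q l) :
    ∃ l', Exits (move x' y) (stackBeads x' y) outer p q l' ∧ R (orient p.2) l l' := by
  rw [move_congr hp]
  induction h with
  | leave h => exact ⟨_, .leave h, hR _⟩
  | step h1 _ ih =>
    obtain ⟨l', h2, h3⟩ := ih
    rw [orient_move h1] at h3
    exact ⟨_, .step h1 h2, happ _ _ _ _ _ (hR _) h3⟩

/-- Loops depend on the strands only; this is `exits_rel` with the trivial relation. -/
theorem noLoop_congr {x x' y : BeadDiagram r s} (hp : x'.partner = x.partner) (h : NoLoop x y) :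
    NoLoop x' y := by
  intro p
  obtain ⟨q, l, h⟩ := h p
  obtain ⟨l', h, _⟩ := exits_rel (fun _ _ _ => True) (fun _ _ _ _ _ _ _ => trivial) hp
    (fun _ => trivial) h
  exact ⟨q, l', h⟩

theorem concat_rel (R : Bool → List ℕ → List ℕ → Prop)
    (happ : ∀ o a a' b b', R o a a' → R o b b' → R o (a ++ b) (a' ++ b'))
    {x x' y : BeadDiagram r s} (hp : x'.partner = x.partner)
    (hR : ∀ p : Stack r s, R (orient p.2) (stackBeads x y p) (stackBeads x' y p))
    (h : NoLoop x y) (h' : NoLoop x' y) :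
    (concat x' y h').partner = (concat x y h).partner ∧
      ∀ v, R (orient v) ((concat x y h).beads v) ((concat x' y h').beads v) := by
  have key : ∀ v, (concat x' y h').partner v = (concat x y h).partner v ∧
      R (orient v) ((concat x y h).beads v) ((concat x' y h').beads v) := by
    intro v
    obtain ⟨l', h1, h2⟩ := exits_rel R happ hp hR (exits_concat h v)
    obtain ⟨h3, rfl⟩ := h1.unique (exits_concat h' v)
    exact ⟨(congrArg Prod.snd h3).symm, h2⟩
  exact ⟨funext fun v => (key v).1, fun v => (key v).2⟩

/-! #### Interchanging two bead numbers -/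

theorem reduce_beta_swap {d d' : BeadDiagram r s} {p : ℕ} (hp : d'.partner = d.partner)
    (hb : ∀ v, d'.beads v = (d.beads v).map (Equiv.swap p (p + 1))) (h1 : 1 ≤ p)
    (h2 : p + 1 ≤ d.numBeads) : d'.reduce = d.reduce ∧ Odd (d'.beta + d.beta) := by
  constructor
  · exact reduce_congr hp fun v => by rw [hb, List.length_map]
  · have hs : ∀ v, d'.segment v = (d.segment v).map (Equiv.swap p (p + 1)) := by
      intro v
      unfold segment
      simp only [isGood_congr hp, hb]
      split_ifs <;> simp
    have hw : d'.word = d.word.map (Equiv.swap p (p + 1)) := by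
      unfold word
      rw [List.map_flatMap, funext hs]
    rw [beta_eq, beta_eq, hw]
    simp only [hs, List.length_map]
    obtain ⟨k, hk⟩ := odd_inversionCount_map_swap d.nodup_word (mem_word.2 ⟨h1, by omega⟩)
      (mem_word.2 ⟨by omega, h2⟩)
    exact ⟨k + ∑ v : BeadVertex r s, if v.2.val < r then (d.segment v).length / 2 else 0, by omega⟩

/-! #### Inserting an adjacent pair of beads -/

/-- The pair of bead numbers `p`, `p + 1`, in decreasing order iff `o`. -/
def beadPair (p : ℕ) (o : Bool) : List ℕ := if o then [p + 1, p] else [p, p + 1]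

theorem beadPair_eq (p : ℕ) (o : Bool) :
    beadPair p o = [p, p + 1] ∨ beadPair p o = [p + 1, p] := by
  cases o
  · exact .inl rfl
  · exact .inr rfl

theorem reduce_beta_insert {d d' : BeadDiagram r s} {p : ℕ} {f : ℕ → ℕ} {o : Bool}
    (hf : StrictMono f) (hfp : ∀ t, f t ≠ p ∧ f t ≠ p + 1) (hp : d'.partner = d.partner)
    (hb : ∀ v, PairInsert (beadPair p (orient v == o)) f (d.beads v) (d'.beads v)) (h1 : 1 ≤ p)
    (h2 : p ≤ d'.numBeads) :
    d'.reduce = d.reduce ∧ d'.beta % 2 = (d.beta + if o then 0 else 1) % 2 := by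
  have hlen : ∀ b, (beadPair p b).length = 2 := fun b => by cases b <;> rfl
  constructor
  · refine reduce_congr hp fun v => ?_
    rw [Nat.odd_iff, Nat.odd_iff, (hb v).length_mod_two (hlen _)]
  have hs : ∀ v, PairInsert (beadPair p (decide (v.2.val < r) == o)) f (d.segment v)
      (d'.segment v) := by
    intro v
    unfold segment
    simp only [isGood_congr hp]
    by_cases hv : d.IsGood v
    · rw [if_pos hv, if_pos hv]
      obtain ⟨_ | _, i⟩ := v
      · simpa [orient] using hb (false, i)
      -- A top segment is read from the other end of the strand, whose orientation is opposite. In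
      -- both rows the inserted pair is thus decreasing iff `(v.2 < r) = o`.
      · have := hb (d.partner (true, i))
        rw [orient_partner, ← hp, d'.beads_partner, hp, d.beads_partner] at this
        simpa [orient] using this
    · rw [if_neg hv, if_neg hv]
      exact .nil
  have hne : ∀ b, beadPair p b ≠ [] := fun b => by cases b <;> simp [beadPair]
  have hmem : ∀ b, p ∈ beadPair p b := fun b => by cases b <;> simp [beadPair]
  have hfm : ∀ l : List ℕ, p ∉ l.map f := fun l h => by
    obtain ⟨t, _, h⟩ := List.mem_map.1 h
    exact (hfp t).1 h
  have hfm' : ∀ l : List ℕ, p + 1 ∉ l.map f := fun l h => by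
    obtain ⟨t, _, h⟩ := List.mem_map.1 h
    exact (hfp t).2 h
  have hs1 : ∀ v, p ∉ d'.segment v → d'.segment v = (d.segment v).map f := by
    intro v hv
    obtain h | ⟨a, b, -, h⟩ := (hs v).split (d'.nodup_segment v) (hne _)
    · exact h
    · exact absurd (by rw [h]; simp [hmem]) hv
  -- The number `p` occurs in the word, and only once: one strand, with good vertex `v₀`, receives
  -- the pair, and all other segments are merely renumbered.
  obtain ⟨v₀, -, hv₀⟩ := List.mem_flatMap.1 (mem_word.2 ⟨h1, h2⟩ : p ∈ d'.word)
  obtain h | ⟨a, b, hab, hab'⟩ := (hs v₀).split (d'.nodup_segment v₀) (hne _)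
  · exact absurd (h ▸ hv₀) (hfm _)
  obtain ⟨V₁, V₂, hV⟩ := List.append_of_mem (mem_vertices v₀)
  have hnd := d'.nodup_word
  unfold word at hnd
  rw [hV, List.flatMap_append, List.flatMap_cons, List.nodup_append, List.nodup_append] at hnd
  have hV₁ : ∀ v ∈ V₁, p ∉ d'.segment v := fun v hv h =>
    hnd.2.2 p (List.mem_flatMap.2 ⟨v, hv, h⟩) p (List.mem_append_left _ hv₀) rfl
  have hV₂ : ∀ v ∈ V₂, p ∉ d'.segment v := fun v hv h =>
    hnd.2.1.2.2 p hv₀ p (List.mem_flatMap.2 ⟨v, hv, h⟩) rfl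
  have hflat : ∀ V : List (BeadVertex r s), (∀ v ∈ V, p ∉ d'.segment v) →
      V.flatMap d'.segment = (V.flatMap d.segment).map f := by
    intro V h
    rw [List.map_flatMap]
    exact List.flatMap_congr fun v hv => hs1 v (h v hv)
  have hother : ∀ v, v ≠ v₀ → p ∉ d'.segment v := by
    intro v hv
    have := mem_vertices v
    rw [hV, List.mem_append, List.mem_cons] at this
    obtain h | h | h := this
    · exact hV₁ v h
    · exact absurd h hv
    · exact hV₂ v h
  have hsum : (∑ v : BeadVertex r s, if v.2.val < r then (d'.segment v).length / 2 else 0) =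
      (∑ v : BeadVertex r s, if v.2.val < r then (d.segment v).length / 2 else 0) +
        if v₀.2.val < r then 1 else 0 := by
    have : ∀ v : BeadVertex r s, (if v.2.val < r then (d'.segment v).length / 2 else 0) =
        (if v.2.val < r then (d.segment v).length / 2 else 0) +
          if v = v₀ then (if v₀.2.val < r then 1 else 0) else 0 := by
      intro v
      by_cases hv : v = v₀
      · subst hv
        rw [hab', hab, if_pos rfl]
        simp only [List.length_append, List.length_map, hlen]
        split_ifs <;> omega
      · rw [if_neg hv, hs1 v (hother v hv), List.length_map, add_zero]
    rw [Finset.sum_congr rfl fun v _ => this v, Finset.sum_add_distrib, Finset.sum_ite_eq',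
      if_pos (Finset.mem_univ _)]
  have hw' : d'.word = ((V₁.flatMap d.segment ++ a).map f) ++
      (beadPair p (decide (v₀.2.val < r) == o) ++ (b ++ V₂.flatMap d.segment).map f) := by
    unfold word
    rw [hV, List.flatMap_append, List.flatMap_cons, hflat V₁ hV₁, hflat V₂ hV₂, hab']
    simp only [List.map_append, List.append_assoc]
  have hw : d.word = (V₁.flatMap d.segment ++ a) ++ (b ++ V₂.flatMap d.segment) := by
    unfold word
    rw [hV, List.flatMap_append, List.flatMap_cons, hab]
    simp only [List.append_assoc]
  have hi := inversionCount_insert_pair (beadPair_eq p (decide (v₀.2.val < r) == o))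
    (hfm (V₁.flatMap d.segment ++ a)) (hfm' _) (hfm (b ++ V₂.flatMap d.segment))
  rw [← hw', ← List.map_append, ← hw, inversionCount_map hf] at hi
  rw [beta_eq, beta_eq, hsum]
  -- Inversion of the pair plus cancelled pair on the left: for `o = true` this is `1 + 1` on the
  -- left and `0 + 0` on the right, for `o = false` it is `0 + 1` and `1 + 0`. The side of `v₀`
  -- drops out modulo 2.
  have hinv : (inversionCount (beadPair p (decide (v₀.2.val < r) == o)) +
      if v₀.2.val < r then 1 else 0) % 2 = (if o then 0 else 1) % 2 := by
    by_cases h : v₀.2.val < r <;> cases o <;>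
      simp [h, beadPair, inversionCount, smallerCount]
  omega

theorem partner_addTop_addTop (x : BeadDiagram r s) (i j : Fin (r + s)) :
    ((x.addTop i).addTop j).partner = x.partner := by
  rw [partner_addTop, partner_addTop]

theorem beads_le {d : BeadDiagram r s} {v : BeadVertex r s} {f : ℕ → ℕ}
    (hf : ∀ t, 1 ≤ t → t ≤ d.numBeads → f t = t) : (d.beads v).map f = d.beads v := by
  conv_rhs => rw [← List.map_id (d.beads v)]
  refine List.map_congr_left fun t ht => ?_
  have := mem_beads_bound ht
  exact hf t this.1 this.2

theorem beads_addTop_swap (x : BeadDiagram r s) {i j : Fin (r + s)} (hij : i ≠ j)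
    (v : BeadVertex r s) : ((x.addTop j).addTop i).beads v =
      (((x.addTop i).addTop j).beads v).map
        (Equiv.swap (x.numBeads + 1) (x.numBeads + 1 + 1)) := by
  have hx : (x.beads v).map (Equiv.swap (x.numBeads + 1) (x.numBeads + 1 + 1)) = x.beads v :=
    beads_le fun t _ _ => Equiv.swap_apply_of_ne_of_ne (by omega) (by omega)
  have hne : ∀ w : BeadVertex r s, w = (true, i) → w ≠ (true, j) := by
    rintro _ rfl h
    exact hij (congrArg Prod.snd h)
  simp only [beads_addTop, partner_addTop, numBeads_addTop, List.map_append, hx]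
  have h1 := hne v
  have h2 := hne (x.partner v)
  by_cases a1 : v = (true, i) <;> by_cases a2 : v = (true, j) <;>
    by_cases b1 : x.partner v = (true, i) <;> by_cases b2 : x.partner v = (true, j) <;>
    simp_all

theorem reduce_beta_concat_swap (x y : BeadDiagram r s) {i j : Fin (r + s)} (hij : i ≠ j)
    (h : NoLoop ((x.addTop i).addTop j) y) (h' : NoLoop ((x.addTop j).addTop i) y) :
    (concat _ _ h').reduce = (concat _ _ h).reduce ∧
      Odd ((concat _ _ h').beta + (concat _ _ h).beta) := by
  have hp : ((x.addTop j).addTop i).partner = ((x.addTop i).addTop j).partner := by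
    rw [partner_addTop_addTop, partner_addTop_addTop]
  have key := concat_rel
    (fun _ l l' => l' = l.map (Equiv.swap (x.numBeads + 1) (x.numBeads + 1 + 1)))
    (fun _ _ _ _ _ h h' => by rw [h, h', List.map_append]) hp ?_ h h'
  · refine reduce_beta_swap key.1 key.2 (by omega) ?_
    show _ ≤ x.numBeads + 1 + 1 + y.numBeads
    omega
  · rintro ⟨_ | _, v⟩
    · exact beads_addTop_swap x hij v
    -- The beads of `y` get numbers from `x.numBeads + 3` on and are not affected by the
    -- interchange.
    · simp only [stackBeads, numBeads_addTop, if_true, List.map_map]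
      refine List.map_congr_left fun t ht => ?_
      have := mem_beads_bound ht
      exact (Equiv.swap_apply_of_ne_of_ne (by omega) (by omega)).symm

theorem reduce_beta_concat_insert (x y : BeadDiagram r s) (k : Fin (r + s)) (h : NoLoop x y)
    (h' : NoLoop ((x.addTop k).addTop k) y) :
    (concat _ _ h').reduce = (concat _ _ h).reduce ∧
      (concat _ _ h').beta % 2 =
        ((concat _ _ h).beta + if orient ((true, k) : BeadVertex r s) then 0 else 1) % 2 := by
  -- Beads of `x` keep their numbers; those of `y` make room for the two new beads.
  set f : ℕ → ℕ := fun t => if t ≤ x.numBeads then t else t + 2 with hf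
  have key := concat_rel
    (fun o => PairInsert (beadPair (x.numBeads + 1) (o == orient ((true, k) : BeadVertex r s))) f)
    (fun _ _ _ _ _ => .append) (partner_addTop_addTop x k k) ?_ h h'
  · refine reduce_beta_insert (f := f) ?_ ?_ key.1 key.2 (by omega) ?_
    · intro a b hab
      simp only [hf]
      split_ifs <;> omega
    · intro t
      simp only [hf]
      split_ifs <;> omega
    · show _ ≤ x.numBeads + 1 + 1 + y.numBeads
      omega
  · rintro ⟨_ | _, v⟩
    · have hx : (x.beads v).map f = x.beads v := beads_le fun t _ ht => if_pos ht
      have hmap : ∀ w, PairInsert w f (x.beads v) (x.beads v) := fun w => by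
        conv => arg 4; rw [← hx]
        exact .map _
      show PairInsert (beadPair (x.numBeads + 1) (orient v == orient ((true, k) : BeadVertex r s))) f
        (x.beads v) (((x.addTop k).addTop k).beads v)
      simp only [beads_addTop, partner_addTop, numBeads_addTop]
      -- The bead added second lies nearer to the top vertex `k`: seen from there the pair is
      -- decreasing, from the other end increasing.
      by_cases h1 : v = (true, k)
      · have h2 : x.partner v ≠ (true, k) := fun h => x.partner_ne v (h.trans h1.symm)
        rw [if_pos h1, if_pos h1, if_neg h2, if_neg h2, h1]
        simp only [BEq.rfl, List.append_nil]
        exact .pair (h1 ▸ hmap _)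
      · by_cases h2 : x.partner v = (true, k)
        · rw [if_neg h1, if_neg h1, if_pos h2, if_pos h2, ← h2, orient_partner]
          have := (hmap (beadPair (x.numBeads + 1) (orient v == !orient v))).append .self
          rw [List.append_nil] at this
          convert this using 1
          cases orient v <;> simp [beadPair]
        · rw [if_neg h1, if_neg h1, if_neg h2, if_neg h2]
          simpa using hmap _
    · show PairInsert _ f ((y.beads v).map (· + x.numBeads))
        ((y.beads v).map (· + (x.numBeads + 1 + 1)))
      have : (y.beads v).map (· + (x.numBeads + 1 + 1)) =
          ((y.beads v).map (· + x.numBeads)).map f := by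
        rw [List.map_map]
        refine List.map_congr_left fun t ht => ?_
        have := mem_beads_bound ht
        simp only [Function.comp, hf]
        rw [if_neg (by omega)]
        omega
      rw [this]
      exact .map _

end BeadDiagram

namespace BeadAlgebra

open BeadDiagram

variable {r s : ℕ}

/-! ### The projection to the reduced diagrams -/

/-- The linear map with `d ↦ (-1)^β(d) d̃`. -/
noncomputable def reduceHom (r s : ℕ) : BeadAlgebra r s →ₗ[ℂ] BeadAlgebra r s :=
  (Finsupp.linearCombination ℂ fun d => (-1 : ℂ) ^ d.beta • of d.reduce :
    (BeadDiagram r s →₀ ℂ) →ₗ[ℂ] BeadAlgebra r s)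

theorem reduceHom_of (d : BeadDiagram r s) :
    reduceHom r s (of d) = (-1 : ℂ) ^ d.beta • of d.reduce := by
  unfold reduceHom of
  erw [Finsupp.linearCombination_single, one_smul]

theorem reduceHom_of_gamma {d : BeadDiagram r s} (h : d.gamma = 0) :
    reduceHom r s (of d) = of d := by
  rw [reduceHom_of, beta_eq_zero h, reduce_eq_self h, pow_zero, one_smul]

theorem reduction_eq (d : BeadDiagram r s) : reduction d = of d - reduceHom r s (of d) := by
  rw [reduceHom_of, reduction]

theorem neg_one_pow_congr {m n : ℕ} (h : m % 2 = n % 2) : (-1 : ℂ) ^ m = (-1 : ℂ) ^ n := by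
  rw [neg_one_pow_eq_pow_mod_two, h, ← neg_one_pow_eq_pow_mod_two]

theorem reduceHom_swap (x y : BeadDiagram r s) {i j : Fin (r + s)} (hij : i ≠ j) :
    reduceHom r s (of x * (of (bead i) * of (bead j) + of (bead j) * of (bead i)) * of y) = 0 := by
  rw [mul_add, ← mul_assoc, ← mul_assoc, of_mul_bead, of_mul_bead, of_mul_bead, of_mul_bead,
    add_mul]
  have hp : ((x.addTop j).addTop i).partner = ((x.addTop i).addTop j).partner := by
    rw [partner_addTop_addTop, partner_addTop_addTop]
  by_cases h : NoLoop ((x.addTop i).addTop j) y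
  · have h' := noLoop_congr hp h
    obtain ⟨h1, k, h2⟩ := reduce_beta_concat_swap x y hij h h'
    rw [of_mul_of_eq h, of_mul_of_eq h', map_add, reduceHom_of, reduceHom_of, h1,
      neg_one_pow_congr (m := (concat _ _ h').beta) (n := (concat _ _ h).beta + 1) (by omega), pow_succ]
    simp
  · have h' : ¬ NoLoop ((x.addTop j).addTop i) y := fun h' => h (noLoop_congr hp.symm h')
    rw [of_mul_of_eq_zero h, of_mul_of_eq_zero h', add_zero, map_zero]

theorem reduceHom_pair (x y : BeadDiagram r s) (k : Fin (r + s)) :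
    reduceHom r s (of x * of (bead k) ^ 2 * of y) =
      (if k.val < r then -1 else 1 : ℂ) • reduceHom r s (of x * of y) := by
  rw [pow_two, ← mul_assoc, of_mul_bead, of_mul_bead]
  have hp := partner_addTop_addTop x k k
  by_cases h : NoLoop x y
  · have h' := noLoop_congr hp h
    obtain ⟨h1, h2⟩ := reduce_beta_concat_insert x y k h h'
    rw [of_mul_of_eq h, of_mul_of_eq h', reduceHom_of, reduceHom_of, h1, neg_one_pow_congr h2]
    by_cases hk : k.val < r
    · simp [orient, hk, pow_succ]
    · simp [orient, hk]
  · have h' : ¬ NoLoop ((x.addTop k).addTop k) y := fun h' => h (noLoop_congr hp.symm h')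
    rw [of_mul_of_eq_zero h, of_mul_of_eq_zero h', map_zero, smul_zero]

theorem forall_reduceHom_eq_zero {z : BeadAlgebra r s}
    (h : ∀ a b : BeadDiagram r s, reduceHom r s (of a * z * of b) = 0) (x y : BeadAlgebra r s) :
    reduceHom r s (x * z * y) = 0 := by
  refine induction_on (P := fun x => reduceHom r s (x * z * y) = 0) x (by simp) (fun a => ?_)
    (fun x x' h h' => ?_) (fun c x h => ?_)
  · refine induction_on (P := fun y => reduceHom r s (of a * z * y) = 0) y (by simp)
      (fun b => h a b) (fun y y' h h' => ?_) (fun c y h => ?_)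
    · rw [mul_add, map_add, h, h', add_zero]
    · rw [mul_smul_comm, map_smul, h, smul_zero]
  · rw [add_mul, add_mul, map_add, h, h', add_zero]
  · rw [smul_mul_assoc, smul_mul_assoc, map_smul, h, smul_zero]

/-- The elements all of whose multiples are annihilated by `reduceHom`. -/
noncomputable def reduceKernel (r s : ℕ) : TwoSidedIdeal (BeadAlgebra r s) :=
  TwoSidedIdeal.mk' {z | ∀ x y, reduceHom r s (x * z * y) = 0}
    (fun x y => by simp)
    (fun h h' x y => by rw [mul_add, add_mul, map_add, h, h', add_zero])
    (fun h x y => by rw [mul_neg, neg_mul, map_neg, h, neg_zero])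
    (fun {a z} h x y => by rw [← mul_assoc x a z, h])
    (fun {z a} h x y => by rw [← mul_assoc x z a, mul_assoc, h])

theorem mem_reduceKernel {z : BeadAlgebra r s} :
    z ∈ reduceKernel r s ↔ ∀ x y, reduceHom r s (x * z * y) = 0 :=
  TwoSidedIdeal.mem_mk' _ _ _ _ _ _ _

/-- The generators of `L` remain in the kernel of `reduceHom` after multiplication by diagrams on
both sides, so they lie in the ideal `reduceKernel`; taking both factors equal to 1 gives the claim.
-/
theorem reduceHom_eq_zero_of_mem {x : BeadAlgebra r s} (hx : x ∈ cliffordSubmodule r s) :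
    reduceHom r s x = 0 := by
  obtain ⟨y, hy, rfl⟩ := hx
  have h : cliffordIdeal r s ≤ (reduceKernel r s).comap (BD' r s).val := by
    refine TwoSidedIdeal.span_le.2 ?_
    intro z hz
    refine TwoSidedIdeal.mem_comap _ |>.2 (mem_reduceKernel.2 ?_)
    refine forall_reduceHom_eq_zero fun a b => ?_
    show reduceHom r s (of a * (z : BeadAlgebra r s) * of b) = 0
    obtain (⟨k, hk, hz⟩ | ⟨k, hk, hz⟩) | ⟨i, j, hij, hz⟩ := hz
    · rw [hz, mul_add, add_mul, map_add, reduceHom_pair, if_pos hk, mul_one, neg_one_smul,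
        neg_add_cancel]
    · rw [hz, mul_sub, sub_mul, map_sub, reduceHom_pair, if_neg (not_lt.2 hk), mul_one, one_smul,
        sub_self]
    · rw [hz, reduceHom_swap a b hij]
  have := mem_reduceKernel.1 ((TwoSidedIdeal.mem_comap _).1 (h hy)) 1 1
  rwa [one_mul, mul_one] at this

end BeadAlgebra

/-! ### Words in anticommuting elements -/

/-- `x` is an integral multiple of `y`. -/
def IsMultiple {R : Type} [Ring R] (x y : R) : Prop := ∃ ε : ℤ, x = ε • y

namespace IsMultiple

variable {R : Type} [Ring R]

theorem refl (x : R) : IsMultiple x x := ⟨1, (one_zsmul x).symm⟩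

theorem of_eq {x y : R} (h : x = y) : IsMultiple x y := h ▸ refl x

theorem zero (y : R) : IsMultiple 0 y := ⟨0, (zero_zsmul y).symm⟩

theorem trans {x y z : R} (h : IsMultiple x y) (h' : IsMultiple y z) : IsMultiple x z := by
  obtain ⟨a, rfl⟩ := h
  obtain ⟨b, rfl⟩ := h'
  exact ⟨a * b, (mul_zsmul _ _ _).symm⟩

theorem mul_left (a : R) {x y : R} (h : IsMultiple x y) : IsMultiple (a * x) (a * y) := by
  obtain ⟨ε, rfl⟩ := h
  exact ⟨ε, mul_smul_comm _ _ _⟩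

theorem mul_right (a : R) {x y : R} (h : IsMultiple x y) : IsMultiple (x * a) (y * a) := by
  obtain ⟨ε, rfl⟩ := h
  exact ⟨ε, smul_mul_assoc _ _ _⟩

theorem neg {x y : R} (h : IsMultiple x y) : IsMultiple (-x) y := by
  obtain ⟨ε, rfl⟩ := h
  exact ⟨-ε, (neg_zsmul _ _).symm⟩

theorem neg_right {x y : R} (h : IsMultiple x y) : IsMultiple x (-y) := by
  obtain ⟨ε, rfl⟩ := h
  exact ⟨-ε, by rw [neg_zsmul, zsmul_neg, neg_neg]⟩

end IsMultiple

/-- A family of elements that anticommute pairwise and whose squares are `1` or `-1`. -/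
structure IsCliffordFamily {R ι : Type} [Ring R] (c : ι → R) : Prop where
  anticomm : ∀ i j, i ≠ j → c i * c j = -(c j * c i)
  sq : ∀ i, IsMultiple (c i * c i) 1

namespace IsCliffordFamily

variable {R ι : Type} [Ring R] {c : ι → R}

theorem mul_prod (hc : IsCliffordFamily c) {i : ι} {l : List ι} (h : i ∉ l) :
    IsMultiple (c i * (l.map c).prod) ((l.map c).prod * c i) := by
  induction l with
  | nil => exact .of_eq (by simp)
  | cons a l ih =>
    simp only [List.mem_cons, not_or] at h
    rw [List.map_cons, List.prod_cons, ← mul_assoc, hc.anticomm i a h.1, neg_mul, mul_assoc,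
      mul_assoc]
    exact ((ih h.2).mul_left _).neg

theorem prod_mul (hc : IsCliffordFamily c) {i : ι} {l : List ι} (h : i ∉ l) :
    IsMultiple ((l.map c).prod * c i) (c i * (l.map c).prod) := by
  induction l with
  | nil => exact .of_eq (by simp)
  | cons a l ih =>
    simp only [List.mem_cons, not_or] at h
    rw [List.map_cons, List.prod_cons, ← mul_assoc, hc.anticomm i a h.1, neg_mul, mul_assoc,
      mul_assoc]
    exact ((ih h.2).mul_left _).neg_right

theorem prod_filter (hc : IsCliffordFamily c) (P : ι → Prop) [DecidablePred P] (l : List ι) :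
    IsMultiple (l.map c).prod
      (((l.filter (P ·)).map c).prod * ((l.filter (¬ P ·)).map c).prod) := by
  induction l with
  | nil => exact .of_eq (by simp)
  | cons a l ih =>
    rw [List.map_cons, List.prod_cons]
    refine (ih.mul_left _).trans ?_
    by_cases h : P a
    · exact .of_eq (by simp [h, mul_assoc])
    · have h1 : a ∉ l.filter (P ·) := by simp [h]
      rw [← mul_assoc]
      refine ((hc.mul_prod h1).mul_right _).trans (.of_eq ?_)
      simp [h, mul_assoc]

/-- Insertion sort: the new letter passes smaller letters at the cost of a sign and cancels against
an equal one. -/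
theorem exists_insert [LinearOrder ι] (hc : IsCliffordFamily c) (i : ι) (l : List ι)
    (hl : l.Pairwise (· < ·)) : ∃ l' : List ι, l'.Pairwise (· < ·) ∧ l' ⊆ i :: l ∧
      IsMultiple (c i * (l.map c).prod) (l'.map c).prod := by
  induction l with
  | nil => exact ⟨[i], List.pairwise_singleton _ _, List.Subset.refl _, .of_eq (by simp)⟩
  | cons a l ih =>
    obtain ⟨h1, h2⟩ := List.pairwise_cons.1 hl
    rcases lt_trichotomy i a with h | rfl | h
    · refine ⟨i :: a :: l, List.pairwise_cons.2 ⟨?_, hl⟩, List.Subset.refl _, .of_eq (by simp)⟩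
      rintro b (_ | ⟨_, hb⟩)
      · exact h
      · exact h.trans (h1 b hb)
    · refine ⟨l, h2, fun b hb => by simp [hb], ?_⟩
      rw [List.map_cons, List.prod_cons, ← mul_assoc]
      exact ((hc.sq i).mul_right _).trans (.of_eq (one_mul _))
    · obtain ⟨l', h3, h4, h5⟩ := ih h2
      refine ⟨a :: l', List.pairwise_cons.2 ⟨fun b hb => ?_, h3⟩, ?_, ?_⟩
      · rcases List.mem_cons.1 (h4 hb) with rfl | hb
        · exact h
        · exact h1 b hb
      · intro b hb
        rcases List.mem_cons.1 hb with rfl | hb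
        · simp
        · rcases List.mem_cons.1 (h4 hb) with rfl | hb <;> simp [*]
      · rw [List.map_cons, List.prod_cons, ← mul_assoc, hc.anticomm i a h.ne', neg_mul, mul_assoc,
          List.map_cons, List.prod_cons]
        exact (h5.mul_left _).neg

theorem exists_sorted [LinearOrder ι] (hc : IsCliffordFamily c) (l : List ι) :
    ∃ l' : List ι, l'.Pairwise (· < ·) ∧ l' ⊆ l ∧ IsMultiple (l.map c).prod (l'.map c).prod := by
  induction l with
  | nil => exact ⟨[], .nil, List.Subset.refl _, .refl _⟩
  | cons a l ih =>
    obtain ⟨l₁, h1, h2, h3⟩ := ih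
    obtain ⟨l₂, h4, h5, h6⟩ := hc.exists_insert a l₁ h1
    refine ⟨l₂, h4, fun b hb => ?_, ?_⟩
    · rcases List.mem_cons.1 (h5 hb) with rfl | hb
      · simp
      · exact List.mem_cons_of_mem _ (h2 hb)
    · rw [List.map_cons, List.prod_cons]
      exact (h3.mul_left _).trans h6

/-- If two letters agree in front of `e`, at most one of them is needed there. -/
theorem prod_mul_of_forall (hc : IsCliffordFamily c) {a b : ι} {e : R} (h : c b * e = c a * e)
    (l : List ι) (hl : ∀ i ∈ l, i = a ∨ i = b) :
    IsMultiple ((l.map c).prod * e) e ∨ IsMultiple ((l.map c).prod * e) (c a * e) := by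
  have haa : IsMultiple (c a * (c a * e)) e := by
    rw [← mul_assoc]
    exact ((hc.sq a).mul_right e).trans (.of_eq (one_mul e))
  induction l with
  | nil => exact .inl (.of_eq (by simp))
  | cons i l ih =>
    have hi : c i * e = c a * e := by
      rcases hl i (by simp) with rfl | rfl
      · rfl
      · exact h
    rw [List.map_cons, List.prod_cons, mul_assoc]
    rcases ih fun i hi => hl i (by simp [hi]) with h1 | h1
    · exact .inr ((h1.mul_left _).trans (.of_eq hi))
    · refine .inl ((h1.mul_left _).trans ?_)
      -- For `i = b ≠ a`: `c b * c a * e = -(c a * c b * e) = -(c a * c a * e)`, a multiple of `e`.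
      by_cases hia : i = a
      · subst hia
        exact haa
      · rw [← mul_assoc, hc.anticomm i a hia, neg_mul, mul_assoc, hi]
        exact haa.neg

end IsCliffordFamily

namespace BeadAlgebra

open BeadDiagram

variable {r s : ℕ}

/-! ### The quotient by the Clifford relations -/

/-- The projection of `BD'` to its quotient by the ideal `L`. -/
noncomputable def cliffordMk (r s : ℕ) : BD' r s →+* (cliffordIdeal r s).ringCon.Quotient :=
  (cliffordIdeal r s).ringCon.mk'

theorem cliffordMk_eq_iff {x y : BD' r s} :
    cliffordMk r s x = cliffordMk r s y ↔ x - y ∈ cliffordIdeal r s :=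
  (RingCon.eq _).trans (TwoSidedIdeal.rel_iff _ _ _)

/-- The class of a diagram. -/
noncomputable def cls (d : BeadDiagram r s) (h : of d ∈ BD' r s) :
    (cliffordIdeal r s).ringCon.Quotient := cliffordMk r s ⟨of d, h⟩

theorem cls_mul_cls {d d' e : BeadDiagram r s} (h : of d ∈ BD' r s) (h' : of d' ∈ BD' r s)
    (he : of d * of d' = of e) :
    cls d h * cls d' h' = cls e (he ▸ mul_mem h h') := by
  unfold cls
  rw [← map_mul]
  congr 1
  exact Subtype.ext he

theorem cls_mul_cls_eq_zero {d d' : BeadDiagram r s} (h : of d ∈ BD' r s) (h' : of d' ∈ BD' r s)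
    (he : of d * of d' = 0) : cls d h * cls d' h' = 0 := by
  unfold cls
  rw [← map_mul, ← map_zero (cliffordMk r s)]
  congr 1
  exact Subtype.ext he

theorem cls_congr {d d' : BeadDiagram r s} (h : of d ∈ BD' r s) (e : d = d') :
    cls d h = cls d' (e ▸ h) := by
  subst e
  rfl

theorem bead_mem (i : Fin (r + s)) : of (bead i) ∈ BD' r s :=
  Algebra.subset_adjoin (.inr ⟨i, rfl⟩)

/-- The class of a one-bead diagram. -/
noncomputable def letter (i : Fin (r + s)) : (cliffordIdeal r s).ringCon.Quotient :=
  cls (bead i) (bead_mem i)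

theorem cliffordMk_eq_zero {x : BD' r s} (h : x ∈ cliffordIdeal r s) : cliffordMk r s x = 0 := by
  rw [← map_zero (cliffordMk r s), cliffordMk_eq_iff, sub_zero]
  exact h

theorem isCliffordFamily_letter : IsCliffordFamily (letter (r := r) (s := s)) where
  anticomm i j hij := by
    have h : cliffordMk r s (⟨of (bead i), bead_mem i⟩ * ⟨of (bead j), bead_mem j⟩ +
        ⟨of (bead j), bead_mem j⟩ * ⟨of (bead i), bead_mem i⟩) = 0 :=
      cliffordMk_eq_zero (TwoSidedIdeal.subset_span (.inr ⟨i, j, hij, rfl⟩))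
    rw [map_add, map_mul, map_mul] at h
    exact eq_neg_of_add_eq_zero_left h
  sq i := by
    by_cases hi : i.val < r
    · have h : cliffordMk r s (⟨of (bead i), bead_mem i⟩ ^ 2 + 1) = 0 :=
        cliffordMk_eq_zero (TwoSidedIdeal.subset_span (.inl (.inl ⟨i, hi, rfl⟩)))
      rw [map_add, map_pow, map_one, pow_two] at h
      exact (IsMultiple.of_eq (eq_neg_of_add_eq_zero_left h)).trans (IsMultiple.refl _).neg
    · have h : cliffordMk r s (⟨of (bead i), bead_mem i⟩ ^ 2 - 1) = 0 :=
        cliffordMk_eq_zero (TwoSidedIdeal.subset_span (.inl (.inr ⟨i, not_lt.1 hi, rfl⟩)))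
      rw [map_sub, map_pow, map_one, pow_two] at h
      exact .of_eq (sub_eq_zero.1 h)

theorem addTop_mem {d : BeadDiagram r s} (h : of d ∈ BD' r s) (j : Fin (r + s)) :
    of (d.addTop j) ∈ BD' r s := by
  rw [← of_mul_bead]
  exact mul_mem h (bead_mem j)

theorem addBottom_mem {d : BeadDiagram r s} (h : of d ∈ BD' r s) (j : Fin (r + s)) :
    of (d.addBottom j) ∈ BD' r s := by
  rw [← bead_mul_of]
  exact mul_mem (bead_mem j) h

theorem cls_mul_letter {d : BeadDiagram r s} (h : of d ∈ BD' r s) (j : Fin (r + s)) :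
    cls d h * letter j = cls (d.addTop j) (addTop_mem h j) :=
  cls_mul_cls h _ (of_mul_bead d j)

theorem letter_mul_cls {d : BeadDiagram r s} (h : of d ∈ BD' r s) (j : Fin (r + s)) :
    letter j * cls d h = cls (d.addBottom j) (addBottom_mem h j) :=
  cls_mul_cls _ h (bead_mul_of d j)

/-- Sliding is an equality of diagrams and uses no Clifford relation. The two lemmas below treat the
horizontal strands. -/
theorem letter_mul_eq_mul_letter {u : BeadDiagram r s} (h : of u ∈ BD' r s)
    (hu : u.numBeads = 0) {i j : Fin (r + s)} (hij : u.partner (false, i) = (true, j)) :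
    letter i * cls u h = cls u h * letter j := by
  rw [letter_mul_cls, cls_mul_letter]
  exact cls_congr _ (addBottom_eq_addTop hu hij)

theorem letter_mul_eq_letter_mul {u : BeadDiagram r s} (h : of u ∈ BD' r s)
    (hu : u.numBeads = 0) {i j : Fin (r + s)} (hij : u.partner (false, i) = (false, j)) :
    letter i * cls u h = letter j * cls u h := by
  rw [letter_mul_cls, letter_mul_cls]
  exact cls_congr _ (addBottom_eq_addBottom hu hij)

theorem mul_letter_eq_mul_letter {u : BeadDiagram r s} (h : of u ∈ BD' r s)
    (hu : u.numBeads = 0) {i j : Fin (r + s)} (hij : u.partner (true, i) = (true, j)) :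
    cls u h * letter i = cls u h * letter j := by
  rw [cls_mul_letter, cls_mul_letter]
  exact cls_congr _ (addTop_eq_addTop hu hij)

/-- A product of one-bead diagrams. -/
noncomputable def letters (l : List (Fin (r + s))) : (cliffordIdeal r s).ringCon.Quotient :=
  (l.map letter).prod

theorem letters_nil : letters ([] : List (Fin (r + s))) = 1 := rfl

theorem letters_cons (i : Fin (r + s)) (l : List (Fin (r + s))) :
    letters (i :: l) = letter i * letters l := by
  unfold letters
  rw [List.map_cons, List.prod_cons]

theorem letters_append (l l' : List (Fin (r + s))) :
    letters (l ++ l') = letters l * letters l' := by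
  unfold letters
  rw [List.map_append, List.prod_append]

theorem letters_singleton (i : Fin (r + s)) : letters [i] = letter i := by
  rw [letters_cons, letters_nil, mul_one]

theorem letters_mul_cls {u : BeadDiagram r s} (h : of u ∈ BD' r s) (hu : u.numBeads = 0)
    (f : Fin (r + s) → Fin (r + s)) (l : List (Fin (r + s)))
    (hl : ∀ i ∈ l, u.partner (false, i) = (true, f i)) :
    letters l * cls u h = cls u h * letters (l.map f) := by
  induction l with
  | nil => rw [List.map_nil, letters_nil, one_mul, mul_one]
  | cons i l ih =>
    rw [List.map_cons, letters_cons, letters_cons, mul_assoc, ih fun i hi => hl i (by simp [hi]),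
      ← mul_assoc, letter_mul_eq_mul_letter h hu (hl i (by simp)), mul_assoc]

/-! ### Moving all beads below or above a beadless diagram -/

/-- Multiples of words in which all beads lie below or above a diagram without beads. -/
def IsSplit (q : (cliffordIdeal r s).ringCon.Quotient) : Prop :=
  ∃ I J u, ∃ h : of u ∈ BD' r s, u.numBeads = 0 ∧
    IsMultiple q (letters I * cls u h * letters J)

theorem isSplit_one : IsSplit (1 : (cliffordIdeal r s).ringCon.Quotient) :=
  ⟨[], [], 1, one_mem _, rfl, .of_eq (by
    rw [letters_nil, one_mul, mul_one]
    exact (map_one (cliffordMk r s)).symm)⟩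

/-- The coefficient 0 is admitted because products with a loop vanish. -/
theorem isSplit_zero : IsSplit (0 : (cliffordIdeal r s).ringCon.Quotient) :=
  ⟨[], [], 1, one_mem _, rfl, .zero _⟩

theorem IsSplit.of_isMultiple {q q' : (cliffordIdeal r s).ringCon.Quotient} (h : IsSplit q)
    (h' : IsMultiple q' q) : IsSplit q' := by
  obtain ⟨I, J, u, hu, h1, h2⟩ := h
  exact ⟨I, J, u, hu, h1, h'.trans h2⟩

theorem IsSplit.letters_mul {q : (cliffordIdeal r s).ringCon.Quotient} (h : IsSplit q)
    (l : List (Fin (r + s))) : IsSplit (letters l * q) := by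
  obtain ⟨I, J, u, hu, h1, h2⟩ := h
  refine ⟨l ++ I, J, u, hu, h1, ?_⟩
  rw [letters_append, mul_assoc, mul_assoc, ← mul_assoc (letters I)]
  exact h2.mul_left _

theorem IsSplit.mul_letters {q : (cliffordIdeal r s).ringCon.Quotient} (h : IsSplit q)
    (l : List (Fin (r + s))) : IsSplit (q * letters l) := by
  obtain ⟨I, J, u, hu, h1, h2⟩ := h
  refine ⟨I, J ++ l, u, hu, h1, ?_⟩
  rw [letters_append, ← mul_assoc]
  exact h2.mul_right _

theorem isSplit_cls_mul_cls {u v : BeadDiagram r s} (hu : of u ∈ BD' r s) (hv : of v ∈ BD' r s)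
    (hu' : u.numBeads = 0) (hv' : v.numBeads = 0) : IsSplit (cls u hu * cls v hv) := by
  by_cases h : NoLoop u v
  · have e := of_mul_of_eq h
    refine ⟨[], [], concat u v h, e ▸ mul_mem hu hv, ?_, .of_eq ?_⟩
    · show u.numBeads + v.numBeads = 0
      omega
    · rw [cls_mul_cls hu hv e, letters_nil, one_mul, mul_one]
  · rw [cls_mul_cls_eq_zero hu hv (of_mul_of_eq_zero h)]
    exact isSplit_zero

theorem transposition_mem (i : ℕ) (h : i + 1 < r + s) (h' : i + 1 ≠ r) :
    of (transposition (r := r) (s := s) i h h') ∈ BD' r s :=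
  Algebra.subset_adjoin (.inl (.inl ⟨i, h, h', rfl⟩))

theorem cupCap_mem (hr : 0 < r) (hs : 0 < s) : of (cupCap hr hs) ∈ BD' r s :=
  Algebra.subset_adjoin (.inl (.inr ⟨hr, hs, rfl⟩))

/-- All strands of a transposition are vertical, so the beads in between slide up through it, with
permuted labels. -/
theorem IsSplit.mul_transposition {q : (cliffordIdeal r s).ringCon.Quotient} (hq : IsSplit q)
    (i : ℕ) (h : i + 1 < r + s) (h' : i + 1 ≠ r) :
    IsSplit (q * cls (transposition i h h') (transposition_mem i h h')) := by
  obtain ⟨I, J, u, hu, h1, h2⟩ := hq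
  refine IsSplit.of_isMultiple ?_ (h2.mul_right _)
  rw [mul_assoc, letters_mul_cls (transposition_mem i h h') rfl
    (Equiv.swap ⟨i, by omega⟩ ⟨i + 1, h⟩) J (fun _ _ => rfl), ← mul_assoc, mul_assoc (letters I)]
  exact ((isSplit_cls_mul_cls hu _ h1 rfl).letters_mul I).mul_letters _

/-- The horizontal strand in the top row of `d` and the one in the bottom row of `cupCap` close up:
the walk alternates forever between two points of the middle row. -/
theorem not_noLoop_cupCap {d : BeadDiagram r s} (hr : 0 < r) (hs : 0 < s)
    (h : d.partner (true, ⟨r - 1, by omega⟩) = (true, ⟨r, by omega⟩)) :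
    ¬ NoLoop d (cupCap hr hs) := by
  intro hd
  have key : ∀ {p q : Stack r s} {l : List ℕ},
      Exits (move d (cupCap hr hs)) (stackBeads d (cupCap hr hs)) outer p q l →
      p ≠ (false, (true, ⟨r - 1, by omega⟩)) ∧ p ≠ (true, (false, ⟨r, by omega⟩)) := by
    have e1 : move d (cupCap hr hs) (false, (true, ⟨r - 1, by omega⟩)) =
        (true, (false, ⟨r, by omega⟩)) := by
      simp [move, h, glue]
    have e2 : move d (cupCap hr hs) (true, (false, ⟨r, by omega⟩)) =
        (false, (true, ⟨r - 1, by omega⟩)) := by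
      have : ¬ r = r - 1 := by omega
      simp [move, cupCap, glue, this]
    intro p q l hp
    induction hp with
    | leave hp =>
      constructor
      · rintro rfl
        rw [e1] at hp
        simp [outer] at hp
      · rintro rfl
        rw [e2] at hp
        simp [outer] at hp
    | step _ _ ih =>
      constructor
      · rintro rfl
        exact ih.2 e1
      · rintro rfl
        exact ih.1 e2
  obtain ⟨q, l, hp⟩ := hd (false, (true, ⟨r - 1, by omega⟩))
  exact (key hp).1 rfl

/-- The bead caught between `u` and `cupCap` escapes along its strand in `u`. If that strand is
vertical, the bead slides to the bottom; if it ends at the other neighbour of the wall, the product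
has a loop and is zero; otherwise the bead reaches a top vertex `t` away from the wall and slides up
through `cupCap`. -/
theorem isSplit_mul_letter_mul_cupCap {u : BeadDiagram r s} (hu : of u ∈ BD' r s)
    (hu' : u.numBeads = 0) (hr : 0 < r) (hs : 0 < s) :
    IsSplit (cls u hu * (letter ⟨r - 1, by omega⟩ * cls (cupCap hr hs) (cupCap_mem hr hs))) := by
  rw [← mul_assoc]
  rcases h : u.partner (true, ⟨r - 1, by omega⟩) with ⟨_ | _, t⟩
  · rw [← letter_mul_eq_mul_letter hu hu' ((u.partner_eq_iff _ _).1 h).symm, mul_assoc,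
      ← letters_singleton]
    exact (isSplit_cls_mul_cls hu _ hu' rfl).letters_mul _
  · by_cases ht : t.val = r
    · have ht' : t = ⟨r, by omega⟩ := Fin.ext ht
      rw [cls_mul_letter, cls_mul_cls_eq_zero]
      · exact isSplit_zero
      · refine of_mul_of_eq_zero (not_noLoop_cupCap hr hs ?_)
        rw [partner_addTop, h, ht']
    · have ht' : t.val ≠ r - 1 := fun h' =>
        u.partner_ne _ (h.trans (Prod.ext rfl (Fin.ext h')))
      rw [mul_letter_eq_mul_letter hu hu' h, mul_assoc,
        letter_mul_eq_mul_letter (j := t) (cupCap_mem hr hs) rfl (by simp [cupCap, ht, ht']),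
        ← mul_assoc, ← letters_singleton]
      exact (isSplit_cls_mul_cls hu _ hu' rfl).mul_letters _

/-- Beads away from the wall slide up through `cupCap`. Those at `r - 1` and `r` sit on one
horizontal strand, where the Clifford relations leave at most one bead, treated by the preceding
lemma. -/
theorem IsSplit.mul_cupCap {q : (cliffordIdeal r s).ringCon.Quotient} (hq : IsSplit q)
    (hr : 0 < r) (hs : 0 < s) : IsSplit (q * cls (cupCap hr hs) (cupCap_mem hr hs)) := by
  obtain ⟨I, J, u, hu, h1, h2⟩ := hq
  refine IsSplit.of_isMultiple ?_ (h2.mul_right _)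
  set e := cls (cupCap hr hs) (cupCap_mem hr hs) with he
  set a : Fin (r + s) := ⟨r - 1, by omega⟩ with ha
  set b : Fin (r + s) := ⟨r, by omega⟩ with hb
  have hba : letter b * e = letter a * e := by
    refine letter_mul_eq_letter_mul _ rfl ?_
    have : ¬ r = r - 1 := by omega
    simp [cupCap, ha, hb, this]
  have hJ := isCliffordFamily_letter.prod_filter (fun i : Fin (r + s) => i = a ∨ i = b) J
  set J₁ := J.filter (fun i : Fin (r + s) => i = a ∨ i = b) with hJ₁
  set J₂ := J.filter (fun i : Fin (r + s) => ¬ (i = a ∨ i = b)) with hJ₂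
  have hJ₂e : letters J₂ * e = e * letters J₂ := by
    have := letters_mul_cls (cupCap_mem hr hs) rfl id J₂ fun i hi => by
      have hi := (List.mem_filter.1 hi).2
      simp only [ha, hb, decide_eq_true_eq, not_or, Fin.ext_iff] at hi
      simp [cupCap, hi.1, hi.2]
    rwa [List.map_id] at this
  have h3 : IsMultiple (letters I * cls u hu * letters J * e)
      (letters I * (cls u hu * (letters J₁ * e)) * letters J₂) := by
    refine ((hJ.mul_left (letters I * cls u hu)).mul_right e).trans (.of_eq ?_)
    show letters I * cls u hu * (letters J₁ * letters J₂) * e = _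
    simp only [mul_assoc, hJ₂e]
  refine IsSplit.of_isMultiple ?_ h3
  refine IsSplit.mul_letters (IsSplit.letters_mul ?_ I) J₂
  rcases isCliffordFamily_letter.prod_mul_of_forall hba J₁
    (fun i hi => by simpa using (List.mem_filter.1 hi).2) with h4 | h4
  · exact (isSplit_cls_mul_cls hu _ h1 rfl).of_isMultiple (h4.mul_left _)
  · exact (isSplit_mul_letter_mul_cupCap hu h1 hr hs).of_isMultiple (h4.mul_left _)

/-- Every word in the generators is split. -/
theorem isSplit_of_mem_closure {x : BeadAlgebra r s}
    (hx : x ∈ Submonoid.closure ({x | ∃ i h h', x = of (transposition (r := r) (s := s) i h h')} ∪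
      {x | ∃ hr hs, x = of (cupCap (r := r) (s := s) hr hs)} ∪ {x | ∃ i, x = of (bead i)})) :
    ∃ h : x ∈ BD' r s, IsSplit (cliffordMk r s ⟨x, h⟩) := by
  induction hx using Submonoid.closure_induction_right with
  | one => exact ⟨one_mem _, by
      have : (⟨1, one_mem _⟩ : BD' r s) = 1 := rfl
      rw [this, map_one]
      exact isSplit_one⟩
  | mul_right x _ y hy ih =>
    obtain ⟨h, ih⟩ := ih
    have hy' : y ∈ BD' r s := Algebra.subset_adjoin hy
    refine ⟨mul_mem h hy', ?_⟩
    have : (⟨x * y, mul_mem h hy'⟩ : BD' r s) = ⟨x, h⟩ * ⟨y, hy'⟩ := rfl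
    rw [this, map_mul]
    obtain (⟨i, h1, h2, rfl⟩ | ⟨hr, hs, rfl⟩) | ⟨i, rfl⟩ := hy
    · exact ih.mul_transposition i h1 h2
    · exact ih.mul_cupCap hr hs
    · have := ih.mul_letters [i]
      rwa [letters_singleton] at this

end BeadAlgebra

namespace BeadAlgebra

open BeadDiagram

variable {r s : ℕ}

/-! ### Reduced representatives -/

/-- A bead at a bottom vertex that is not good sits on a vertical strand and slides to the top
(hence `J'`), or at the right end of a horizontal one and slides to its left end. -/
theorem exists_letters_mul_cls {u : BeadDiagram r s} (h : of u ∈ BD' r s) (hu : u.numBeads = 0)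
    (I : List (Fin (r + s))) : ∃ I' J', (∀ i ∈ I', u.IsGood (false, i)) ∧
      IsMultiple (letters I * cls u h) (letters I' * cls u h * letters J') := by
  induction I with
  | nil => exact ⟨[], [], by simp, .of_eq (by rw [letters_nil, mul_one])⟩
  | cons i I ih =>
    obtain ⟨I', J', h1, h2⟩ := ih
    have h3 : IsMultiple (letters (i :: I) * cls u h)
        (letter i * letters I' * cls u h * letters J') := by
      rw [letters_cons, mul_assoc]
      exact (h2.mul_left _).trans (.of_eq (by simp only [mul_assoc]))
    by_cases hi : u.IsGood (false, i)
    · refine ⟨i :: I', J', ?_, ?_⟩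
      · rintro k (_ | ⟨_, hk⟩)
        · exact hi
        · exact h1 k hk
      · rwa [letters_cons]
    -- All letters of `I'` are good and `i` is not, so it can be moved past `I'`, next to `u`, up to
    -- sign.
    · have h4 := isCliffordFamily_letter.mul_prod (i := i) (l := I') fun h => hi (h1 i h)
      have h5 := h3.trans ((h4.mul_right (cls u h)).mul_right (letters J'))
      change IsMultiple _ (letters I' * letter i * cls u h * letters J') at h5
      rw [mul_assoc (letters I')] at h5
      rcases hp : u.partner (false, i) with ⟨_ | _, k⟩
      · refine ⟨I' ++ [k], J', ?_, ?_⟩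
        · intro l hl
          rcases List.mem_append.1 hl with hl | hl
          · exact h1 l hl
          · rw [List.mem_singleton.1 hl, ← hp]
            exact (u.isGood_partner _).2 hi
        · rw [letters_append, letters_singleton, mul_assoc (letters I'),
            ← letter_mul_eq_letter_mul h hu hp]
          exact h5
      · refine ⟨I', k :: J', h1, ?_⟩
        rw [letter_mul_eq_mul_letter h hu hp] at h5
        rw [letters_cons k]
        simpa only [mul_assoc] using h5

theorem exists_cls_mul_letters {u : BeadDiagram r s} (h : of u ∈ BD' r s) (hu : u.numBeads = 0)
    (J : List (Fin (r + s))) : ∃ J', (∀ j ∈ J', u.IsGood (true, j)) ∧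
      IsMultiple (cls u h * letters J) (cls u h * letters J') := by
  induction J using List.reverseRecOn with
  | nil => exact ⟨[], by simp, .refl _⟩
  | append_singleton J j ih =>
    obtain ⟨J', h1, h2⟩ := ih
    have h3 : IsMultiple (cls u h * letters (J ++ [j])) (cls u h * letters J' * letter j) := by
      rw [letters_append, letters_singleton, ← mul_assoc]
      exact h2.mul_right _
    by_cases hj : u.IsGood (true, j)
    · refine ⟨J' ++ [j], ?_, ?_⟩
      · intro l hl
        rcases List.mem_append.1 hl with hl | hl
        · exact h1 l hl
        · rwa [List.mem_singleton.1 hl]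
      · rwa [letters_append J', letters_singleton, ← mul_assoc]
    · have h4 := isCliffordFamily_letter.prod_mul (i := j) (l := J') fun h => hj (h1 j h)
      rw [mul_assoc] at h3
      have h5 := h3.trans (h4.mul_left (cls u h))
      change IsMultiple _ (cls u h * (letter j * letters J')) at h5
      have hg := (u.isGood_partner _).2 hj
      rcases hp : u.partner (true, j) with ⟨_ | _, k⟩
      -- The top end of a vertical strand is good, so only right ends of horizontal strands remain.
      · exact absurd (.inl ⟨by simp [hp], rfl⟩) hj
      · rw [hp] at hg
        refine ⟨k :: J', ?_, ?_⟩
        · rintro l (_ | ⟨_, hl⟩)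
          · exact hg
          · exact h1 l hl
        · rwa [letters_cons, ← mul_assoc, ← mul_letter_eq_mul_letter h hu hp, mul_assoc]

theorem segment_eq_nil_of_beadless {u : BeadDiagram r s} (hu : u.numBeads = 0)
    (v : BeadVertex r s) : u.segment v = [] := by
  unfold BeadDiagram.segment
  rw [beads_eq_nil hu]
  split_ifs <;> rfl

theorem gamma_of_beadless {u : BeadDiagram r s} (hu : u.numBeads = 0) : u.gamma = 0 := by
  rw [gamma_eq_zero_iff, List.length_eq_zero_iff.1 (u.length_word.trans hu)]
  exact ⟨.nil, fun v => by simp [segment_eq_nil_of_beadless hu v]⟩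

/-- Beads are put on top from left to right; the fourth conclusion records that there is nothing yet
to the right of the last one, as `gamma_addTop` requires. The last conclusion prepares the addition
of the bottom beads. -/
theorem exists_reduced_cls_mul_letters {u : BeadDiagram r s} (h : of u ∈ BD' r s)
    (hu : u.numBeads = 0) (J : List (Fin (r + s))) (hJ : J.Pairwise (· < ·))
    (hg : ∀ j ∈ J, u.IsGood (true, j)) :
    ∃ d, ∃ hd : of d ∈ BD' r s, cls u h * letters J = cls d hd ∧ d.partner = u.partner ∧
      d.gamma = 0 ∧ (∀ i, (∀ j ∈ J, j < i) → d.segment (true, i) = []) ∧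
        ∀ i, d.segment (false, i) = [] := by
  induction J using List.reverseRecOn with
  | nil => exact ⟨u, h, by rw [letters_nil, mul_one], rfl, gamma_of_beadless hu,
      fun i _ => segment_eq_nil_of_beadless hu _, fun i => segment_eq_nil_of_beadless hu _⟩
  | append_singleton J j ih =>
    rw [List.pairwise_append] at hJ
    obtain ⟨d, hd, h1, h2, h3, h4, h5⟩ := ih hJ.1 fun j hj => hg j (by simp [hj])
    have hgj : d.IsGood (true, j) := (isGood_congr h2 _).2 (hg j (by simp))
    have hlt : ∀ k ∈ J, k < j := fun k hk => hJ.2.2 k hk j (by simp)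
    refine ⟨d.addTop j, addTop_mem hd j, ?_, by rw [partner_addTop, h2],
      gamma_addTop h3 hgj fun i hi => h4 i fun k hk => (hlt k hk).trans_le hi, fun i hi => ?_,
      fun i => ?_⟩
    · rw [letters_append, letters_singleton, ← mul_assoc, h1, cls_mul_letter]
    · have hji := hi j (by simp)
      rw [segment_addTop hgj, h4 i fun k hk => (hlt k hk).trans hji,
        if_neg (by simpa using hji.ne')]
      rfl
    · rw [segment_addTop hgj, h5, if_neg (by simp)]
      rfl

/-- Here the factor next to `d` acts first, so beads are added at the bottom from right to left,
each becoming number 1. -/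
theorem exists_reduced_letters_mul {d : BeadDiagram r s} (h : of d ∈ BD' r s)
    (hd : d.gamma = 0) (hseg : ∀ i, d.segment (false, i) = []) (I : List (Fin (r + s)))
    (hI : I.Pairwise (· < ·)) (hg : ∀ i ∈ I, d.IsGood (false, i)) :
    ∃ e, ∃ he : of e ∈ BD' r s, letters I * cls d h = cls e he ∧ e.partner = d.partner ∧
      e.gamma = 0 ∧ ∀ i, (∀ j ∈ I, i < j) → e.segment (false, i) = [] := by
  induction I with
  | nil => exact ⟨d, h, by rw [letters_nil, one_mul], rfl, hd, fun i _ => hseg i⟩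
  | cons j I ih =>
    rw [List.pairwise_cons] at hI
    obtain ⟨e, he, h1, h2, h3, h4⟩ := ih hI.2 fun i hi => hg i (by simp [hi])
    have hgj : e.IsGood (false, j) := (isGood_congr h2 _).2 (hg j (by simp))
    refine ⟨e.addBottom j, addBottom_mem he j, ?_, by rw [partner_addBottom, h2],
      gamma_addBottom h3 hgj fun i hi => h4 i fun k hk => hi.trans_lt (hI.1 k hk), fun i hi => ?_⟩
    · rw [letters_cons, mul_assoc, h1, letter_mul_cls]
    · have hij := hi j (by simp)
      rw [segment_addBottom hgj, h4 i fun k hk => hij.trans (hI.1 k hk),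
        if_neg (by simpa using hij.ne)]
      rfl

/-- Once all letters are at good vertices and strictly increasing below and above `u`, the product
is itself a diagram with `γ = 0`. -/
theorem IsSplit.exists_reduced {q : (cliffordIdeal r s).ringCon.Quotient} (hq : IsSplit q) :
    ∃ d, ∃ hd : of d ∈ BD' r s, d.gamma = 0 ∧ IsMultiple q (cls d hd) := by
  obtain ⟨I, J, u, h, hu, h1⟩ := hq
  obtain ⟨I₁, J₁, hI₁, h2⟩ := exists_letters_mul_cls h hu I
  obtain ⟨J₂, hJ₂, h3⟩ := exists_cls_mul_letters h hu (J₁ ++ J)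
  obtain ⟨I₃, hI₃, hI₃', h4⟩ := isCliffordFamily_letter.exists_sorted I₁
  obtain ⟨J₃, hJ₃, hJ₃', h5⟩ := isCliffordFamily_letter.exists_sorted J₂
  obtain ⟨d, hd, h6, h7, h8, -, h9⟩ := exists_reduced_cls_mul_letters h hu J₃ hJ₃
    fun j hj => hJ₂ j (hJ₃' hj)
  obtain ⟨e, he, h10, -, h11, -⟩ := exists_reduced_letters_mul hd h8 h9 I₃ hI₃
    fun i hi => (isGood_congr h7 _).2 (hI₁ i (hI₃' hi))
  refine ⟨e, he, h11, h1.trans ((h2.mul_right (letters J)).trans ?_)⟩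
  rw [← h10, ← h6, mul_assoc, mul_assoc, ← letters_append]
  exact (h3.mul_left _).trans (((h5.mul_left _).mul_left _).trans (h4.mul_right _))

/-! ### The decomposition `BD' = W + L` and the equality `L = M` -/

/-- The span of the reduced diagrams in `BD'`. -/
noncomputable def reducedSpan (r s : ℕ) : Submodule ℂ (BeadAlgebra r s) :=
  Submodule.span ℂ {x | ∃ d : BeadDiagram r s, of d ∈ BD' r s ∧ d.gamma = 0 ∧ x = of d}

theorem sub_mem_of_isMultiple {x y : BD' r s} (h : IsMultiple (cliffordMk r s x) (cliffordMk r s y)) :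
    ∃ ε : ℤ, (x : BeadAlgebra r s) - (ε : ℂ) • (y : BeadAlgebra r s) ∈ cliffordSubmodule r s := by
  obtain ⟨ε, h⟩ := h
  rw [← map_zsmul, cliffordMk_eq_iff, ← Int.cast_smul_eq_zsmul ℂ] at h
  exact ⟨ε, _, h, rfl⟩

theorem mem_reducedSpan_sup_of_mem_closure {x : BeadAlgebra r s}
    (hx : x ∈ Submonoid.closure ({x | ∃ i h h', x = of (transposition (r := r) (s := s) i h h')} ∪
      {x | ∃ hr hs, x = of (cupCap (r := r) (s := s) hr hs)} ∪ {x | ∃ i, x = of (bead i)})) :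
    x ∈ reducedSpan r s ⊔ cliffordSubmodule r s := by
  obtain ⟨h, hs⟩ := isSplit_of_mem_closure hx
  obtain ⟨d, hd, hγ, he⟩ := hs.exists_reduced
  obtain ⟨ε, h1⟩ := sub_mem_of_isMultiple he
  have h2 : (ε : ℂ) • of d ∈ reducedSpan r s :=
    Submodule.smul_mem _ _ (Submodule.subset_span ⟨d, hd, hγ, rfl⟩)
  have := Submodule.add_mem_sup h2 h1
  rwa [add_sub_cancel] at this

theorem mem_reducedSpan_sup {x : BeadAlgebra r s} (hx : x ∈ BD' r s) :
    x ∈ reducedSpan r s ⊔ cliffordSubmodule r s := by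
  rw [← Subalgebra.mem_toSubmodule, BD', Algebra.adjoin_eq_span] at hx
  exact Submodule.span_le.2 (fun y hy => mem_reducedSpan_sup_of_mem_closure hy) hx

theorem reduceHom_of_mem_reducedSpan {x : BeadAlgebra r s} (hx : x ∈ reducedSpan r s) :
    reduceHom r s x = x := by
  unfold reducedSpan at hx
  induction hx using Submodule.span_induction with
  | mem x hx =>
    obtain ⟨d, _, h, rfl⟩ := hx
    exact reduceHom_of_gamma h
  | zero => exact map_zero _
  | add x y _ _ hx hy => rw [map_add, hx, hy]
  | smul c x _ hx => rw [map_smul, hx]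

/-- In `x = w + l` the projection fixes `w` and kills `l`, so the difference is `l`. This recovers
the sign that was left open in the reduction of words. -/
theorem sub_reduceHom_mem {x : BeadAlgebra r s} (hx : x ∈ BD' r s) :
    x - reduceHom r s x ∈ cliffordSubmodule r s := by
  obtain ⟨w, hw, l, hl, rfl⟩ := Submodule.mem_sup.1 (mem_reducedSpan_sup hx)
  rw [map_add, reduceHom_of_mem_reducedSpan hw, reduceHom_eq_zero_of_mem hl, add_zero,
    add_sub_cancel_left]
  exact hl

/-- Every product of generators is a diagram or zero. -/
theorem eq_zero_or_eq_of_of_mem_closure {x : BeadAlgebra r s}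
    (hx : x ∈ Submonoid.closure ({x | ∃ i h h', x = of (transposition (r := r) (s := s) i h h')} ∪
      {x | ∃ hr hs, x = of (cupCap (r := r) (s := s) hr hs)} ∪ {x | ∃ i, x = of (bead i)})) :
    x = 0 ∨ ∃ d, x = of d := by
  induction hx using Submonoid.closure_induction with
  | mem x hx => obtain (⟨_, _, _, rfl⟩ | ⟨_, _, rfl⟩) | ⟨_, rfl⟩ := hx <;> exact .inr ⟨_, rfl⟩
  | one => exact .inr ⟨1, rfl⟩
  | mul x y _ _ hx hy =>
    rcases hx with rfl | ⟨d, rfl⟩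
    · exact .inl (zero_mul y)
    · rcases hy with rfl | ⟨e, rfl⟩
      · exact .inl (mul_zero _)
      · rw [of_mul_of]
        cases d.mul e with
        | none => exact .inl rfl
        | some f => exact .inr ⟨f, rfl⟩

/-- By linearity it suffices to treat products of generators, and these are zero or diagrams. -/
theorem sub_reduceHom_mem_reductionSpan {x : BeadAlgebra r s} (hx : x ∈ BD' r s) :
    x - reduceHom r s x ∈ reductionSpan r s := by
  rw [← Subalgebra.mem_toSubmodule, BD', Algebra.adjoin_eq_span] at hx
  induction hx using Submodule.span_induction with
  | mem x hx =>
    rcases eq_zero_or_eq_of_of_mem_closure hx with rfl | ⟨d, rfl⟩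
    · rw [map_zero, sub_zero]
      exact zero_mem _
    · rw [← reduction_eq]
      exact Submodule.subset_span ⟨d, (isSplit_of_mem_closure hx).1, rfl⟩
  | zero =>
    rw [map_zero, sub_zero]
    exact zero_mem _
  | add x y _ _ hx hy =>
    rw [map_add, add_sub_add_comm]
    exact add_mem hx hy
  | smul c x _ hx =>
    rw [map_smul, ← smul_sub]
    exact Submodule.smul_mem _ _ hx

theorem cliffordSubmodule_le {x : BeadAlgebra r s} (hx : x ∈ cliffordSubmodule r s) :
    x ∈ BD' r s := by
  obtain ⟨y, _, rfl⟩ := hx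
  exact y.2

theorem reduction_mem {d : BeadDiagram r s} (h : of d ∈ BD' r s) :
    reduction d ∈ cliffordSubmodule r s := by
  rw [reduction_eq]
  exact sub_reduceHom_mem h

theorem cliffordSubmodule_eq_reductionSpan (r s : ℕ) :
    cliffordSubmodule r s = reductionSpan r s := by
  apply le_antisymm
  · intro x hx
    have := sub_reduceHom_mem_reductionSpan (cliffordSubmodule_le hx)
    rwa [reduceHom_eq_zero_of_mem hx, sub_zero] at this
  · refine Submodule.span_le.2 ?_
    rintro _ ⟨d, hd, rfl⟩
    exact reduction_mem hd

/-! ### The basis of `L` -/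

theorem reduction_eq_zero {d : BeadDiagram r s} (h : d.gamma = 0) : reduction d = 0 := by
  rw [reduction_eq, reduceHom_of_gamma h, sub_self]

-- The coordinate projection `π` onto the diagrams of `BD'` with `γ ≥ 1` kills every `d̃`, so it
-- maps the family to the standard basis.
open scoped Classical in
theorem linearIndependent_reduction (r s : ℕ) :
    LinearIndependent ℂ fun
      d : {d : BeadDiagram r s // of d ∈ BD' r s ∧ 1 ≤ d.gamma} => reduction d.1 := by
  let π : BeadAlgebra r s →ₗ[ℂ]
      ({d : BeadDiagram r s // of d ∈ BD' r s ∧ 1 ≤ d.gamma} →₀ ℂ) :=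
    (Finsupp.lsubtypeDomain {d : BeadDiagram r s | of d ∈ BD' r s ∧ 1 ≤ d.gamma} :
      (BeadDiagram r s →₀ ℂ) →ₗ[ℂ] _)
  refine LinearIndependent.of_comp π ?_
  have : (π ∘ fun d : {d : BeadDiagram r s // of d ∈ BD' r s ∧ 1 ≤ d.gamma} => reduction d.1) =
      fun d => Finsupp.single d 1 := by
    funext d
    have h1 : π (of d.1) = Finsupp.single d 1 := by
      ext e
      show (Finsupp.single d.1 (1 : ℂ)) e.1 = _
      rw [Finsupp.single_apply, Finsupp.single_apply]
      simp only [Subtype.ext_iff]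
    have h2 : π (of d.1.reduce) = 0 := by
      ext e
      show (Finsupp.single d.1.reduce (1 : ℂ)) e.1 = 0
      refine Finsupp.single_eq_of_ne fun h => ?_
      have h3 := e.2.2
      rw [h, gamma_reduce] at h3
      omega
    show π (reduction d.1) = _
    rw [reduction, map_sub, map_smul, h1, h2, smul_zero, sub_zero]
  rw [this]
  exact Finsupp.linearIndependent_single_one ℂ _

/-- A basis of a submodule from linearly independent vectors that span it. -/
theorem exists_basis_of_span_eq {M ι : Type} [AddCommGroup M] [Module ℂ M] (N : Submodule ℂ M)
    (v : ι → M) (hv : LinearIndependent ℂ v) (h : Submodule.span ℂ (Set.range v) = N) :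
    ∃ b : Module.Basis ι ℂ N, ∀ i, (b i : M) = v i := by
  subst h
  exact ⟨.span hv, fun i => congrArg Subtype.val (Module.Basis.span_apply hv i)⟩

theorem span_range_reduction (r s : ℕ) :
    Submodule.span ℂ (Set.range fun d : {d : BeadDiagram r s // of d ∈ BD' r s ∧ 1 ≤ d.gamma} =>
      reduction d.1) = cliffordSubmodule r s := by
  rw [cliffordSubmodule_eq_reductionSpan]
  refine le_antisymm (Submodule.span_le.2 ?_) (Submodule.span_le.2 ?_)
  · rintro _ ⟨d, rfl⟩
    exact Submodule.subset_span ⟨d.1, d.2.1, rfl⟩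
  · rintro _ ⟨d, hd, rfl⟩
    by_cases h : d.gamma = 0
    · rw [reduction_eq_zero h]
      exact zero_mem _
    · exact Submodule.subset_span ⟨⟨d, hd, by omega⟩, rfl⟩

theorem exists_basis_reduction (r s : ℕ) :
    ∃ b : Module.Basis {d : BeadDiagram r s // of d ∈ BD' r s ∧ 1 ≤ d.gamma} ℂ
        (cliffordSubmodule r s),
      ∀ d, (b d : BeadAlgebra r s) = reduction d.1 :=
  exists_basis_of_span_eq _ _ (linearIndependent_reduction r s) (span_range_reduction r s)

end BeadAlgebra

theorem mainTheorem12 (r s : ℕ) :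
    BeadAlgebra.cliffordSubmodule r s = BeadAlgebra.reductionSpan r s ∧
      ∃ b : Module.Basis {d : BeadDiagram r s // BeadAlgebra.of d ∈ BeadAlgebra.BD' r s ∧ 1 ≤ d.gamma}
          ℂ (BeadAlgebra.cliffordSubmodule r s),
        ∀ d, (b d : BeadAlgebra r s) = BeadAlgebra.reduction d.1 :=
  ⟨BeadAlgebra.cliffordSubmodule_eq_reductionSpan r s, BeadAlgebra.exists_basis_reduction r s⟩
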